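/- For $n\in\mathbb N_0$ let $(x)_n=x(x+1)\cdots(x+n-1)$, and for a complex index $s$ let $(x)_s=\Gamma(x+s)/\Gamma(x)$. Let $G=\sum_{n\ge0}\frac{(-1)^n}{(2n+1)^2}$ be Catalan's constant. For $a\in\mathbb C\setminus\{-1,-2,-3,\dots\}$ put $$f(a)=\sum_{n=0}^{\infty}\frac{(-1)^n}{2^{10n}}\frac{(a+\frac12)_n^5}{(a+1)_n^5}\,[820(n+a)^2+180(n+a)+13],\qquad g(a)=\sum_{n=0}^{\infty}\frac{1}{2^{6n}}\frac{(a+\frac12)_n^3}{(a+1)_n^3}\,[42(n+a)+5].$$ Both series converge for these $a$, $f$ is holomorphic on $\mathbb C\setminus\{-1,-2,\dots\}$, and the following hold, including the convergence of every series that occurs. (i) For $\operatorname{Re}a>0$, $$f(a)=128a\sum_{n=0}^{\infty}\frac{(a+\frac12)_n^4}{(2a+1)_n^4}(4n+6a+1).$$ (ii) For $a\notin\{-1,-2,\dots\}$ with $\cos\pi a\ne0$, $$f(a)=\frac8\pi\cdot\frac{16^a}{\cos\pi a}\cdot\frac{(1)_a^2}{(\frac12)_a^2}\,g(a)+\frac{2048a^3}{2a-1}\sum_{n=0}^{\infty}\frac{(\frac12+a)_n^3}{(2a+1)_n^2(\frac32-a)_n}.$$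 (iii) For $a\notin\{-1,-2,\dots\}$ with $\cos\pi a\ne0$ and $\operatorname{Re}a<\frac12$, $$f(a)=\frac{128}{\pi^2}\cdot\frac{1024^a}{\cos^3\pi a}\cdot\frac{(1)_a^5}{(\frac12)_a^5}+\frac{1024}{\pi}\cdot\frac{16^a}{\cos\pi a}\cdot\frac{(1)_a^2}{(\frac12)_a^2}\cdot\frac{a^2}{2a-1}\sum_{n=0}^{\infty}\frac{(a+\frac12)_n^2}{(2a+1)_n(\frac32-a)_n}+\frac{2048a^3}{2a-1}\sum_{n=0}^{\infty}\frac{(\frac12+a)_n^3}{(2a+1)_n^2(\frac32-a)_n}.$$ Moreover $f(\tfrac12)=256\,\zeta(3)$; $\displaystyle\sum_{n=0}^\infty\frac{\binom{2n}{n}^2}{16^n(2n+1)}=\frac{4G}{\pi}$ and $$\lim_{a\to0}\left[\frac{f(a)}{a^3}-\frac8\pi\cdot\frac{16^a}{\cos\pi a}\cdot\frac{(1)_a^2}{(\frac12)_a^2}\cdot\frac{g(a)}{a^3}\right]=-2048\sum_{n=0}^\infty\frac{\binom{2n}{n}^2}{16^n(2n+1)}=-\frac{8192\,G}{\pi};$$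 and $$f(0)=\frac{128}{\pi^2},\qquad f'(0)=\frac{2560}{\pi^2}\ln2,\qquad f''(0)=\frac{2560}{3\pi^2}\left(60\ln^22-\pi^2\right).$$ -/

import Mathlib

open Filter Topology

namespace RamanujanExt

noncomputable section

/-- The rising factorial `(x)_n = x (x + 1) ⋯ (x + n - 1)` for a natural number `n`. -/
def rising (x : ℂ) (n : ℕ) : ℂ := (ascPochhammer ℂ n).eval x

/-- The rising factorial `(x)_s = Γ(x + s) / Γ(x)` for a complex index `s`. -/
def risingC (x s : ℂ) : ℂ := Complex.Gamma (x + s) / Complex.Gamma x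

/-- The parameters for which the series below are defined: `a` is not one of `-1, -2, -3, …`. -/
def domain : Set ℂ := {a | ∀ m : ℕ, a ≠ -((m : ℂ) + 1)}

/-- The `n`-th term of the series `f(a)`. -/
def fTerm (a : ℂ) (n : ℕ) : ℂ :=
  (-1) ^ n / 2 ^ (10 * n) * (rising (a + 1 / 2) n ^ 5 / rising (a + 1) n ^ 5) *
    (820 * ((n : ℂ) + a) ^ 2 + 180 * ((n : ℂ) + a) + 13)

/-- The function `f(a)`. -/
def f (a : ℂ) : ℂ := ∑' n : ℕ, fTerm a n

/-- The `n`-th term of the series `g(a)`. -/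
def gTerm (a : ℂ) (n : ℕ) : ℂ :=
  1 / 2 ^ (6 * n) * (rising (a + 1 / 2) n ^ 3 / rising (a + 1) n ^ 3) *
    (42 * ((n : ℂ) + a) + 5)

/-- The function `g(a)`. -/
def g (a : ℂ) : ℂ := ∑' n : ℕ, gTerm a n

/-- The `n`-th term of the series in the first form of `f(a)`. -/
def firstTerm (a : ℂ) (n : ℕ) : ℂ :=
  rising (a + 1 / 2) n ^ 4 / rising (2 * a + 1) n ^ 4 * (4 * (n : ℂ) + 6 * a + 1)

/-- The `n`-th term of the series with a cube in the numerator (second and third forms). -/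
def cubeTerm (a : ℂ) (n : ℕ) : ℂ :=
  rising (1 / 2 + a) n ^ 3 / (rising (2 * a + 1) n ^ 2 * rising (3 / 2 - a) n)

/-- The `n`-th term of the series with a square in the numerator (third form). -/
def squareTerm (a : ℂ) (n : ℕ) : ℂ :=
  rising (a + 1 / 2) n ^ 2 / (rising (2 * a + 1) n * rising (3 / 2 - a) n)

/-- Catalan's constant `G = 1 - 1/3² + 1/5² - ⋯`. -/
def catalanG : ℝ := ∑' n : ℕ, (-1) ^ n / (2 * (n : ℝ) + 1) ^ 2

/-- The terms `binom(2n, n)² / (16ⁿ (2n + 1))`. -/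
def binomTerm (n : ℕ) : ℝ := ((2 * n).choose n : ℝ) ^ 2 / (16 ^ n * (2 * (n : ℝ) + 1))

end

end RamanujanExt

namespace RamanujanExt

/-! ### Rising factorials -/

/-! Splitting off the first term shows that `f` solves f(a) = 820a² + 180a + 13 + r(a) f(a + 1), and
`g` solves g(a) = 42a + 5 + s(a) g(a + 1), with `rFactor` and `sFactor` as r and s. The other series
satisfy the same kind of recurrence for a deeper reason. Each is a sum over k of a hypergeometric
term F(a, k), and F(a, k) - r(a) F(a + 1, k) (or the same with s) is a difference T(k) - T(k + 1)
with an explicit rational certificate T/F (Zeilberger's method). Summing over k gives the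
recurrence, up to the limit of T at infinity. Once Re a ≥ 1 the shifted terms shrink by a factor
1/2, so iterating a ↦ a + 1 leaves no remainder and identifies the sums
(`tendsto_sum_of_recurrence`).

First form: T tends to 0, so the series of `firstTerm` is f (`f_eq_tsum_firstTerm`).

Second form: for `cubeTerm` the limit of T is not 0 but `scale a * (42 * a + 5)`
(`cubeCert_limit_eq`). Since r(a) scale(a + 1) = scale(a) s(a), these boundary terms, accumulated
along the iteration, add up to `scale a * g a` (`f_eq_scale_mul_g_add`).

Third form: it remains to write g through `squareTerm`. That series converges only for Re a < 1/2,
so it cannot be iterated to the right. Instead g is first written as the series of `ratioTerm` for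
Re a > 0. For real a in (0, 1/2) a relation between two ₃F₂(1) series, obtained from complementary
incomplete beta integrals (`three_term_relation`), links `ratioTerm`, `squareTerm` and a Gamma
product. The identity theorem carries the result to the strip -1 < Re a < 1/2, and the recurrences
carry it further left (`g_eq_gammaPart_add`).

Special values: at a = 1/2 the first form is a multiple of ζ(3). The limit at 0 is the value of the
`cubeTerm` series there, computed from the arcsine series, Wallis integrals and ∫ θ/sin θ = 2G. The
derivatives at 0 come from the third form times cos³(πa), which is a Gamma quotient plus a² times an
analytic function. -/

@[simp] theorem rising_zero (x : ℂ) : rising x 0 = 1 := by simp [rising]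

theorem rising_succ (x : ℂ) (n : ℕ) : rising x (n + 1) = rising x n * (x + n) := by
  simp [rising, ascPochhammer_succ_eval]

theorem rising_succ_left (x : ℂ) (n : ℕ) : rising x (n + 1) = x * rising (x + 1) n := by
  simp [rising, ascPochhammer_succ_left, Polynomial.eval_comp]

theorem rising_eq_prod (x : ℂ) (n : ℕ) : rising x n = ∏ j ∈ Finset.range n, (x + j) := by
  induction n with
  | zero => simp
  | succ n ih => rw [rising_succ, ih, Finset.prod_range_succ]

theorem rising_ne_zero {x : ℂ} (hx : ∀ m : ℕ, x ≠ -m) (n : ℕ) : rising x n ≠ 0 := by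
  rw [rising_eq_prod, Finset.prod_ne_zero_iff]
  intro j _ h
  exact hx j (eq_neg_of_add_eq_zero_left h)

theorem rising_add_one {x : ℂ} (hx : x ≠ 0) (n : ℕ) :
    rising (x + 1) n = rising x n * ((x + n) / x) := by
  have h := rising_succ_left x n
  rw [rising_succ] at h
  field_simp
  rw [h, mul_comm]

theorem natCast_cpow_ne_zero {n : ℕ} (hn : n ≠ 0) (s : ℂ) : (n : ℂ) ^ s ≠ 0 := by
  simp [Complex.cpow_eq_zero_iff, hn]

/-- Euler's limit formula for Γ. Its product has n + 1 factors, hence the index n + 1. -/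
theorem tendsto_rising_succ_div {x : ℂ} (hx : ∀ m : ℕ, x ≠ -m) :
    Tendsto (fun n : ℕ => rising x (n + 1) / ((n : ℂ) ^ x * n.factorial)) atTop
      (𝓝 (Complex.Gamma x)⁻¹) := by
  refine ((Complex.GammaSeq_tendsto_Gamma x).inv₀ (Complex.Gamma_ne_zero hx)).congr fun n => ?_
  rw [Complex.GammaSeq, rising_eq_prod, inv_div]

/-- `(x)_n / (y)_n ~ Γ(y) / Γ(x) · n ^ (x - y)`. -/
theorem tendsto_rising_div_rising {x y : ℂ} (hx : ∀ m : ℕ, x ≠ -m) (hy : ∀ m : ℕ, y ≠ -m) :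
    Tendsto (fun n : ℕ => rising x n / rising y n * (n : ℂ) ^ (y - x)) atTop
      (𝓝 (Complex.Gamma y / Complex.Gamma x)) := by
  have h1 := (tendsto_rising_succ_div hx).div (tendsto_rising_succ_div hy)
    (inv_ne_zero (Complex.Gamma_ne_zero hy))
  -- This factor turns the quotient at index n + 1 back into the quotient at index n.
  have h2 : Tendsto (fun n : ℕ => (y + (n : ℂ)) / (x + n)) atTop (𝓝 1) := by
    have h := tendsto_add_mul_div_add_mul_atTop_nhds (𝕜 := ℂ) y x 1 one_ne_zero
    simpa using h
  have h3 := h1.mul h2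
  have e : (Complex.Gamma x)⁻¹ / (Complex.Gamma y)⁻¹ * 1 = Complex.Gamma y / Complex.Gamma x := by
    rw [mul_one, inv_div_inv]
  rw [e] at h3
  refine h3.congr' ?_
  filter_upwards [eventually_ne_atTop 0] with n hn
  have hn' : (n : ℂ) ≠ 0 := by exact_mod_cast hn
  have hxn : x + n ≠ 0 := fun h => hx n (eq_neg_of_add_eq_zero_left h)
  have hyn : y + n ≠ 0 := fun h => hy n (eq_neg_of_add_eq_zero_left h)
  have := natCast_cpow_ne_zero hn x
  have := natCast_cpow_ne_zero hn y
  have := rising_ne_zero hy n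
  have : (n.factorial : ℂ) ≠ 0 := by exact_mod_cast n.factorial_ne_zero
  simp only [Pi.div_apply]
  rw [rising_succ, rising_succ, Complex.cpow_sub _ _ hn']
  field_simp

theorem isBigO_of_tendsto_mul_cpow {u : ℕ → ℂ} {s L : ℂ}
    (h : Tendsto (fun n : ℕ => u n * (n : ℂ) ^ s) atTop (𝓝 L)) :
    u =O[atTop] fun n : ℕ => (n : ℝ) ^ (-s.re) := by
  obtain ⟨c, hc⟩ := (h.isBigO_one ℝ).bound
  refine Asymptotics.IsBigO.of_bound c ?_
  filter_upwards [hc, eventually_gt_atTop 0] with n hn hn0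
  have hn' : (0 : ℝ) < n := by exact_mod_cast hn0
  have hp : 0 < (n : ℝ) ^ s.re := Real.rpow_pos_of_pos hn' _
  rw [norm_mul, Complex.norm_natCast_cpow_of_pos hn0, norm_one, mul_one] at hn
  rw [Real.rpow_neg hn'.le, norm_inv, Real.norm_of_nonneg hp.le, ← div_eq_mul_inv,
    le_div_iff₀ hp]
  exact hn

theorem summable_of_tendsto_mul_cpow {u : ℕ → ℂ} {s L : ℂ} (hs : 1 < s.re)
    (h : Tendsto (fun n : ℕ => u n * (n : ℂ) ^ s) atTop (𝓝 L)) : Summable u :=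
  summable_of_isBigO_nat (Real.summable_nat_rpow.2 (by linarith)) (isBigO_of_tendsto_mul_cpow h)

theorem tendsto_mul_pow_of_tendsto_mul_cpow {u : ℕ → ℂ} {s L : ℂ} (j : ℕ) (hs : j < s.re)
    (h : Tendsto (fun n : ℕ => u n * (n : ℂ) ^ s) atTop (𝓝 L)) :
    Tendsto (fun n : ℕ => u n * (n : ℂ) ^ j) atTop (𝓝 0) := by
  have h1 : Tendsto (fun n : ℕ => (n : ℂ) ^ ((j : ℂ) - s)) atTop (𝓝 0) := by
    rw [tendsto_zero_iff_norm_tendsto_zero]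
    have h2 : Tendsto (fun n : ℕ => (n : ℝ) ^ (-(s.re - j))) atTop (𝓝 0) :=
      (tendsto_rpow_neg_atTop (by linarith)).comp tendsto_natCast_atTop_atTop
    refine h2.congr' ?_
    filter_upwards [eventually_gt_atTop 0] with n hn
    rw [Complex.norm_natCast_cpow_of_pos hn]
    congr 1
    simp
  have h3 := h.mul h1
  rw [mul_zero] at h3
  refine h3.congr' ?_
  filter_upwards [eventually_ne_atTop 0] with n hn
  have hn' : (n : ℂ) ≠ 0 := by exact_mod_cast hn
  have := natCast_cpow_ne_zero hn s
  rw [Complex.cpow_sub _ _ hn', Complex.cpow_natCast]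
  field_simp

/-! ### Telescoping -/

/-- The limit L matters: it vanishes for three of the certificates, while for `cubeTerm` it is the
source of g. -/
theorem tsum_sub_eq_of_telescoping {u v T : ℕ → ℂ} {L : ℂ} (hu : Summable u) (hv : Summable v)
    (h : ∀ k, u k - v k = T k - T (k + 1)) (hT : Tendsto T atTop (𝓝 L)) :
    ∑' k, u k - ∑' k, v k = T 0 - L := by
  rw [← hu.tsum_sub hv]
  have h1 := (hu.sub hv).hasSum.tendsto_sum_nat
  refine tendsto_nhds_unique h1 ?_
  have h2 : ∀ n, ∑ k ∈ Finset.range n, (u k - v k) = T 0 - T n := fun n => by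
    rw [Finset.sum_congr rfl fun k _ => h k, Finset.sum_range_sub']
  simp only [h2]
  exact tendsto_const_nhds.sub hT

/-- Iterating an inhomogeneous recurrence `V(a) = P(a) + r(a) V(a + 1)` whose solution `V` is given
by a series with terms contracted by the recurrence. -/
theorem tendsto_sum_of_recurrence {a : ℂ} {A : ℕ → ℂ} {r P : ℂ → ℂ} {F : ℂ → ℕ → ℂ}
    (hA0 : A 0 = 1) (hA : ∀ n : ℕ, A (n + 1) = A n * r (a + n))
    (hF : ∀ n : ℕ, Summable (F (a + n)))
    (hrec : ∀ n : ℕ, ∑' k, F (a + n) k = P (a + n) + r (a + n) * ∑' k, F (a + n + 1) k)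
    (hr : ∀ n : ℕ, 1 ≤ (a + n).re → ∀ k, ‖r (a + n) * F (a + n + 1) k‖ ≤ 1 / 2 * ‖F (a + n) k‖) :
    Tendsto (fun N => ∑ n ∈ Finset.range N, A n * P (a + n)) atTop (𝓝 (∑' k, F a k)) := by
  have key : ∀ N : ℕ, ∑ n ∈ Finset.range N, A n * P (a + n)
      = ∑' k, F a k - A N * ∑' k, F (a + N) k := by
    intro N
    induction N with
    | zero => simp [hA0]
    | succ N ih =>
      rw [Finset.sum_range_succ, ih, hA, hrec N]
      push_cast
      rw [← add_assoc]
      ring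
  have hlim : Tendsto (fun N : ℕ => A N * ∑' k, F (a + N) k) atTop (𝓝 0) := by
    -- From index M on, Re (a + n) ≥ 1, and the remainder is dominated by a geometric sequence times
    -- one fixed convergent series.
    obtain ⟨M, hM⟩ := exists_nat_ge (1 - a.re)
    have hM' : ∀ n : ℕ, 1 ≤ (a + (M + n : ℕ)).re := fun n => by
      simp; linarith [(Nat.cast_nonneg n : (0 : ℝ) ≤ n)]
    have hstep : ∀ n k : ℕ, ‖A (M + n) * F (a + (M + n : ℕ)) k‖
        ≤ (1 / 2) ^ n * ‖A M * F (a + M) k‖ := by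
      intro n k
      induction n with
      | zero => simp
      | succ n ih =>
        have h1 := hr (M + n) (hM' n) k
        have h2 : A (M + (n + 1)) * F (a + (M + (n + 1) : ℕ)) k
            = A (M + n) * (r (a + (M + n : ℕ)) * F (a + (M + n : ℕ) + 1) k) := by
          rw [← add_assoc M n 1, hA]
          push_cast
          rw [← add_assoc]
          ring_nf
        rw [h2, norm_mul]
        calc ‖A (M + n)‖ * ‖r (a + (M + n : ℕ)) * F (a + (M + n : ℕ) + 1) k‖
            ≤ ‖A (M + n)‖ * (1 / 2 * ‖F (a + (M + n : ℕ)) k‖) := by gcongr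
          _ = 1 / 2 * ‖A (M + n) * F (a + (M + n : ℕ)) k‖ := by rw [norm_mul]; ring
          _ ≤ 1 / 2 * ((1 / 2) ^ n * ‖A M * F (a + M) k‖) := by gcongr
          _ = _ := by ring
    have hS : Summable fun k => ‖A M * F (a + M) k‖ := ((hF M).mul_left _).norm
    rw [← tendsto_add_atTop_iff_nat M]
    refine squeeze_zero_norm (a := fun n : ℕ => (1 / 2 : ℝ) ^ n * ∑' k, ‖A M * F (a + M) k‖)
      (fun n => ?_) ?_
    · rw [← tsum_mul_left, ← tsum_mul_left, add_comm n M]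
      exact tsum_of_norm_bounded (hS.mul_left _).hasSum (hstep n)
    · have := (tendsto_pow_atTop_nhds_zero_of_lt_one (r := (1 / 2 : ℝ)) (by norm_num)
        (by norm_num)).mul_const (∑' k, ‖A M * F (a + M) k‖)
      simpa using this
  simp only [key]
  simpa using tendsto_const_nhds.sub hlim

/-- The two conditions on real parts say |Re z| ≤ Re w, in a form that linear arithmetic can supply
even when Re z may be negative. -/
theorem norm_le_norm_of_re_le_of_abs_im_le {z w : ℂ} (h0 : 0 ≤ z.re + w.re) (hre : z.re ≤ w.re)
    (him : |z.im| ≤ |w.im|) : ‖z‖ ≤ ‖w‖ := by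
  rw [Complex.norm_def, Complex.norm_def, Complex.normSq_apply, Complex.normSq_apply]
  apply Real.sqrt_le_sqrt
  have := sq_le_sq.2 him
  nlinarith

/-- The rational factor in `f(a) = (820 a² + 180 a + 13) + r(a) f(a + 1)`. -/
noncomputable def rFactor (a : ℂ) : ℂ := -(1 / 1024) * ((a + 1 / 2) ^ 5 / (a + 1) ^ 5)

/-- The rational factor in `g(a) = (42 a + 5) + s(a) g(a + 1)`. -/
noncomputable def sFactor (a : ℂ) : ℂ := 1 / 64 * ((a + 1 / 2) ^ 3 / (a + 1) ^ 3)

/-! ### Shifts and certificates -/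

theorem ne_neg_nat_of_re_pos {x : ℂ} (hx : 0 < x.re) (m : ℕ) : x ≠ -m := by
  rintro rfl
  simp at hx
  linarith [(Nat.cast_nonneg m : (0 : ℝ) ≤ m)]

theorem add_nat_ne_zero {x : ℂ} (hx : ∀ m : ℕ, x ≠ -m) (k : ℕ) : x + k ≠ 0 :=
  fun h => hx k (eq_neg_of_add_eq_zero_left h)

theorem two_mul_add_two_add_ne_zero {a : ℂ} (h : ∀ m : ℕ, 2 * a + 1 ≠ -m) (k : ℕ) :
    2 * a + 2 + k ≠ 0 := by
  have := add_nat_ne_zero h (k + 1)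
  push_cast at this
  convert this using 1
  ring

theorem two_mul_add_one_ne_zero {a : ℂ} (h : ∀ m : ℕ, 2 * a + 1 ≠ -m) : 2 * a + 1 ≠ 0 := by
  simpa using h 0

theorem two_mul_add_two_ne_zero {a : ℂ} (h : ∀ m : ℕ, 2 * a + 1 ≠ -m) : 2 * a + 2 ≠ 0 := by
  simpa using two_mul_add_two_add_ne_zero h 0

theorem two_mul_add_one_ne_of_re_pos {a : ℂ} (ha : 0 < a.re) (m : ℕ) : 2 * a + 1 ≠ -m :=
  ne_neg_nat_of_re_pos (by simp; linarith) m

theorem rising_shift_half {a : ℂ} (h : 2 * a + 1 ≠ 0) (k : ℕ) :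
    rising (a + 1 + 1 / 2) k = rising (a + 1 / 2) k * (2 * (a + 1 / 2 + k) / (2 * a + 1)) := by
  have e : a + 1 / 2 = (2 * a + 1) / 2 := by ring
  have h' : a + 1 / 2 ≠ 0 := by rw [e]; exact div_ne_zero h two_ne_zero
  rw [show a + 1 + 1 / 2 = a + 1 / 2 + 1 by ring, rising_add_one h']
  congr 1
  rw [div_eq_div_iff h' h]
  ring

theorem rising_shift_two {a : ℂ} (h : 2 * a + 1 ≠ 0) (h' : 2 * a + 2 ≠ 0) (k : ℕ) :
    rising (2 * (a + 1) + 1) k = rising (2 * a + 1) k *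
      ((2 * a + 1 + k) * (2 * a + 2 + k) / ((2 * a + 1) * (2 * a + 2))) := by
  have e : 2 * (a + 1) + 1 = 2 * a + 1 + 1 + 1 := by ring
  have h'' : 2 * a + 1 + 1 ≠ 0 := by convert h' using 1; ring
  rw [e, rising_add_one h'', rising_add_one h]
  have e2 : 2 * a + 1 + 1 = 2 * a + 2 := by ring
  rw [e2]
  field_simp

theorem rising_shift_sub {a : ℂ} (h : 1 / 2 - a ≠ 0) (h' : ∀ k : ℕ, 1 / 2 - a + k ≠ 0) (k : ℕ) :
    rising (3 / 2 - (a + 1)) k = rising (3 / 2 - a) k * ((1 / 2 - a) / (1 / 2 - a + k)) := by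
  have e : 3 / 2 - a = 1 / 2 - a + 1 := by ring
  have e2 : 3 / 2 - (a + 1) = 1 / 2 - a := by ring
  rw [e, e2, rising_add_one h]
  have := h' k
  generalize rising (1 / 2 - a) k = R at *
  generalize 1 / 2 - a = c at *
  field_simp

/-- The numerator of the certificate for `firstTerm`. -/
noncomputable def firstPoly (a k : ℂ) : ℂ :=
  13 + 124 * k + 480 * k ^ 2 + 960 * k ^ 3 + 1040 * k ^ 4 + 576 * k ^ 5 + 128 * k ^ 6 + 284 * a
    + 2264 * a * k + 6656 * a * k ^ 2 + 9344 * a * k ^ 3 + 6336 * a * k ^ 4 + 1664 * a * k ^ 5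
    + 2572 * a ^ 2 + 15200 * a ^ 2 * k + 31488 * a ^ 2 * k ^ 2 + 27904 * a ^ 2 * k ^ 3
    + 9024 * a ^ 2 * k ^ 4 + 11296 * a ^ 3 + 46784 * a ^ 3 * k + 61440 * a ^ 3 * k ^ 2
    + 26112 * a ^ 3 * k ^ 3 + 25648 * a ^ 4 + 67264 * a ^ 4 * k + 42496 * a ^ 4 * k ^ 2
    + 29120 * a ^ 5 + 36736 * a ^ 5 * k + 13120 * a ^ 6

/-- The numerator of the certificate for `cubeTerm`. -/
noncomputable def cubePoly (a k : ℂ) : ℂ :=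
  -26 - 124 * k - 184 * k ^ 2 - 80 * k ^ 3 - 464 * a - 1768 * a * k - 2016 * a * k ^ 2
    - 672 * a * k ^ 3 - 3184 * a ^ 2 - 7632 * a ^ 2 * k - 4320 * a ^ 2 * k ^ 2 - 8000 * a ^ 3
    - 9184 * a ^ 3 * k - 6560 * a ^ 4

/-- The numerator of the certificate for `squareTerm`. -/
noncomputable def squarePoly (a k : ℂ) : ℂ :=
  -10 - 24 * k - 8 * k ^ 2 - 104 * a - 112 * a * k - 168 * a ^ 2

/-- The numerator of the certificate for `ratioTerm`. -/
noncomputable def ratioPoly (a k : ℂ) : ℂ :=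
  5 + 24 * k + 36 * k ^ 2 + 16 * k ^ 3 + 62 * a + 160 * a * k + 104 * a * k ^ 2 + 188 * a ^ 2
    + 224 * a ^ 2 * k + 168 * a ^ 3

/-- The terms of a slowly convergent series for `g`. -/
noncomputable def ratioTerm (a : ℂ) (n : ℕ) : ℂ :=
  rising (a + 1 / 2) n ^ 2 / rising (2 * a + 1) n ^ 2

/-- Once the shifted term is a rational function times the unshifted hypergeometric factor,
telescoping becomes a polynomial identity and the contraction bound a comparison of linear factors.
The shift lemmas for the other terms play the same role. -/
theorem firstTerm_shift {a : ℂ} (h : ∀ m : ℕ, 2 * a + 1 ≠ -m) (k : ℕ) :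
    rFactor a * (128 * (a + 1) * firstTerm (a + 1) k) =
      -((2 * a + 1) ^ 5 * (a + 1 / 2 + k) ^ 4 / ((2 * a + 1 + k) * (2 * a + 2 + k)) ^ 4 *
        (4 * k + 6 * a + 7)) * (rising (a + 1 / 2) k ^ 4 / rising (2 * a + 1) k ^ 4) := by
  have h1 := two_mul_add_one_ne_zero h
  have h2 := two_mul_add_two_ne_zero h
  have h4 := add_nat_ne_zero h k
  have h5 := two_mul_add_two_add_ne_zero h k
  have h6 := rising_ne_zero h k
  rw [firstTerm, rFactor, rising_shift_half h1, rising_shift_two h1 h2]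
  generalize rising (a + 1 / 2) k = R at *
  generalize rising (2 * a + 1) k = D at *
  generalize a + 1 / 2 + (k : ℂ) = B at *
  -- Everything is expressed in the linear forms already known to be nonzero.
  rw [show a + 1 / 2 = (2 * a + 1) / 2 by ring, show a + 1 = (2 * a + 2) / 2 by ring,
    show 4 * (k : ℂ) + 6 * ((2 * a + 2) / 2) + 1 = 4 * k + 6 * a + 7 by ring]
  generalize 2 * a + 1 + (k : ℂ) = X at *
  generalize 2 * a + 2 + (k : ℂ) = Y at *
  generalize 4 * (k : ℂ) + 6 * a + 7 = U at *
  generalize 2 * a + 1 = W at *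
  generalize 2 * a + 2 = V at *
  field_simp
  ring

theorem ratioTerm_shift {a : ℂ} (h : ∀ m : ℕ, 2 * a + 1 ≠ -m) (k : ℕ) :
    sFactor a * (32 * (a + 1) * ratioTerm (a + 1) k) =
      (2 * a + 1) ^ 3 * (a + 1 / 2 + k) ^ 2 / ((2 * a + 1 + k) * (2 * a + 2 + k)) ^ 2 *
        ratioTerm a k := by
  have h1 := two_mul_add_one_ne_zero h
  have h2 := two_mul_add_two_ne_zero h
  have h4 := add_nat_ne_zero h k
  have h5 := two_mul_add_two_add_ne_zero h k
  have h6 := rising_ne_zero h k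
  rw [ratioTerm, ratioTerm, sFactor, rising_shift_half h1, rising_shift_two h1 h2]
  generalize rising (a + 1 / 2) k = R at *
  generalize rising (2 * a + 1) k = D at *
  generalize a + 1 / 2 + (k : ℂ) = B at *
  rw [show a + 1 / 2 = (2 * a + 1) / 2 by ring, show a + 1 = (2 * a + 2) / 2 by ring]
  generalize 2 * a + 1 + (k : ℂ) = X at *
  generalize 2 * a + 2 + (k : ℂ) = Y at *
  generalize 2 * a + 1 = W at *
  generalize 2 * a + 2 = V at *
  field_simp
  ring

theorem sub_add_nat_ne_zero {a : ℂ} (h : ∀ m : ℕ, 1 / 2 - a ≠ -m) (k : ℕ) : 3 / 2 - a + k ≠ 0 := by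
  have := add_nat_ne_zero h (k + 1)
  push_cast at this
  convert this using 1
  ring

theorem three_half_sub_ne {a : ℂ} (h : ∀ m : ℕ, 1 / 2 - a ≠ -m) (m : ℕ) : 3 / 2 - a ≠ -m :=
  fun e => sub_add_nat_ne_zero h m (by rw [e]; ring)

theorem two_mul_sub_one_ne_zero {a : ℂ} (h : ∀ m : ℕ, 1 / 2 - a ≠ -m) : 2 * a - 1 ≠ 0 := by
  intro e
  refine h 0 ?_
  push_cast
  linear_combination -e / 2

theorem cubeTerm_shift {a : ℂ} (h : ∀ m : ℕ, 2 * a + 1 ≠ -m) (h' : ∀ m : ℕ, 1 / 2 - a ≠ -m)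
    (k : ℕ) :
    rFactor a * (2048 * (a + 1) ^ 3 / (2 * (a + 1) - 1) * cubeTerm (a + 1) k) =
      4 * (2 * a + 1) ^ 3 * (a + 1 / 2 + k) ^ 3 * (1 / 2 - a + k) /
        (((2 * a + 1 + k) * (2 * a + 2 + k)) ^ 2 * (2 * a - 1)) * cubeTerm a k := by
  have h1 := two_mul_add_one_ne_zero h
  have h2 := two_mul_add_two_ne_zero h
  have h3 := two_mul_sub_one_ne_zero h'
  have h4 := add_nat_ne_zero h k
  have h5 := two_mul_add_two_add_ne_zero h k
  have h6 := rising_ne_zero h k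
  have h7 := rising_ne_zero (three_half_sub_ne h') k
  have h8 := add_nat_ne_zero h' k
  have h9 : 1 / 2 - a ≠ 0 := by simpa using h' 0
  rw [cubeTerm, cubeTerm, rFactor, add_comm (1 / 2 : ℂ), add_comm (1 / 2 : ℂ), rising_shift_half h1,
    rising_shift_two h1 h2, rising_shift_sub h9 (add_nat_ne_zero h')]
  generalize rising (a + 1 / 2) k = R at *
  generalize rising (2 * a + 1) k = D at *
  generalize rising (3 / 2 - a) k = E at *
  generalize a + 1 / 2 + (k : ℂ) = B at *
  generalize 1 / 2 - a + (k : ℂ) = C at *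
  rw [show a + 1 / 2 = (2 * a + 1) / 2 by ring, show 1 / 2 - a = -(2 * a - 1) / 2 by ring,
    show a + 1 = (2 * a + 2) / 2 by ring, show 2 * ((2 * a + 2) / 2) - 1 = 2 * a + 1 by ring]
  generalize 2 * a + 1 + (k : ℂ) = X at *
  generalize 2 * a + 2 + (k : ℂ) = Y at *
  generalize 2 * a + 1 = W at *
  generalize 2 * a + 2 = V at *
  generalize 2 * a - 1 = M at *
  field_simp
  ring

theorem squareTerm_shift {a : ℂ} (h : ∀ m : ℕ, 2 * a + 1 ≠ -m) (h' : ∀ m : ℕ, 1 / 2 - a ≠ -m)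
    (k : ℕ) :
    sFactor a * (128 * (a + 1) ^ 2 / (2 * (a + 1) - 1) * squareTerm (a + 1) k) =
      -(4 * (2 * a + 1) * (a + 1 / 2 + k) ^ 2 * (1 / 2 - a + k) /
        ((2 * a + 1 + k) * (2 * a + 2 + k) * (2 * a - 1))) * squareTerm a k := by
  have h1 := two_mul_add_one_ne_zero h
  have h2 := two_mul_add_two_ne_zero h
  have h3 := two_mul_sub_one_ne_zero h'
  have h4 := add_nat_ne_zero h k
  have h5 := two_mul_add_two_add_ne_zero h k
  have h6 := rising_ne_zero h k
  have h7 := rising_ne_zero (three_half_sub_ne h') k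
  have h8 := add_nat_ne_zero h' k
  have h9 : 1 / 2 - a ≠ 0 := by simpa using h' 0
  rw [squareTerm, squareTerm, sFactor, rising_shift_half h1,
    rising_shift_two h1 h2, rising_shift_sub h9 (add_nat_ne_zero h')]
  generalize rising (a + 1 / 2) k = R at *
  generalize rising (2 * a + 1) k = D at *
  generalize rising (3 / 2 - a) k = E at *
  generalize a + 1 / 2 + (k : ℂ) = B at *
  generalize 1 / 2 - a + (k : ℂ) = C at *
  rw [show a + 1 / 2 = (2 * a + 1) / 2 by ring, show 1 / 2 - a = -(2 * a - 1) / 2 by ring,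
    show a + 1 = (2 * a + 2) / 2 by ring, show 2 * ((2 * a + 2) / 2) - 1 = 2 * a + 1 by ring]
  generalize 2 * a + 1 + (k : ℂ) = X at *
  generalize 2 * a + 2 + (k : ℂ) = Y at *
  generalize 2 * a + 1 = W at *
  generalize 2 * a + 2 = V at *
  generalize 2 * a - 1 = M at *
  field_simp
  ring

theorem firstTerm_telescoping {a : ℂ} (h : ∀ m : ℕ, 2 * a + 1 ≠ -m) (k : ℕ) :
    128 * a * firstTerm a k - rFactor a * (128 * (a + 1) * firstTerm (a + 1) k) =
      rising (a + 1 / 2) k ^ 4 / rising (2 * a + 1) k ^ 4 *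
          (firstPoly a k / (2 * a + 1 + k) ^ 4) -
        rising (a + 1 / 2) (k + 1) ^ 4 / rising (2 * a + 1) (k + 1) ^ 4 *
          (firstPoly a (k + 1 : ℕ) / (2 * a + 1 + (k + 1 : ℕ)) ^ 4) := by
  have h4 := add_nat_ne_zero h k
  have h5 := two_mul_add_two_add_ne_zero h k
  have h6 := rising_ne_zero h k
  -- The telescoping relation with the common hypergeometric factor divided out and the denominators
  -- (2a + 1 + k)⁴ (2a + 2 + k)⁴ cleared.
  have hp : 128 * a * (4 * k + 6 * a + 1) * (2 * a + 1 + k) ^ 4 * (2 * a + 2 + k) ^ 4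
      + (2 * a + 1) ^ 5 * (4 * k + 6 * a + 7) * (a + 1 / 2 + k) ^ 4
      = firstPoly a k * (2 * a + 2 + k) ^ 4
        - (a + 1 / 2 + k) ^ 4 * firstPoly a (k + 1) := by
    simp only [firstPoly]; ring
  rw [firstTerm_shift h, firstTerm, rising_succ, rising_succ]
  push_cast
  rw [show 2 * a + 1 + ((k : ℂ) + 1) = 2 * a + 2 + k by ring]
  generalize rising (a + 1 / 2) k = R at *
  generalize rising (2 * a + 1) k = D at *
  generalize firstPoly a k = P at *
  generalize firstPoly a (k + 1) = Q at *
  generalize a + 1 / 2 + (k : ℂ) = B at *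
  generalize 2 * a + 1 + (k : ℂ) = X at *
  generalize 2 * a + 2 + (k : ℂ) = Y at *
  generalize 4 * (k : ℂ) + 6 * a + 1 = U at *
  generalize 4 * (k : ℂ) + 6 * a + 7 = V at *
  generalize 2 * a + 1 = W at *
  field_simp
  linear_combination R ^ 4 * hp

theorem ratioTerm_telescoping {a : ℂ} (h : ∀ m : ℕ, 2 * a + 1 ≠ -m) (k : ℕ) :
    32 * a * ratioTerm a k - sFactor a * (32 * (a + 1) * ratioTerm (a + 1) k) =
      ratioTerm a k * (ratioPoly a k / (2 * a + 1 + k) ^ 2) -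
        ratioTerm a (k + 1) * (ratioPoly a (k + 1 : ℕ) / (2 * a + 1 + (k + 1 : ℕ)) ^ 2) := by
  have h4 := add_nat_ne_zero h k
  have h5 := two_mul_add_two_add_ne_zero h k
  have h6 := rising_ne_zero h k
  have hp : 32 * a * (2 * a + 1 + k) ^ 2 * (2 * a + 2 + k) ^ 2
      - (2 * a + 1) ^ 3 * (a + 1 / 2 + k) ^ 2
      = ratioPoly a k * (2 * a + 2 + k) ^ 2
        - (a + 1 / 2 + k) ^ 2 * ratioPoly a (k + 1) := by
    simp only [ratioPoly]; ring
  rw [ratioTerm_shift h, ratioTerm, ratioTerm, rising_succ, rising_succ]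
  push_cast
  rw [show 2 * a + 1 + ((k : ℂ) + 1) = 2 * a + 2 + k by ring]
  generalize rising (a + 1 / 2) k = R at *
  generalize rising (2 * a + 1) k = D at *
  generalize ratioPoly a k = P at *
  generalize ratioPoly a (k + 1) = Q at *
  generalize a + 1 / 2 + (k : ℂ) = B at *
  generalize 2 * a + 1 + (k : ℂ) = X at *
  generalize 2 * a + 2 + (k : ℂ) = Y at *
  generalize 2 * a + 1 = W at *
  field_simp
  linear_combination R ^ 2 * hp

/-- The certificate carries the factor 1/2 - a + k because at k + 1 it becomes 3/2 - a + k and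
cancels the new factor of (3/2 - a)_{k+1}. The same device serves `squareTerm`. -/
theorem cubeTerm_telescoping {a : ℂ} (h : ∀ m : ℕ, 2 * a + 1 ≠ -m) (h' : ∀ m : ℕ, 1 / 2 - a ≠ -m)
    (k : ℕ) :
    2048 * a ^ 3 / (2 * a - 1) * cubeTerm a k -
        rFactor a * (2048 * (a + 1) ^ 3 / (2 * (a + 1) - 1) * cubeTerm (a + 1) k) =
      cubeTerm a k * (cubePoly a k * (1 / 2 - a + k) / ((2 * a + 1 + k) ^ 2 * (2 * a - 1))) -
        cubeTerm a (k + 1) * (cubePoly a (k + 1 : ℕ) * (1 / 2 - a + (k + 1 : ℕ)) /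
          ((2 * a + 1 + (k + 1 : ℕ)) ^ 2 * (2 * a - 1))) := by
  have h3 := two_mul_sub_one_ne_zero h'
  have h4 := add_nat_ne_zero h k
  have h5 := two_mul_add_two_add_ne_zero h k
  have h6 := rising_ne_zero h k
  have h7 := rising_ne_zero (three_half_sub_ne h') k
  have h8 := sub_add_nat_ne_zero h' k
  have hp : 2048 * a ^ 3 * (2 * a + 1 + k) ^ 2 * (2 * a + 2 + k) ^ 2
      - 4 * (2 * a + 1) ^ 3 * (a + 1 / 2 + k) ^ 3 * (1 / 2 - a + k)
      = cubePoly a k * (1 / 2 - a + k) * (2 * a + 2 + k) ^ 2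
        - (a + 1 / 2 + k) ^ 3 * cubePoly a (k + 1) := by
    simp only [cubePoly]; ring
  rw [cubeTerm_shift h h', cubeTerm, cubeTerm, rising_succ, rising_succ, rising_succ,
    add_comm (1 / 2 : ℂ)]
  push_cast
  rw [show 2 * a + 1 + ((k : ℂ) + 1) = 2 * a + 2 + k by ring,
    show 1 / 2 - a + ((k : ℂ) + 1) = 3 / 2 - a + k by ring]
  generalize rising (a + 1 / 2) k = R at *
  generalize rising (2 * a + 1) k = D at *
  generalize rising (3 / 2 - a) k = E at *
  generalize cubePoly a k = P at *
  generalize cubePoly a (k + 1) = Q at *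
  generalize a + 1 / 2 + (k : ℂ) = B at *
  generalize 1 / 2 - a + (k : ℂ) = C at *
  generalize 3 / 2 - a + (k : ℂ) = C' at *
  generalize 2 * a + 1 + (k : ℂ) = X at *
  generalize 2 * a + 2 + (k : ℂ) = Y at *
  generalize 2 * a + 1 = W at *
  generalize 2 * a - 1 = M at *
  field_simp
  linear_combination R ^ 3 * hp

theorem squareTerm_telescoping {a : ℂ} (h : ∀ m : ℕ, 2 * a + 1 ≠ -m)
    (h' : ∀ m : ℕ, 1 / 2 - a ≠ -m) (k : ℕ) :
    128 * a ^ 2 / (2 * a - 1) * squareTerm a k -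
        sFactor a * (128 * (a + 1) ^ 2 / (2 * (a + 1) - 1) * squareTerm (a + 1) k) =
      squareTerm a k * (squarePoly a k * (1 / 2 - a + k) / ((2 * a + 1 + k) * (2 * a - 1))) -
        squareTerm a (k + 1) * (squarePoly a (k + 1 : ℕ) * (1 / 2 - a + (k + 1 : ℕ)) /
          ((2 * a + 1 + (k + 1 : ℕ)) * (2 * a - 1))) := by
  have h3 := two_mul_sub_one_ne_zero h'
  have h4 := add_nat_ne_zero h k
  have h5 := two_mul_add_two_add_ne_zero h k
  have h6 := rising_ne_zero h k
  have h7 := rising_ne_zero (three_half_sub_ne h') k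
  have h8 := sub_add_nat_ne_zero h' k
  have hp : 128 * a ^ 2 * (2 * a + 1 + k) * (2 * a + 2 + k)
      + 4 * (2 * a + 1) * (a + 1 / 2 + k) ^ 2 * (1 / 2 - a + k)
      = squarePoly a k * (1 / 2 - a + k) * (2 * a + 2 + k)
        - (a + 1 / 2 + k) ^ 2 * squarePoly a (k + 1) := by
    simp only [squarePoly]; ring
  rw [squareTerm_shift h h', squareTerm, squareTerm, rising_succ, rising_succ, rising_succ]
  push_cast
  rw [show 2 * a + 1 + ((k : ℂ) + 1) = 2 * a + 2 + k by ring,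
    show 1 / 2 - a + ((k : ℂ) + 1) = 3 / 2 - a + k by ring]
  generalize rising (a + 1 / 2) k = R at *
  generalize rising (2 * a + 1) k = D at *
  generalize rising (3 / 2 - a) k = E at *
  generalize squarePoly a k = P at *
  generalize squarePoly a (k + 1) = Q at *
  generalize a + 1 / 2 + (k : ℂ) = B at *
  generalize 1 / 2 - a + (k : ℂ) = C at *
  generalize 3 / 2 - a + (k : ℂ) = C' at *
  generalize 2 * a + 1 + (k : ℂ) = X at *
  generalize 2 * a + 2 + (k : ℂ) = Y at *
  generalize 2 * a + 1 = W at *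
  generalize 2 * a - 1 = M at *
  field_simp
  linear_combination R ^ 2 * hp

/-! ### Asymptotics of the terms -/

theorem add_half_ne {a : ℂ} (h : ∀ m : ℕ, 2 * a + 1 ≠ -m) (m : ℕ) : a + 1 / 2 ≠ -m := by
  intro e
  refine h (2 * m) ?_
  push_cast
  linear_combination 2 * e

theorem tendsto_rising_ratio {a : ℂ} (h : ∀ m : ℕ, 2 * a + 1 ≠ -m) :
    Tendsto (fun n : ℕ => rising (a + 1 / 2) n / rising (2 * a + 1) n * (n : ℂ) ^ (a + 1 / 2)) atTop
      (𝓝 (Complex.Gamma (2 * a + 1) / Complex.Gamma (a + 1 / 2))) := by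
  convert tendsto_rising_div_rising (add_half_ne h) h using 5
  ring

theorem tendsto_rising_ratio_sub {a : ℂ} (h : ∀ m : ℕ, 2 * a + 1 ≠ -m)
    (h' : ∀ m : ℕ, 1 / 2 - a ≠ -m) :
    Tendsto (fun n : ℕ => rising (a + 1 / 2) n / rising (3 / 2 - a) n * (n : ℂ) ^ (1 - 2 * a)) atTop
      (𝓝 (Complex.Gamma (3 / 2 - a) / Complex.Gamma (a + 1 / 2))) := by
  have e : 1 - 2 * a = 3 / 2 - a - (a + 1 / 2) := by ring
  rw [e]
  exact tendsto_rising_div_rising (add_half_ne h) (three_half_sub_ne h')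

/-- Passing to the limit in a function of `1 / n`. -/
theorem tendsto_of_eq_comp_inv {u : ℕ → ℂ} {Φ : ℂ → ℂ} (hΦ : ContinuousAt Φ 0)
    (h : ∀ n : ℕ, (n : ℂ) ≠ 0 → u n = Φ (1 / n)) : Tendsto u atTop (𝓝 (Φ 0)) := by
  refine (hΦ.tendsto.comp (tendsto_const_div_atTop_nhds_zero_nat (1 : ℂ))).congr' ?_
  filter_upwards [eventually_ne_atTop 0] with n hn
  exact (h n (by exact_mod_cast hn)).symm

theorem tendsto_fourth_power {a : ℂ} (h : ∀ m : ℕ, 2 * a + 1 ≠ -m) :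
    Tendsto (fun n : ℕ => rising (a + 1 / 2) n ^ 4 / rising (2 * a + 1) n ^ 4 *
      (n : ℂ) ^ (4 * a + 2)) atTop
      (𝓝 ((Complex.Gamma (2 * a + 1) / Complex.Gamma (a + 1 / 2)) ^ 4)) := by
  refine ((tendsto_rising_ratio h).pow 4).congr fun n => ?_
  rw [mul_pow, div_pow, ← Complex.cpow_nat_mul]
  congr 2
  push_cast
  ring

theorem tendsto_ratioTerm {a : ℂ} (h : ∀ m : ℕ, 2 * a + 1 ≠ -m) :
    Tendsto (fun n : ℕ => ratioTerm a n * (n : ℂ) ^ (2 * a + 1)) atTop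
      (𝓝 ((Complex.Gamma (2 * a + 1) / Complex.Gamma (a + 1 / 2)) ^ 2)) := by
  refine ((tendsto_rising_ratio h).pow 2).congr fun n => ?_
  rw [mul_pow, div_pow, ← Complex.cpow_nat_mul, ratioTerm]
  congr 2
  push_cast
  ring

/-- The decay exponent 3/2 - a is what restricts the third form to Re a < 1/2. -/
theorem tendsto_squareTerm {a : ℂ} (h : ∀ m : ℕ, 2 * a + 1 ≠ -m) (h' : ∀ m : ℕ, 1 / 2 - a ≠ -m) :
    Tendsto (fun n : ℕ => squareTerm a n * (n : ℂ) ^ (3 / 2 - a)) atTop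
      (𝓝 (Complex.Gamma (2 * a + 1) / Complex.Gamma (a + 1 / 2) *
        (Complex.Gamma (3 / 2 - a) / Complex.Gamma (a + 1 / 2)))) := by
  refine ((tendsto_rising_ratio h).mul (tendsto_rising_ratio_sub h h')).congr' ?_
  filter_upwards [eventually_ne_atTop 0] with n hn
  have hn' : (n : ℂ) ≠ 0 := by exact_mod_cast hn
  have e : (n : ℂ) ^ (3 / 2 - a) = (n : ℂ) ^ (a + 1 / 2) * (n : ℂ) ^ (1 - 2 * a) := by
    rw [← Complex.cpow_add _ _ hn']
    congr 1
    ring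
  rw [e, squareTerm]
  generalize (n : ℂ) ^ (a + 1 / 2) = x
  generalize (n : ℂ) ^ (1 - 2 * a) = y
  ring

/-- The exponents 2(a + 1/2) and 1 - 2a add up to 2 for every a. Hence the series converges without
restriction on Re a, while a certificate growing like k² has a finite limit that need not vanish. -/
theorem tendsto_cubeTerm {a : ℂ} (h : ∀ m : ℕ, 2 * a + 1 ≠ -m) (h' : ∀ m : ℕ, 1 / 2 - a ≠ -m) :
    Tendsto (fun n : ℕ => cubeTerm a n * (n : ℂ) ^ 2) atTop
      (𝓝 ((Complex.Gamma (2 * a + 1) / Complex.Gamma (a + 1 / 2)) ^ 2 *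
        (Complex.Gamma (3 / 2 - a) / Complex.Gamma (a + 1 / 2)))) := by
  refine (((tendsto_rising_ratio h).pow 2).mul (tendsto_rising_ratio_sub h h')).congr' ?_
  filter_upwards [eventually_ne_atTop 0] with n hn
  have hn' : (n : ℂ) ≠ 0 := by exact_mod_cast hn
  have e : (n : ℂ) ^ 2 = ((n : ℂ) ^ (a + 1 / 2)) ^ 2 * (n : ℂ) ^ (1 - 2 * a) := by
    rw [← Complex.cpow_nat_mul, ← Complex.cpow_add _ _ hn', ← Complex.cpow_natCast]
    congr 1
    push_cast
    ring
  rw [e, cubeTerm, add_comm (1 / 2 : ℂ)]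
  generalize (n : ℂ) ^ (a + 1 / 2) = x
  generalize (n : ℂ) ^ (1 - 2 * a) = y
  ring

theorem summable_firstTerm {a : ℂ} (ha : 0 < a.re) : Summable (firstTerm a) := by
  have h := two_mul_add_one_ne_of_re_pos ha
  have h1 : Tendsto (fun n : ℕ => (4 * (n : ℂ) + 6 * a + 1) / n) atTop (𝓝 4) := by
    have := tendsto_of_eq_comp_inv (u := fun n : ℕ => (4 * (n : ℂ) + 6 * a + 1) / n)
      (Φ := fun x => 4 + (6 * a + 1) * x) (by fun_prop) (fun n hn => by field_simp; ring)
    simpa using this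
  refine summable_of_tendsto_mul_cpow (s := 4 * a + 1) (by simp; linarith)
    (((tendsto_fourth_power h).mul h1).congr' ?_)
  filter_upwards [eventually_ne_atTop 0] with n hn
  have hn' : (n : ℂ) ≠ 0 := by exact_mod_cast hn
  rw [show 4 * a + 2 = 4 * a + 1 + 1 by ring, Complex.cpow_add _ _ hn', Complex.cpow_one, firstTerm]
  field_simp

theorem summable_ratioTerm {a : ℂ} (ha : 0 < a.re) : Summable (ratioTerm a) :=
  summable_of_tendsto_mul_cpow (by simp; linarith)
    (tendsto_ratioTerm (two_mul_add_one_ne_of_re_pos ha))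

theorem summable_squareTerm {a : ℂ} (h : ∀ m : ℕ, 2 * a + 1 ≠ -m) (h' : ∀ m : ℕ, 1 / 2 - a ≠ -m)
    (ha : a.re < 1 / 2) : Summable (squareTerm a) :=
  summable_of_tendsto_mul_cpow (by simp; linarith) (tendsto_squareTerm h h')

theorem summable_cubeTerm {a : ℂ} (h : ∀ m : ℕ, 2 * a + 1 ≠ -m) (h' : ∀ m : ℕ, 1 / 2 - a ≠ -m) :
    Summable (cubeTerm a) := by
  refine summable_of_tendsto_mul_cpow (s := 2) (by simp) ((tendsto_cubeTerm h h').congr fun n => ?_)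
  congr 1
  exact_mod_cast rfl

/-- The certificate grows like k² and the weight decays like k^(-(4a + 2)), so Re a > 0 is what
makes the product vanish. -/
theorem tendsto_firstCert {a : ℂ} (ha : 0 < a.re) :
    Tendsto (fun k : ℕ => rising (a + 1 / 2) k ^ 4 / rising (2 * a + 1) k ^ 4 *
      (firstPoly a k / (2 * a + 1 + k) ^ 4)) atTop (𝓝 0) := by
  have h := two_mul_add_one_ne_of_re_pos ha
  have h1 := tendsto_mul_pow_of_tendsto_mul_cpow 2 (by simp; linarith) (tendsto_fourth_power h)
  -- Φ is the quotient with numerator and denominator divided by the top power of k and written in x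
  -- = 1/k. Its value at 0 is the limit.
  have h2 := tendsto_of_eq_comp_inv (u := fun k : ℕ => firstPoly a k / (2 * a + 1 + k) ^ 4 / k ^ 2)
      (Φ := fun x => (13 * x ^ 6 + 124 * x ^ 5 + 480 * x ^ 4 + 960 * x ^ 3 + 1040 * x ^ 2 + 576 * x
        + 128 + 284 * a * x ^ 6 + 2264 * a * x ^ 5 + 6656 * a * x ^ 4 + 9344 * a * x ^ 3
        + 6336 * a * x ^ 2 + 1664 * a * x + 2572 * a ^ 2 * x ^ 6 + 15200 * a ^ 2 * x ^ 5
        + 31488 * a ^ 2 * x ^ 4 + 27904 * a ^ 2 * x ^ 3 + 9024 * a ^ 2 * x ^ 2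
        + 11296 * a ^ 3 * x ^ 6 + 46784 * a ^ 3 * x ^ 5 + 61440 * a ^ 3 * x ^ 4
        + 26112 * a ^ 3 * x ^ 3 + 25648 * a ^ 4 * x ^ 6 + 67264 * a ^ 4 * x ^ 5
        + 42496 * a ^ 4 * x ^ 4 + 29120 * a ^ 5 * x ^ 6 + 36736 * a ^ 5 * x ^ 5
        + 13120 * a ^ 6 * x ^ 6) / ((2 * a + 1) * x + 1) ^ 4)
      (by refine ContinuousAt.div (by fun_prop) (by fun_prop) (by simp))
      (fun n hn => by
        have h4 := add_nat_ne_zero h n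
        have h5 : (2 * a + 1) * (1 / n) + 1 = (2 * a + 1 + n) / n := by field_simp
        simp only [h5, firstPoly]
        generalize 2 * a + 1 + (n : ℂ) = X at *
        field_simp)
  have h3 := h1.mul h2
  rw [zero_mul] at h3
  refine h3.congr' ?_
  filter_upwards [eventually_ne_atTop 0] with n hn
  have hn' : (n : ℂ) ≠ 0 := by exact_mod_cast hn
  rw [mul_assoc, mul_div_cancel₀ _ (pow_ne_zero 2 hn')]

theorem tendsto_ratioCert {a : ℂ} (ha : 0 < a.re) :
    Tendsto (fun k : ℕ => ratioTerm a k * (ratioPoly a k / (2 * a + 1 + k) ^ 2)) atTop (𝓝 0) := by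
  have h := two_mul_add_one_ne_of_re_pos ha
  have h1 := tendsto_mul_pow_of_tendsto_mul_cpow 1 (by simp; linarith) (tendsto_ratioTerm h)
  have h2 := tendsto_of_eq_comp_inv (u := fun k : ℕ => ratioPoly a k / (2 * a + 1 + k) ^ 2 / k ^ 1)
      (Φ := fun x => (5 * x ^ 3 + 24 * x ^ 2 + 36 * x + 16 + 62 * a * x ^ 3 + 160 * a * x ^ 2
        + 104 * a * x + 188 * a ^ 2 * x ^ 3 + 224 * a ^ 2 * x ^ 2 + 168 * a ^ 3 * x ^ 3) /
        ((2 * a + 1) * x + 1) ^ 2)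
      (by refine ContinuousAt.div (by fun_prop) (by fun_prop) (by simp))
      (fun n hn => by
        have h4 := add_nat_ne_zero h n
        have h5 : (2 * a + 1) * (1 / n) + 1 = (2 * a + 1 + n) / n := by field_simp
        simp only [h5, ratioPoly]
        generalize 2 * a + 1 + (n : ℂ) = X at *
        field_simp)
  have h3 := h1.mul h2
  rw [zero_mul] at h3
  refine h3.congr' ?_
  filter_upwards [eventually_ne_atTop 0] with n hn
  have hn' : (n : ℂ) ≠ 0 := by exact_mod_cast hn
  rw [mul_assoc, mul_div_cancel₀ _ (pow_ne_zero 1 hn')]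

/-- A certificate of size k² against decay k^(-(3/2 - a)) requires Re a < -1/2, which is also where
the series at a + 1 converges. -/
theorem tendsto_squareCert {a : ℂ} (h : ∀ m : ℕ, 2 * a + 1 ≠ -m) (h' : ∀ m : ℕ, 1 / 2 - a ≠ -m)
    (ha : a.re < -(1 / 2)) :
    Tendsto (fun k : ℕ => squareTerm a k *
      (squarePoly a k * (1 / 2 - a + k) / ((2 * a + 1 + k) * (2 * a - 1)))) atTop (𝓝 0) := by
  have h1 := tendsto_mul_pow_of_tendsto_mul_cpow 2 (by simp; linarith) (tendsto_squareTerm h h')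
  have hM := two_mul_sub_one_ne_zero h'
  have h2 := tendsto_of_eq_comp_inv
      (u := fun k : ℕ => squarePoly a k * (1 / 2 - a + k) / ((2 * a + 1 + k) * (2 * a - 1)) / k ^ 2)
      (Φ := fun x => (-10 * x ^ 2 - 24 * x - 8 - 104 * a * x ^ 2 - 112 * a * x - 168 * a ^ 2 * x ^ 2)
        * ((1 / 2 - a) * x + 1) / (((2 * a + 1) * x + 1) * (2 * a - 1)))
      (by refine ContinuousAt.div (by fun_prop) (by fun_prop) (by simpa using hM))
      (fun n hn => by
        have h4 := add_nat_ne_zero h n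
        have h5 : (2 * a + 1) * (1 / n) + 1 = (2 * a + 1 + n) / n := by field_simp
        simp only [h5, squarePoly]
        generalize 2 * a + 1 + (n : ℂ) = X at *
        generalize 2 * a - 1 = M at *
        field_simp)
  have h3 := h1.mul h2
  rw [zero_mul] at h3
  refine h3.congr' ?_
  filter_upwards [eventually_ne_atTop 0] with n hn
  have hn' : (n : ℂ) ≠ 0 := by exact_mod_cast hn
  rw [mul_assoc, mul_div_cancel₀ _ (pow_ne_zero 2 hn')]

/-- The top coefficient of `cubePoly` in k is -80 - 672a = -16(42a + 5): the linear polynomial of g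
appears here. -/
theorem tendsto_cubeCert {a : ℂ} (h : ∀ m : ℕ, 2 * a + 1 ≠ -m) (h' : ∀ m : ℕ, 1 / 2 - a ≠ -m) :
    Tendsto (fun k : ℕ => cubeTerm a k *
      (cubePoly a k * (1 / 2 - a + k) / ((2 * a + 1 + k) ^ 2 * (2 * a - 1)))) atTop
      (𝓝 ((Complex.Gamma (2 * a + 1) / Complex.Gamma (a + 1 / 2)) ^ 2 *
        (Complex.Gamma (3 / 2 - a) / Complex.Gamma (a + 1 / 2)) *
        (-16 * (42 * a + 5) / (2 * a - 1)))) := by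
  have hM := two_mul_sub_one_ne_zero h'
  have h2 := tendsto_of_eq_comp_inv
      (u := fun k : ℕ =>
        cubePoly a k * (1 / 2 - a + k) / ((2 * a + 1 + k) ^ 2 * (2 * a - 1)) / k ^ 2)
      (Φ := fun x => (-26 * x ^ 3 - 124 * x ^ 2 - 184 * x - 80 - 464 * a * x ^ 3 - 1768 * a * x ^ 2
        - 2016 * a * x - 672 * a - 3184 * a ^ 2 * x ^ 3 - 7632 * a ^ 2 * x ^ 2 - 4320 * a ^ 2 * x
        - 8000 * a ^ 3 * x ^ 3 - 9184 * a ^ 3 * x ^ 2 - 6560 * a ^ 4 * x ^ 3)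
        * ((1 / 2 - a) * x + 1) / (((2 * a + 1) * x + 1) ^ 2 * (2 * a - 1)))
      (by refine ContinuousAt.div (by fun_prop) (by fun_prop) (by simpa using hM))
      (fun n hn => by
        have h4 := add_nat_ne_zero h n
        have h5 : (2 * a + 1) * (1 / n) + 1 = (2 * a + 1 + n) / n := by field_simp
        simp only [h5, cubePoly]
        generalize 2 * a + 1 + (n : ℂ) = X at *
        generalize 2 * a - 1 = M at *
        field_simp)
  have h3 := (tendsto_cubeTerm h h').mul h2
  refine (h3.congr' ?_).trans (le_of_eq ?_)
  · filter_upwards [eventually_ne_atTop 0] with n hn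
    have hn' : (n : ℂ) ≠ 0 := by exact_mod_cast hn
    rw [mul_assoc, mul_div_cancel₀ _ (pow_ne_zero 2 hn')]
  · congr 2
    simp only [mul_zero, zero_add, one_pow, one_mul, ne_eq, OfNat.ofNat_ne_zero, not_false_eq_true,
      zero_pow, mul_one]
    ring

/-! ### Bounds for the terms -/

theorem norm_div_le_self {w b x y : ℂ} (hb : ‖b‖ ≤ ‖x‖) (hw : ‖w‖ ≤ ‖y‖) (m : ℕ) :
    ‖(w * b) ^ m / (x * y) ^ m‖ ≤ 1 := by
  rw [norm_div, norm_pow, norm_pow, norm_mul, norm_mul]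
  refine div_le_one_of_le₀ ?_ (by positivity)
  gcongr ?_ ^ m
  rw [mul_comm]
  gcongr

theorem norm_half_add_le {a : ℂ} (ha : 0 ≤ a.re) (k : ℕ) :
    ‖a + 1 / 2 + k‖ ≤ ‖2 * a + 1 + k‖ := by
  have := (Nat.cast_nonneg k : (0 : ℝ) ≤ k)
  refine norm_le_norm_of_re_le_of_abs_im_le ?_ ?_ ?_
  · simp; linarith
  · simp; linarith
  · simp [abs_mul]; linarith [abs_nonneg a.im]

theorem norm_le_add_nat {a : ℂ} (ha : 0 ≤ a.re) (k : ℕ) :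
    ‖2 * a + 1‖ ≤ ‖2 * a + 2 + k‖ := by
  have := (Nat.cast_nonneg k : (0 : ℝ) ≤ k)
  refine norm_le_norm_of_re_le_of_abs_im_le ?_ ?_ ?_
  · simp; linarith
  · simp; linarith
  · simp

theorem one_le_norm {a : ℂ} (ha : 1 ≤ a.re) : 1 ≤ ‖a‖ :=
  ha.trans (Complex.re_le_norm a)

theorem norm_two_mul_add_one_le {a : ℂ} (ha : 1 ≤ a.re) : ‖2 * a + 1‖ ≤ 3 * ‖a‖ := by
  have h := norm_add_le (2 * a) 1
  have := one_le_norm ha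
  simp at h
  linarith

/-- Four of the five factors 2a + 1 are absorbed, with those of a + 1/2 + k, by the denominator.
What remains costs at most 3 · 2 = 6 times ‖a‖, well below 128/2. -/
theorem norm_firstTerm_shift_le {a : ℂ} (ha : 1 ≤ a.re) (k : ℕ) :
    ‖rFactor a * (128 * (a + 1) * firstTerm (a + 1) k)‖ ≤ 1 / 2 * ‖128 * a * firstTerm a k‖ := by
  have h0 : (0 : ℝ) ≤ a.re := by linarith
  have hk := (Nat.cast_nonneg k : (0 : ℝ) ≤ k)
  rw [firstTerm_shift (two_mul_add_one_ne_of_re_pos (by linarith)), firstTerm]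
  have h1 := norm_div_le_self (norm_half_add_le h0 k) (norm_le_add_nat h0 k) 4
  have h2 := norm_two_mul_add_one_le ha
  have h3 : ‖4 * (k : ℂ) + 6 * a + 7‖ ≤ 2 * ‖4 * (k : ℂ) + 6 * a + 1‖ := by
    have e : ‖(2 : ℂ) * (4 * (k : ℂ) + 6 * a + 1)‖ = 2 * ‖4 * (k : ℂ) + 6 * a + 1‖ := by
      rw [norm_mul]; simp
    rw [← e]
    refine norm_le_norm_of_re_le_of_abs_im_le ?_ ?_ ?_
    · simp; linarith
    · simp; linarith
    · simp [abs_mul]; linarith [abs_nonneg a.im]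
  generalize rising (a + 1 / 2) k ^ 4 / rising (2 * a + 1) k ^ 4 = t
  have e : -((2 * a + 1) ^ 5 * (a + 1 / 2 + k) ^ 4 / ((2 * a + 1 + k) * (2 * a + 2 + k)) ^ 4 *
      (4 * k + 6 * a + 7)) * t = -(((2 * a + 1) * (a + 1 / 2 + k)) ^ 4 /
        ((2 * a + 1 + k) * (2 * a + 2 + k)) ^ 4 * ((2 * a + 1) * (4 * k + 6 * a + 7) * t)) := by
    ring
  rw [e, norm_neg, norm_mul]
  calc _ ≤ 1 * ‖(2 * a + 1) * (4 * k + 6 * a + 7) * t‖ := by gcongr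
    _ = ‖2 * a + 1‖ * ‖4 * (k : ℂ) + 6 * a + 7‖ * ‖t‖ := by rw [one_mul, norm_mul, norm_mul]
    _ ≤ (3 * ‖a‖) * (2 * ‖4 * (k : ℂ) + 6 * a + 1‖) * ‖t‖ := by gcongr
    _ ≤ 1 / 2 * (128 * ‖a‖ * (‖t‖ * ‖4 * (k : ℂ) + 6 * a + 1‖)) := by
      have : 0 ≤ ‖a‖ * (‖t‖ * ‖4 * (k : ℂ) + 6 * a + 1‖) := by positivity
      linarith
    _ = _ := by rw [norm_mul, norm_mul, norm_mul]; simp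

theorem norm_ratioTerm_shift_le {a : ℂ} (ha : 1 ≤ a.re) (k : ℕ) :
    ‖sFactor a * (32 * (a + 1) * ratioTerm (a + 1) k)‖ ≤ 1 / 2 * ‖32 * a * ratioTerm a k‖ := by
  have h0 : (0 : ℝ) ≤ a.re := by linarith
  rw [ratioTerm_shift (two_mul_add_one_ne_of_re_pos (by linarith))]
  have h1 := norm_div_le_self (norm_half_add_le h0 k) (norm_le_add_nat h0 k) 2
  have h2 := norm_two_mul_add_one_le ha
  generalize ratioTerm a k = t
  have e : (2 * a + 1) ^ 3 * (a + 1 / 2 + k) ^ 2 / ((2 * a + 1 + k) * (2 * a + 2 + k)) ^ 2 * t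
      = ((2 * a + 1) * (a + 1 / 2 + k)) ^ 2 /
        ((2 * a + 1 + k) * (2 * a + 2 + k)) ^ 2 * ((2 * a + 1) * t) := by
    ring
  rw [e, norm_mul]
  calc _ ≤ 1 * ‖(2 * a + 1) * t‖ := by gcongr
    _ = ‖2 * a + 1‖ * ‖t‖ := by rw [one_mul, norm_mul]
    _ ≤ (3 * ‖a‖) * ‖t‖ := by gcongr
    _ ≤ 1 / 2 * (32 * ‖a‖ * ‖t‖) := by
      have : 0 ≤ ‖a‖ * ‖t‖ := by positivity
      linarith
    _ = _ := by rw [norm_mul, norm_mul]; simp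

/-- The four linear factors in k are bounded by those of the denominator, two by 2a + 1 + k and two
by 2a + 2 + k. The constant left is 4 · 3³ = 108, below 2048/2. -/
theorem norm_cubeTerm_shift_le {a : ℂ} (ha : 1 ≤ a.re) (h' : ∀ m : ℕ, 1 / 2 - a ≠ -m) (k : ℕ) :
    ‖rFactor a * (2048 * (a + 1) ^ 3 / (2 * (a + 1) - 1) * cubeTerm (a + 1) k)‖ ≤
      1 / 2 * ‖2048 * a ^ 3 / (2 * a - 1) * cubeTerm a k‖ := by
  have h0 : (0 : ℝ) ≤ a.re := by linarith
  have hk := (Nat.cast_nonneg k : (0 : ℝ) ≤ k)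
  rw [cubeTerm_shift (two_mul_add_one_ne_of_re_pos (by linarith)) h']
  have hB := norm_half_add_le h0 k
  have h2 := norm_two_mul_add_one_le ha
  have hBY : ‖a + 1 / 2 + k‖ ≤ ‖2 * a + 2 + k‖ := by
    refine norm_le_norm_of_re_le_of_abs_im_le ?_ ?_ ?_
    · simp; linarith
    · simp; linarith
    · simp [abs_mul]; linarith [abs_nonneg a.im]
  have hCY : ‖1 / 2 - a + k‖ ≤ ‖2 * a + 2 + k‖ := by
    refine norm_le_norm_of_re_le_of_abs_im_le ?_ ?_ ?_
    · simp; linarith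
    · simp; linarith
    · simp [abs_mul]; linarith [abs_nonneg a.im]
  have h3 : ‖(a + 1 / 2 + k) ^ 3 * (1 / 2 - a + k) / ((2 * a + 1 + k) * (2 * a + 2 + k)) ^ 2‖
      ≤ 1 := by
    rw [norm_div, norm_mul, norm_pow, norm_pow, norm_mul]
    refine div_le_one_of_le₀ ?_ (by positivity)
    calc ‖a + 1 / 2 + k‖ ^ 3 * ‖1 / 2 - a + k‖
        = ‖a + 1 / 2 + k‖ ^ 2 * (‖a + 1 / 2 + k‖ * ‖1 / 2 - a + k‖) := by ring
      _ ≤ ‖2 * a + 1 + k‖ ^ 2 * (‖2 * a + 2 + k‖ * ‖2 * a + 2 + k‖) := by gcongr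
      _ = _ := by ring
  have e : 4 * (2 * a + 1) ^ 3 * (a + 1 / 2 + k) ^ 3 * (1 / 2 - a + k) /
        (((2 * a + 1 + k) * (2 * a + 2 + k)) ^ 2 * (2 * a - 1)) * cubeTerm a k
      = (a + 1 / 2 + k) ^ 3 * (1 / 2 - a + k) / ((2 * a + 1 + k) * (2 * a + 2 + k)) ^ 2 *
        (4 * (2 * a + 1) ^ 3 * (cubeTerm a k / (2 * a - 1))) := by
    generalize ((2 * a + 1 + (k : ℂ)) * (2 * a + 2 + k)) ^ 2 = X
    generalize 2 * a - 1 = M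
    rw [mul_comm X M, ← div_div]
    ring
  have e' : 2048 * a ^ 3 / (2 * a - 1) * cubeTerm a k
      = 2048 * a ^ 3 * (cubeTerm a k / (2 * a - 1)) := by ring
  rw [e, e', norm_mul]
  generalize cubeTerm a k / (2 * a - 1) = t
  calc _ ≤ 1 * ‖4 * (2 * a + 1) ^ 3 * t‖ := by gcongr
    _ = 4 * ‖2 * a + 1‖ ^ 3 * ‖t‖ := by rw [one_mul, norm_mul, norm_mul, norm_pow]; simp
    _ ≤ 4 * (3 * ‖a‖) ^ 3 * ‖t‖ := by gcongr
    _ ≤ 1 / 2 * (2048 * ‖a‖ ^ 3 * ‖t‖) := by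
      have : 0 ≤ ‖a‖ ^ 3 * ‖t‖ := by positivity
      linarith
    _ = _ := by rw [norm_mul, norm_mul, norm_pow]; simp

/-! ### The series `f` and `g` -/

/-- The factor of `fTerm` without the polynomial. -/
noncomputable def fWeight (a : ℂ) (n : ℕ) : ℂ :=
  (-1) ^ n / 2 ^ (10 * n) * (rising (a + 1 / 2) n ^ 5 / rising (a + 1) n ^ 5)

/-- The factor of `gTerm` without the polynomial. -/
noncomputable def gWeight (a : ℂ) (n : ℕ) : ℂ :=
  1 / 2 ^ (6 * n) * (rising (a + 1 / 2) n ^ 3 / rising (a + 1) n ^ 3)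

theorem fTerm_eq (a : ℂ) (n : ℕ) :
    fTerm a n = fWeight a n * (820 * (a + n) ^ 2 + 180 * (a + n) + 13) := by
  rw [fTerm, fWeight, add_comm (n : ℂ)]

theorem gTerm_eq (a : ℂ) (n : ℕ) : gTerm a n = gWeight a n * (42 * (a + n) + 5) := by
  rw [gTerm, gWeight, add_comm (n : ℂ)]

theorem fWeight_zero (a : ℂ) : fWeight a 0 = 1 := by simp [fWeight]

theorem gWeight_zero (a : ℂ) : gWeight a 0 = 1 := by simp [gWeight]

theorem fWeight_succ (a : ℂ) (n : ℕ) : fWeight a (n + 1) = fWeight a n * rFactor (a + n) := by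
  rw [fWeight, fWeight, rFactor, rising_succ, rising_succ, mul_add 10 n 1, pow_add (2 : ℂ), pow_succ (-1 : ℂ),
    mul_pow, mul_pow, add_right_comm a 1, add_right_comm a (1 / 2), mul_div_mul_comm,
    mul_div_mul_comm]
  ring

theorem gWeight_succ (a : ℂ) (n : ℕ) : gWeight a (n + 1) = gWeight a n * sFactor (a + n) := by
  rw [gWeight, gWeight, sFactor, rising_succ, rising_succ, mul_add 6 n 1, pow_add,
    mul_pow, mul_pow, add_right_comm a 1, add_right_comm a (1 / 2), mul_div_mul_comm]
  ring

theorem fTerm_succ (a : ℂ) (n : ℕ) : fTerm a (n + 1) = rFactor a * fTerm (a + 1) n := by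
  rw [fTerm, fTerm, rFactor, rising_succ_left, rising_succ_left, mul_add 10 n 1, pow_add (2 : ℂ), pow_succ (-1 : ℂ),
    mul_pow, mul_pow, add_right_comm a 1, mul_div_mul_comm, mul_div_mul_comm]
  push_cast
  ring_nf

theorem gTerm_succ (a : ℂ) (n : ℕ) : gTerm a (n + 1) = sFactor a * gTerm (a + 1) n := by
  rw [gTerm, gTerm, sFactor, rising_succ_left, rising_succ_left, mul_add 6 n 1, pow_add,
    mul_pow, mul_pow, add_right_comm a 1, mul_div_mul_comm]
  push_cast
  ring_nf

theorem fTerm_zero (a : ℂ) : fTerm a 0 = 820 * a ^ 2 + 180 * a + 13 := by simp [fTerm]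

theorem gTerm_zero (a : ℂ) : gTerm a 0 = 42 * a + 5 := by simp [gTerm]

/-- Factor by factor: a + j + 1/2 is at most as far from 0 as a + j + 1 exactly when Re a + j ≥
-3/4. -/
theorem norm_rising_ratio_le_one {a : ℂ} (ha : -(3 / 4) ≤ a.re) (n : ℕ) :
    ‖rising (a + 1 / 2) n / rising (a + 1) n‖ ≤ 1 := by
  rw [norm_div]
  refine div_le_one_of_le₀ ?_ (norm_nonneg _)
  rw [rising_eq_prod, rising_eq_prod, norm_prod, norm_prod]
  refine Finset.prod_le_prod (fun _ _ => norm_nonneg _) fun j _ => ?_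
  have := (Nat.cast_nonneg j : (0 : ℝ) ≤ j)
  refine norm_le_norm_of_re_le_of_abs_im_le ?_ ?_ ?_
  · simp; linarith
  · simp; linarith
  · simp

theorem norm_fTerm_le {a : ℂ} {R : ℝ} (ha : -(3 / 4) ≤ a.re) (hR : ‖a‖ ≤ R) (n : ℕ) :
    ‖fTerm a n‖ ≤ (1 / 2 : ℝ) ^ n * (820 * (n + R) ^ 2 + 180 * (n + R) + 13) := by
  have h1 : ‖(n : ℂ) + a‖ ≤ n + R := (norm_add_le _ _).trans (by simpa using hR)
  have h2 : ‖820 * ((n : ℂ) + a) ^ 2 + 180 * ((n : ℂ) + a) + 13‖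
      ≤ 820 * (n + R) ^ 2 + 180 * (n + R) + 13 := by
    refine (norm_add₃_le).trans ?_
    rw [norm_mul, norm_mul, norm_pow]
    simp only [Complex.norm_ofNat]
    gcongr
  rw [fTerm, ← div_pow, norm_mul, norm_mul, norm_pow]
  have h3 : ‖((-1 : ℂ) ^ n / 2 ^ (10 * n))‖ ≤ (1 / 2 : ℝ) ^ n := by
    rw [norm_div, norm_pow, norm_pow, norm_neg, norm_one, one_pow, one_div_pow]
    simp only [Complex.norm_ofNat]
    gcongr
    · norm_num
    · omega
  calc _ ≤ (1 / 2 : ℝ) ^ n * 1 ^ 5 * (820 * (n + R) ^ 2 + 180 * (n + R) + 13) := by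
        gcongr
        exact norm_rising_ratio_le_one ha n
    _ = _ := by ring

theorem norm_gTerm_le {a : ℂ} {R : ℝ} (ha : -(3 / 4) ≤ a.re) (hR : ‖a‖ ≤ R) (n : ℕ) :
    ‖gTerm a n‖ ≤ (1 / 2 : ℝ) ^ n * (42 * (n + R) + 5) := by
  have h1 : ‖(n : ℂ) + a‖ ≤ n + R := (norm_add_le _ _).trans (by simpa using hR)
  have h2 : ‖42 * ((n : ℂ) + a) + 5‖ ≤ 42 * (n + R) + 5 := by
    refine (norm_add_le _ _).trans ?_
    rw [norm_mul]
    simp only [Complex.norm_ofNat]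
    gcongr
  rw [gTerm, ← div_pow, norm_mul, norm_mul, norm_pow]
  have h3 : ‖((1 : ℂ) / 2 ^ (6 * n))‖ ≤ (1 / 2 : ℝ) ^ n := by
    rw [norm_div, norm_pow, norm_one, one_div_pow]
    simp only [Complex.norm_ofNat]
    gcongr
    · norm_num
    · omega
  calc _ ≤ (1 / 2 : ℝ) ^ n * 1 ^ 3 * (42 * (n + R) + 5) := by
        gcongr
        exact norm_rising_ratio_le_one ha n
    _ = _ := by ring

theorem summable_geometric_mul_quadratic (b c d R : ℝ) :
    Summable fun n : ℕ => (1 / 2 : ℝ) ^ n * (b * (n + R) ^ 2 + c * (n + R) + d) := by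
  have h : ∀ k : ℕ, Summable fun n : ℕ => (n : ℝ) ^ k * (1 / 2 : ℝ) ^ n := fun k =>
    summable_pow_mul_geometric_of_norm_lt_one k (by norm_num)
  refine ((((h 2).mul_left b).add ((h 1).mul_left (2 * b * R + c))).add
    ((h 0).mul_left (b * R ^ 2 + c * R + d))).congr fun n => ?_
  ring

theorem summable_geometric_mul_linear (c d R : ℝ) :
    Summable fun n : ℕ => (1 / 2 : ℝ) ^ n * (c * (n + R) + d) := by
  simpa using summable_geometric_mul_quadratic 0 c d R

/-- Induction along `a ↦ a + 1` from a right half plane. -/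
theorem induction_of_re {p : ℂ → Prop} {x : ℝ} (h0 : ∀ a : ℂ, x < a.re → p a)
    (h1 : ∀ a : ℂ, p (a + 1) → p a) (a : ℂ) : p a := by
  obtain ⟨N, hN⟩ := exists_nat_gt (x - a.re)
  have : ∀ N : ℕ, ∀ a : ℂ, x - a.re < N → p a := by
    intro N
    induction N with
    | zero => exact fun a ha => h0 a (by simpa using ha)
    | succ N ih =>
      intro a ha
      refine h1 a (ih _ ?_)
      push_cast at ha
      simp
      linarith
  exact this N a hN

/-- Holds at the excluded points as well: with x / 0 = 0 the shift `fTerm_succ` is valid for every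
a, and it transports summability leftwards. -/
theorem summable_fTerm (a : ℂ) : Summable (fTerm a) := by
  refine induction_of_re (p := fun a => Summable (fTerm a)) (x := -(3 / 4)) (fun a ha => ?_)
    (fun a h => ?_) a
  · exact (summable_geometric_mul_quadratic _ _ _ ‖a‖).of_norm_bounded
      (norm_fTerm_le ha.le le_rfl)
  · rw [← summable_nat_add_iff 1]
    simp only [fTerm_succ]
    exact h.mul_left _

theorem summable_gTerm (a : ℂ) : Summable (gTerm a) := by
  refine induction_of_re (p := fun a => Summable (gTerm a)) (x := -(3 / 4)) (fun a ha => ?_)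
    (fun a h => ?_) a
  · exact (summable_geometric_mul_linear _ _ ‖a‖).of_norm_bounded
      (norm_gTerm_le ha.le le_rfl)
  · rw [← summable_nat_add_iff 1]
    simp only [gTerm_succ]
    exact h.mul_left _

theorem f_eq_add (a : ℂ) : f a = 820 * a ^ 2 + 180 * a + 13 + rFactor a * f (a + 1) := by
  rw [f, (summable_fTerm a).tsum_eq_zero_add, fTerm_zero, f, ← tsum_mul_left]
  simp only [fTerm_succ]

theorem g_eq_add (a : ℂ) : g a = 42 * a + 5 + sFactor a * g (a + 1) := by
  rw [g, (summable_gTerm a).tsum_eq_zero_add, gTerm_zero, g, ← tsum_mul_left]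
  simp only [gTerm_succ]

/-! ### Holomorphy of f and g -/

theorem differentiable_rising (n : ℕ) : Differentiable ℂ fun x => rising x n := by
  simp only [rising]
  exact Polynomial.differentiable _

theorem add_one_mem_domain {a : ℂ} (ha : a ∈ domain) : a + 1 ∈ domain := by
  intro m h
  refine ha (m + 1) ?_
  push_cast
  linear_combination h

theorem add_one_ne_of_mem_domain {a : ℂ} (ha : a ∈ domain) (m : ℕ) : a + 1 ≠ -m := by
  intro h
  exact ha m (by linear_combination h)

theorem add_one_ne_zero_of_mem_domain {a : ℂ} (ha : a ∈ domain) : a + 1 ≠ 0 := by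
  simpa using add_one_ne_of_mem_domain ha 0

theorem mem_domain_of_re {a : ℂ} (ha : -1 < a.re) : a ∈ domain := by
  rintro m rfl
  simp at ha
  linarith [(Nat.cast_nonneg m : (0 : ℝ) ≤ m)]

theorem differentiableAt_rising_ratio {a : ℂ} (ha : a ∈ domain) (n m : ℕ) :
    DifferentiableAt ℂ (fun a => rising (a + 1 / 2) n ^ m / rising (a + 1) n ^ m) a := by
  have h := rising_ne_zero (add_one_ne_of_mem_domain ha) n
  have h1 : DifferentiableAt ℂ (fun a : ℂ => rising (a + 1 / 2) n) a :=
    (differentiable_rising n).differentiableAt.comp a (by fun_prop)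
  have h2 : DifferentiableAt ℂ (fun a : ℂ => rising (a + 1) n) a :=
    (differentiable_rising n).differentiableAt.comp a (by fun_prop)
  exact (h1.pow m).div (h2.pow m) (pow_ne_zero _ h)

theorem differentiableAt_rFactor {a : ℂ} (ha : a ∈ domain) : DifferentiableAt ℂ rFactor a := by
  have := pow_ne_zero 5 (add_one_ne_zero_of_mem_domain ha)
  unfold rFactor
  fun_prop (disch := assumption)

theorem differentiableAt_sFactor {a : ℂ} (ha : a ∈ domain) : DifferentiableAt ℂ sFactor a := by
  have := pow_ne_zero 3 (add_one_ne_zero_of_mem_domain ha)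
  unfold sFactor
  fun_prop (disch := assumption)

/-- Weierstrass' test on the part of a half plane inside a ball. R is the bound for ‖a‖. -/
theorem differentiableAt_tsum_of_bound {F : ℂ → ℕ → ℂ} {B : ℝ → ℕ → ℝ} {x : ℝ}
    (hF : ∀ n, ∀ a : ℂ, x < a.re → DifferentiableAt ℂ (fun a => F a n) a)
    (hB : ∀ R, Summable (B R)) (h : ∀ R n a, x < a.re → ‖a‖ ≤ R → ‖F a n‖ ≤ B R n)
    {a : ℂ} (ha : x < a.re) : DifferentiableAt ℂ (fun a => ∑' n, F a n) a := by
  have ho : IsOpen ({a : ℂ | x < a.re} ∩ Metric.ball 0 (‖a‖ + 1)) :=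
    (isOpen_lt continuous_const Complex.continuous_re).inter Metric.isOpen_ball
  have hd := Complex.differentiableOn_tsum_of_summable_norm (hB (‖a‖ + 1))
    (fun n b hb => (hF n b hb.1).differentiableWithinAt) ho
    (fun n b hb => h _ n b hb.1 (mem_ball_zero_iff.1 hb.2).le)
  exact hd.differentiableAt (ho.mem_nhds ⟨ha, by simp⟩)

theorem differentiableAt_f {a : ℂ} (ha : a ∈ domain) : DifferentiableAt ℂ f a := by
  revert ha
  refine induction_of_re (p := fun a => a ∈ domain → DifferentiableAt ℂ f a) (x := -(3 / 4))
    (fun a ha _ => ?_) (fun a h ha => ?_) a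
  · refine differentiableAt_tsum_of_bound (F := fTerm)
      (B := fun R n => (1 / 2 : ℝ) ^ n * (820 * (n + R) ^ 2 + 180 * (n + R) + 13)) (fun n a ha => ?_)
      (fun R => summable_geometric_mul_quadratic _ _ _ R)
      (fun R n a ha hR => norm_fTerm_le ha.le hR n) ha
    have := differentiableAt_rising_ratio (mem_domain_of_re (a := a) (by linarith)) n 5
    have h2 : DifferentiableAt ℂ (fun a : ℂ => 820 * ((n : ℂ) + a) ^ 2 + 180 * ((n : ℂ) + a) + 13)
      a := by fun_prop
    exact (this.const_mul _).mul h2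
  · have h0 : DifferentiableAt ℂ (fun a : ℂ => a + 1) a := by fun_prop
    have h1 : DifferentiableAt ℂ (fun a => f (a + 1)) a :=
      DifferentiableAt.comp (g := f) a (h (add_one_mem_domain ha)) h0
    have h2 := differentiableAt_rFactor ha
    rw [show f = fun a => 820 * a ^ 2 + 180 * a + 13 + rFactor a * f (a + 1) from funext f_eq_add]
    fun_prop

theorem differentiableAt_g {a : ℂ} (ha : a ∈ domain) : DifferentiableAt ℂ g a := by
  revert ha
  refine induction_of_re (p := fun a => a ∈ domain → DifferentiableAt ℂ g a) (x := -(3 / 4))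
    (fun a ha _ => ?_) (fun a h ha => ?_) a
  · refine differentiableAt_tsum_of_bound (F := gTerm)
      (B := fun R n => (1 / 2 : ℝ) ^ n * (42 * (n + R) + 5)) (fun n a ha => ?_)
      (fun R => summable_geometric_mul_linear _ _ R)
      (fun R n a ha hR => norm_gTerm_le ha.le hR n) ha
    have := differentiableAt_rising_ratio (mem_domain_of_re (a := a) (by linarith)) n 3
    have h2 : DifferentiableAt ℂ (fun a : ℂ => 42 * ((n : ℂ) + a) + 5) a := by fun_prop
    exact (this.const_mul _).mul h2
  · have h0 : DifferentiableAt ℂ (fun a : ℂ => a + 1) a := by fun_prop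
    have h1 : DifferentiableAt ℂ (fun a => g (a + 1)) a :=
      DifferentiableAt.comp (g := g) a (h (add_one_mem_domain ha)) h0
    have h2 := differentiableAt_sFactor ha
    rw [show g = fun a => 42 * a + 5 + sFactor a * g (a + 1) from funext g_eq_add]
    fun_prop

/-! ### Accelerated series -/

theorem tsum_firstTerm_recurrence {a : ℂ} (ha : 0 < a.re) :
    ∑' k, 128 * a * firstTerm a k = 820 * a ^ 2 + 180 * a + 13 +
      rFactor a * ∑' k, 128 * (a + 1) * firstTerm (a + 1) k := by
  have h := two_mul_add_one_ne_of_re_pos ha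
  have h1 := tsum_sub_eq_of_telescoping ((summable_firstTerm ha).mul_left _)
    (((summable_firstTerm (a := a + 1) (by simp; linarith)).mul_left _).mul_left _)
    (firstTerm_telescoping h) (tendsto_firstCert ha)
  rw [← tsum_mul_left, ← sub_eq_iff_eq_add, h1]
  have h2 := two_mul_add_one_ne_zero h
  -- At k = 0 the certificate reduces to the quadratic of f, the inhomogeneous term of its
  -- recurrence.
  have e : firstPoly a 0 = (2 * a + 1) ^ 4 * (820 * a ^ 2 + 180 * a + 13) := by
    simp only [firstPoly]; ring
  simp only [rising_zero, Nat.cast_zero, add_zero, e]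
  rw [mul_div_cancel_left₀ _ (pow_ne_zero 4 h2)]
  ring

theorem f_eq_tsum_firstTerm {a : ℂ} (ha : 0 < a.re) : f a = 128 * a * ∑' n, firstTerm a n := by
  have hre : ∀ n : ℕ, 0 < (a + n).re := fun n => by
    have := (Nat.cast_nonneg n : (0 : ℝ) ≤ n)
    simp; linarith
  have h := tendsto_sum_of_recurrence (a := a) (A := fWeight a)
    (r := rFactor) (F := fun a k => 128 * a * firstTerm a k)
    (P := fun a => 820 * a ^ 2 + 180 * a + 13)
    (fWeight_zero a) (fWeight_succ a) (fun n => (summable_firstTerm (hre n)).mul_left (128 * (a + n)))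
    (fun n => tsum_firstTerm_recurrence (hre n)) (fun n h k => norm_firstTerm_shift_le h k)
  -- The sums produced by the iteration are exactly the partial sums of f.
  simp only [← fTerm_eq] at h
  rw [← tsum_mul_left]
  exact tendsto_nhds_unique (summable_fTerm a).hasSum.tendsto_sum_nat h

theorem tsum_ratioTerm_recurrence {a : ℂ} (ha : 0 < a.re) :
    ∑' k, 32 * a * ratioTerm a k = 42 * a + 5 +
      sFactor a * ∑' k, 32 * (a + 1) * ratioTerm (a + 1) k := by
  have h := two_mul_add_one_ne_of_re_pos ha
  have h1 := tsum_sub_eq_of_telescoping ((summable_ratioTerm ha).mul_left _)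
    (((summable_ratioTerm (a := a + 1) (by simp; linarith)).mul_left _).mul_left _)
    (ratioTerm_telescoping h) (tendsto_ratioCert ha)
  rw [← tsum_mul_left, ← sub_eq_iff_eq_add, h1]
  have h2 := two_mul_add_one_ne_zero h
  have e : ratioPoly a 0 = (2 * a + 1) ^ 2 * (42 * a + 5) := by
    simp only [ratioPoly]; ring
  simp only [ratioTerm, rising_zero, Nat.cast_zero, add_zero, e]
  rw [mul_div_cancel_left₀ _ (pow_ne_zero 2 h2)]
  ring

/-- An auxiliary form of g: a ₃F₂ at 1 to which `three_term_relation` applies. -/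
theorem g_eq_tsum_ratioTerm {a : ℂ} (ha : 0 < a.re) : g a = 32 * a * ∑' n, ratioTerm a n := by
  have hre : ∀ n : ℕ, 0 < (a + n).re := fun n => by
    have := (Nat.cast_nonneg n : (0 : ℝ) ≤ n)
    simp; linarith
  have h := tendsto_sum_of_recurrence (a := a) (A := gWeight a)
    (r := sFactor) (F := fun a k => 32 * a * ratioTerm a k)
    (P := fun a => 42 * a + 5)
    (gWeight_zero a) (gWeight_succ a) (fun n => (summable_ratioTerm (hre n)).mul_left (32 * (a + n)))
    (fun n => tsum_ratioTerm_recurrence (hre n)) (fun n h k => norm_ratioTerm_shift_le h k)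
  simp only [← gTerm_eq] at h
  rw [← tsum_mul_left]
  exact tendsto_nhds_unique (summable_gTerm a).hasSum.tendsto_sum_nat h

/-! ### The second form and its Gamma factor -/

theorem add_nat_mem_domain {a : ℂ} (ha : a ∈ domain) (n : ℕ) : a + n ∈ domain := by
  induction n with
  | zero => simpa using ha
  | succ n ih => simpa [add_assoc] using add_one_mem_domain ih

theorem cos_pi_mul_add_one (a : ℂ) :
    Complex.cos (Real.pi * (a + 1)) = -Complex.cos (Real.pi * a) := by
  rw [mul_add, mul_one, Complex.cos_add_pi]

theorem cos_pi_mul_add_nat_ne_zero {a : ℂ} (ha : Complex.cos (Real.pi * a) ≠ 0) (n : ℕ) :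
    Complex.cos (Real.pi * (a + n)) ≠ 0 := by
  induction n with
  | zero => simpa using ha
  | succ n ih =>
    push_cast
    rw [← add_assoc, cos_pi_mul_add_one]
    exact neg_ne_zero.2 ih

theorem ne_int_add_half {a : ℂ} (ha : Complex.cos (Real.pi * a) ≠ 0) (m : ℤ) : a ≠ m + 1 / 2 := by
  rintro rfl
  refine ha (Complex.cos_eq_zero_iff.2 ⟨m, ?_⟩)
  ring

theorem half_sub_ne {a : ℂ} (ha : Complex.cos (Real.pi * a) ≠ 0) (m : ℕ) : 1 / 2 - a ≠ -m := by
  intro h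
  refine ne_int_add_half ha m ?_
  push_cast
  linear_combination -h

/-- Even m would make a a half-integer, where the cosine vanishes. Odd m would make a a negative
integer. -/
theorem two_mul_add_one_ne {a : ℂ} (ha : a ∈ domain) (hc : Complex.cos (Real.pi * a) ≠ 0) (m : ℕ) :
    2 * a + 1 ≠ -m := by
  intro h
  obtain ⟨j, rfl | rfl⟩ := Nat.even_or_odd' m
  · refine ne_int_add_half hc (-j - 1) ?_
    push_cast at h ⊢
    linear_combination h / 2
  · refine ha j ?_
    push_cast at h ⊢
    linear_combination h / 2

theorem two_pow_cpow (n : ℕ) (a : ℂ) : ((2 : ℂ) ^ n) ^ a = ((2 : ℂ) ^ a) ^ n := by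
  induction n with
  | zero => simp
  | succ n ih =>
    rw [pow_succ, pow_succ, ← ih]
    have := Complex.natCast_mul_natCast_cpow (2 ^ n) 2 a
    push_cast at this
    exact this

/-- The factor of `g` in the second form of `f`. -/
noncomputable def scale (a : ℂ) : ℂ :=
  8 / (Real.pi : ℂ) * ((16 : ℂ) ^ a / Complex.cos (Real.pi * a)) *
    (risingC 1 a ^ 2 / risingC (1 / 2) a ^ 2)

theorem risingC_one (a : ℂ) : risingC 1 a = Complex.Gamma (a + 1) := by
  rw [risingC, Complex.Gamma_one, div_one, add_comm]

theorem risingC_half (a : ℂ) :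
    risingC (1 / 2) a = Complex.Gamma (a + 1 / 2) / (Real.pi : ℂ) ^ (1 / 2 : ℂ) := by
  rw [risingC, Complex.Gamma_one_half_eq, add_comm]

theorem pi_cpow_half_sq : ((Real.pi : ℂ) ^ (1 / 2 : ℂ)) ^ 2 = Real.pi := by
  rw [← Complex.cpow_nat_mul]
  simp

theorem pi_ne_zero' : (Real.pi : ℂ) ≠ 0 := by exact_mod_cast Real.pi_ne_zero

theorem scale_eq (a : ℂ) : scale a = 8 * ((2 : ℂ) ^ a) ^ 4 / Complex.cos (Real.pi * a) *
    (Complex.Gamma (a + 1) ^ 2 / Complex.Gamma (a + 1 / 2) ^ 2) := by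
  have := pi_ne_zero'
  rw [scale, risingC_one, risingC_half, div_pow, pi_cpow_half_sq, ← two_pow_cpow]
  norm_num
  field_simp

/-- `scale` intertwines the two recurrences: s/r is -16 ((a + 1)/(a + 1/2))², where 16 comes from
16^a, the sign from the cosine and the square from the Gamma quotient. -/
theorem scale_add_one {a : ℂ} (ha : a ∈ domain) (hc : Complex.cos (Real.pi * a) ≠ 0) :
    rFactor a * scale (a + 1) = scale a * sFactor a := by
  have h1 := add_one_ne_zero_of_mem_domain ha
  have h2 : a + 1 / 2 ≠ 0 := by simpa using add_half_ne (two_mul_add_one_ne ha hc) 0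
  have h3 := Complex.Gamma_ne_zero (add_half_ne (two_mul_add_one_ne ha hc))
  rw [scale_eq, scale_eq, cos_pi_mul_add_one, Complex.Gamma_add_one _ h1, add_right_comm a 1,
    Complex.Gamma_add_one _ h2, Complex.cpow_add _ _ two_ne_zero, Complex.cpow_one, rFactor, sFactor]
  generalize Complex.Gamma (a + 1 / 2) = G at *
  generalize a + 1 = x at *
  generalize a + 1 / 2 = y at *
  field_simp
  ring

theorem Gamma_half_sub {a : ℂ} (hG : Complex.Gamma (a + 1 / 2) ≠ 0) :
    Complex.Gamma (1 / 2 - a) =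
      Real.pi / (Complex.cos (Real.pi * a) * Complex.Gamma (a + 1 / 2)) := by
  have h := Complex.Gamma_mul_Gamma_one_sub (a + 1 / 2)
  rw [mul_add, mul_one_div, Complex.sin_add_pi_div_two, show 1 - (a + 1 / 2) = 1 / 2 - a by ring] at h
  rw [← div_div, ← h, mul_div_cancel_left₀ _ hG]

theorem Gamma_two_mul_add_one (a : ℂ) :
    Complex.Gamma (2 * a + 1) =
      Complex.Gamma (a + 1 / 2) * Complex.Gamma (a + 1) * ((2 : ℂ) ^ a) ^ 2 /
        (Real.pi : ℂ) ^ (1 / 2 : ℂ) := by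
  have h := Complex.Gamma_mul_Gamma_add_half (a + 1 / 2)
  have h2 : (2 : ℂ) ^ a ≠ 0 := by simp [Complex.cpow_eq_zero_iff]
  have h3 : (Real.pi : ℂ) ^ (1 / 2 : ℂ) ≠ 0 := by simp [Complex.cpow_eq_zero_iff]
  have e : (2 : ℂ) ^ (1 - 2 * (a + 1 / 2)) = (((2 : ℂ) ^ a) ^ 2)⁻¹ := by
    rw [← Complex.cpow_nat_mul, ← Complex.cpow_neg]
    congr 1
    push_cast
    ring
  have e2 : ((√Real.pi : ℝ) : ℂ) = (Real.pi : ℂ) ^ (1 / 2 : ℂ) := by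
    rw [Real.sqrt_eq_rpow, Complex.ofReal_cpow Real.pi_pos.le]
    simp
  rw [e, e2, show a + 1 / 2 + 1 / 2 = a + 1 by ring, show 2 * (a + 1 / 2) = 2 * a + 1 by ring] at h
  rw [h]
  field_simp

/-- Duplication removes Γ(2a + 1), and reflection turns Γ(3/2 - a) into the cosine. -/
theorem cubeCert_limit_eq {a : ℂ} (ha : a ∈ domain) (hc : Complex.cos (Real.pi * a) ≠ 0) :
    (Complex.Gamma (2 * a + 1) / Complex.Gamma (a + 1 / 2)) ^ 2 *
        (Complex.Gamma (3 / 2 - a) / Complex.Gamma (a + 1 / 2)) *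
        (-16 * (42 * a + 5) / (2 * a - 1)) = scale a * (42 * a + 5) := by
  have h2 : 1 / 2 - a ≠ 0 := by simpa using half_sub_ne hc 0
  have h3 := Complex.Gamma_ne_zero (add_half_ne (two_mul_add_one_ne ha hc))
  have h4 := pi_ne_zero'
  have h5 : (Real.pi : ℂ) ^ (1 / 2 : ℂ) ≠ 0 := by simp [Complex.cpow_eq_zero_iff]
  have h6 : (2 : ℂ) ^ a ≠ 0 := by simp [Complex.cpow_eq_zero_iff]
  have h7 := pi_cpow_half_sq
  rw [scale_eq, Gamma_two_mul_add_one, show 3 / 2 - a = 1 / 2 - a + 1 by ring,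
    Complex.Gamma_add_one _ h2, Gamma_half_sub h3, show 2 * a - 1 = -2 * (1 / 2 - a) by ring]
  generalize Complex.Gamma (a + 1 / 2) = G at *
  generalize Complex.Gamma (a + 1) = G' at *
  generalize 42 * a + 5 = u
  generalize 1 / 2 - a = v at *
  generalize (Real.pi : ℂ) ^ (1 / 2 : ℂ) = q at *
  generalize (2 : ℂ) ^ a = w at *
  rw [← h7] at *
  field_simp
  ring

theorem tsum_cubeTerm_recurrence {a : ℂ} (ha : a ∈ domain) (hc : Complex.cos (Real.pi * a) ≠ 0) :
    ∑' k, 2048 * a ^ 3 / (2 * a - 1) * cubeTerm a k =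
      820 * a ^ 2 + 180 * a + 13 - scale a * (42 * a + 5) +
        rFactor a * ∑' k, 2048 * (a + 1) ^ 3 / (2 * (a + 1) - 1) * cubeTerm (a + 1) k := by
  have h := two_mul_add_one_ne ha hc
  have h' := half_sub_ne hc
  have hc1 : Complex.cos (Real.pi * (a + 1)) ≠ 0 := by simpa using cos_pi_mul_add_nat_ne_zero hc 1
  have ha1 := add_one_mem_domain ha
  have h1 := tsum_sub_eq_of_telescoping ((summable_cubeTerm h h').mul_left _)
    (((summable_cubeTerm (two_mul_add_one_ne ha1 hc1) (half_sub_ne hc1)).mul_left _).mul_left _)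
    (cubeTerm_telescoping h h') (tendsto_cubeCert h h')
  rw [← tsum_mul_left, ← sub_eq_iff_eq_add, h1, cubeCert_limit_eq ha hc]
  have h2 := two_mul_add_one_ne_zero h
  have h3 := two_mul_sub_one_ne_zero h'
  have e : cubePoly a 0 * (1 / 2 - a) =
      ((2 * a + 1) ^ 2 * (2 * a - 1)) * (820 * a ^ 2 + 180 * a + 13) := by
    simp only [cubePoly]; ring
  simp only [cubeTerm, rising_zero, Nat.cast_zero, add_zero, e]
  rw [mul_div_cancel_left₀ _ (mul_ne_zero (pow_ne_zero 2 h2) h3)]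
  ring

/-- Makes the boundary terms met along the iteration of f into `scale a` times the terms of g. -/
theorem fWeight_mul_scale {a : ℂ} (ha : a ∈ domain) (hc : Complex.cos (Real.pi * a) ≠ 0) (n : ℕ) :
    fWeight a n * scale (a + n) = scale a * gWeight a n := by
  induction n with
  | zero => simp [fWeight_zero, gWeight_zero]
  | succ n ih =>
    have h := scale_add_one (add_nat_mem_domain ha n) (cos_pi_mul_add_nat_ne_zero hc n)
    rw [fWeight_succ, gWeight_succ, mul_assoc]
    push_cast
    rw [← add_assoc, h, ← mul_assoc, ih, mul_assoc]

theorem f_eq_scale_mul_g_add {a : ℂ} (ha : a ∈ domain) (hc : Complex.cos (Real.pi * a) ≠ 0) :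
    f a = scale a * g a + 2048 * a ^ 3 / (2 * a - 1) * ∑' n, cubeTerm a n := by
  have hd := add_nat_mem_domain ha
  have hcn := cos_pi_mul_add_nat_ne_zero hc
  have h := tendsto_sum_of_recurrence (a := a) (A := fWeight a)
    (r := rFactor) (F := fun a k => 2048 * a ^ 3 / (2 * a - 1) * cubeTerm a k)
    (P := fun a => 820 * a ^ 2 + 180 * a + 13 - scale a * (42 * a + 5))
    (fWeight_zero a) (fWeight_succ a)
    (fun n => (summable_cubeTerm (two_mul_add_one_ne (hd n) (hcn n))
      (half_sub_ne (hcn n))).mul_left (2048 * (a + n) ^ 3 / (2 * (a + n) - 1)))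
    (fun n => tsum_cubeTerm_recurrence (hd n) (hcn n))
    (fun n h k => norm_cubeTerm_shift_le h (half_sub_ne (hcn n)) k)
  have e : ∀ n : ℕ, fWeight a n *
      (820 * (a + n) ^ 2 + 180 * (a + n) + 13 - scale (a + n) * (42 * (a + n) + 5)) =
      fTerm a n - scale a * gTerm a n := fun n => by
    rw [mul_sub, ← fTerm_eq, ← mul_assoc, fWeight_mul_scale ha hc, mul_assoc, ← gTerm_eq]
  simp only [e] at h
  have h2 := ((summable_fTerm a).sub ((summable_gTerm a).mul_left (scale a))).hasSum.tendsto_sum_nat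
  have h3 := tendsto_nhds_unique h h2
  rw [(summable_fTerm a).tsum_sub ((summable_gTerm a).mul_left (scale a)), tsum_mul_left,
    tsum_mul_left] at h3
  rw [h3, f, g]
  ring

/-- Too narrow a half plane for iterating to the right. It serves to move the formula for g from a +
1 to a. -/
theorem tsum_squareTerm_recurrence {a : ℂ} (ha : a ∈ domain) (hc : Complex.cos (Real.pi * a) ≠ 0)
    (hre : a.re < -(1 / 2)) :
    128 * a ^ 2 / (2 * a - 1) * ∑' k, squareTerm a k = 42 * a + 5 +
        sFactor a * (128 * (a + 1) ^ 2 / (2 * (a + 1) - 1) * ∑' k, squareTerm (a + 1) k) := by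
  have h := two_mul_add_one_ne ha hc
  have h' := half_sub_ne hc
  have hc1 : Complex.cos (Real.pi * (a + 1)) ≠ 0 := by simpa using cos_pi_mul_add_nat_ne_zero hc 1
  have ha1 := add_one_mem_domain ha
  have h1 := tsum_sub_eq_of_telescoping ((summable_squareTerm h h' (by linarith)).mul_left _)
    (((summable_squareTerm (two_mul_add_one_ne ha1 hc1) (half_sub_ne hc1)
      (by simp; linarith)).mul_left _).mul_left _)
    (squareTerm_telescoping h h') (tendsto_squareCert h h' hre)
  rw [← tsum_mul_left, ← tsum_mul_left, ← tsum_mul_left, ← sub_eq_iff_eq_add, h1]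
  have h2 := two_mul_add_one_ne_zero h
  have h3 := two_mul_sub_one_ne_zero h'
  have e : squarePoly a 0 * (1 / 2 - a) = ((2 * a + 1) * (2 * a - 1)) * (42 * a + 5) := by
    simp only [squarePoly]; ring
  simp only [squareTerm, rising_zero, Nat.cast_zero, add_zero, e]
  rw [mul_div_cancel_left₀ _ (mul_ne_zero h2 h3)]
  ring

section

/-! ### Hypergeometric series with a unit parameter as incomplete beta integrals -/

open MeasureTheory Set ProbabilityTheory

/-- The real number `(b)_k / (d)_k`. -/
noncomputable def pochRatio (b d : ℝ) (k : ℕ) : ℝ := ∏ j ∈ Finset.range k, (b + j) / (d + j)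

/-- The series `∑ (b)_k / (d)_k u ^ k`. -/
noncomputable def unitHyp (b d u : ℝ) : ℝ := ∑' k, pochRatio b d k * u ^ k

/-- The integrand of the beta integral. -/
noncomputable def betaIntegrand (p q x : ℝ) : ℝ := x ^ (p - 1) * (1 - x) ^ (q - 1)

@[simp] theorem pochRatio_zero (b d : ℝ) : pochRatio b d 0 = 1 := by simp [pochRatio]

theorem pochRatio_succ {b d : ℝ} (hd : 0 < d) (k : ℕ) :
    (d + k) * pochRatio b d (k + 1) = (b + k) * pochRatio b d k := by
  have : d + k ≠ 0 := by positivity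
  rw [pochRatio, Finset.prod_range_succ, ← pochRatio]
  field_simp

theorem pochRatio_nonneg {b d : ℝ} (hb : 0 < b) (hd : 0 < d) (k : ℕ) : 0 ≤ pochRatio b d k :=
  Finset.prod_nonneg fun j _ => by positivity

theorem pochRatio_le_one {b d : ℝ} (hb : 0 < b) (hbd : b ≤ d) (k : ℕ) : pochRatio b d k ≤ 1 := by
  have hd : 0 < d := hb.trans_le hbd
  refine Finset.prod_le_one (fun j _ => by positivity) fun j _ => ?_
  rw [div_le_one (by positivity)]
  linarith

theorem norm_pochRatio_le_one {b d : ℝ} (hb : 0 < b) (hbd : b ≤ d) (k : ℕ) :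
    ‖pochRatio b d k‖ ≤ 1 := by
  rw [Real.norm_of_nonneg (pochRatio_nonneg hb (hb.trans_le hbd) k)]
  exact pochRatio_le_one hb hbd k

theorem summable_nat_mul_pochRatio {b d u : ℝ} (hb : 0 < b) (hbd : b ≤ d) (hu : |u| < 1) (j : ℕ) :
    Summable fun k : ℕ => (k : ℝ) ^ j * (pochRatio b d k * u ^ k) := by
  refine Summable.of_norm_bounded (summable_pow_mul_geometric_of_norm_lt_one (R := ℝ) j
    (by simpa using hu : ‖|u|‖ < 1)) fun k => ?_
  rw [norm_mul, norm_mul, norm_pow, norm_pow, Real.norm_natCast, Real.norm_eq_abs u]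
  gcongr
  exact mul_le_of_le_one_left (by positivity) (norm_pochRatio_le_one hb hbd k)

theorem hasDerivAt_unitHyp {b d u : ℝ} (hb : 0 < b) (hbd : b ≤ d) (hu : |u| < 1) :
    HasDerivAt (unitHyp b d) (∑' k : ℕ, pochRatio b d k * (k * u ^ (k - 1))) u := by
  obtain ⟨r, hr, hr1⟩ := exists_between hu
  have hr0 : 0 < r := (abs_nonneg u).trans_lt hr
  have hs : Summable fun k : ℕ => (k : ℝ) * r ^ (k - 1) := by
    have h := (summable_pow_mul_geometric_of_norm_lt_one (R := ℝ) 1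
      (by rwa [Real.norm_of_nonneg hr0.le] : ‖r‖ < 1)).mul_right r⁻¹
    refine h.congr fun k => ?_
    rcases k with _ | k
    · simp
    · rw [pow_one, Nat.add_sub_cancel, pow_succ]; field_simp
  refine hasDerivAt_tsum_of_isPreconnected hs (t := Metric.ball (0 : ℝ) r)
    (g := fun k y => pochRatio b d k * y ^ k)
    (g' := fun k y => pochRatio b d k * (k * y ^ (k - 1))) Metric.isOpen_ball
    (convex_ball _ _).isPreconnected (fun k y _ => (hasDerivAt_pow k y).const_mul _)
    (fun k y hy => ?_) (y₀ := 0) (Metric.mem_ball_self hr0) ?_ (by simpa using hr)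
  · rw [norm_mul, norm_mul, norm_pow, Real.norm_natCast]
    have hy' : ‖y‖ ≤ r := (mem_ball_zero_iff.1 hy).le
    calc _ ≤ 1 * ((k : ℝ) * r ^ (k - 1)) := by
          gcongr
          exact norm_pochRatio_le_one hb hbd k
      _ = _ := one_mul _
  · refine summable_of_ne_finset_zero (s := {0}) fun k hk => ?_
    simp at hk
    simp [hk]

/-- The upper parameter 1 cancels k!, so the coefficients obey (d + k) c_{k+1} = (b + k) c_k and the
equation has order one only. -/
theorem unitHyp_ode {b d u : ℝ} (hb : 0 < b) (hbd : b ≤ d) (hu : |u| < 1) :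
    u * (1 - u) * (∑' k : ℕ, pochRatio b d k * (k * u ^ (k - 1))) +
      (d - 1 - b * u) * unitHyp b d u = d - 1 := by
  have hd : 0 < d := hb.trans_le hbd
  have s0 : Summable fun k : ℕ => pochRatio b d k * u ^ k := by
    simpa using summable_nat_mul_pochRatio hb hbd hu 0
  have s1 : Summable fun k : ℕ => (k : ℝ) * (pochRatio b d k * u ^ k) := by
    simpa using summable_nat_mul_pochRatio hb hbd hu 1
  have e1 : u * (∑' k : ℕ, pochRatio b d k * (k * u ^ (k - 1)))
      = ∑' k : ℕ, (k : ℝ) * (pochRatio b d k * u ^ k) := by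
    rw [← tsum_mul_left]
    refine tsum_congr fun k => ?_
    rcases k with _ | k
    · simp
    · rw [pow_succ, Nat.add_sub_cancel]; push_cast; ring
  have se : Summable fun k : ℕ => (k + d - 1) * (pochRatio b d k * u ^ k) := by
    refine (s1.add (s0.mul_left (d - 1))).congr fun k => ?_
    ring
  -- The coefficient recurrence summed after an index shift. The term k = 0 gives the inhomogeneity
  -- d - 1.
  have e2 : ∑' k : ℕ, (k + d - 1) * (pochRatio b d k * u ^ k) =
      (d - 1) + u * ∑' k : ℕ, (k + b) * (pochRatio b d k * u ^ k) := by
    rw [se.tsum_eq_zero_add, ← tsum_mul_left]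
    simp only [Nat.cast_zero, zero_add, pochRatio_zero, pow_zero, mul_one]
    congr 1
    refine tsum_congr fun k => ?_
    have := pochRatio_succ (b := b) hd k
    push_cast
    rw [pow_succ]
    linear_combination u ^ k * u * this
  have e3 : ∑' k : ℕ, (k + d - 1) * (pochRatio b d k * u ^ k) =
      ∑' k : ℕ, (k : ℝ) * (pochRatio b d k * u ^ k) + (d - 1) * unitHyp b d u := by
    rw [unitHyp, ← tsum_mul_left, ← s1.tsum_add (s0.mul_left _)]
    exact tsum_congr fun k => by ring
  have e4 : ∑' k : ℕ, (k + b) * (pochRatio b d k * u ^ k) =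
      ∑' k : ℕ, (k : ℝ) * (pochRatio b d k * u ^ k) + b * unitHyp b d u := by
    rw [unitHyp, ← tsum_mul_left, ← s1.tsum_add (s0.mul_left _)]
    exact tsum_congr fun k => by ring
  rw [e3, e4] at e2
  linear_combination (1 - u) * e1 + e2

theorem ofReal_betaIntegrand {p q x : ℝ} (hx : x ∈ Icc (0 : ℝ) 1) :
    ((betaIntegrand p q x : ℝ) : ℂ) = (x : ℂ) ^ ((p : ℂ) - 1) * (1 - (x : ℂ)) ^ ((q : ℂ) - 1) := by
  rw [betaIntegrand, Complex.ofReal_mul, Complex.ofReal_cpow hx.1,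
    Complex.ofReal_cpow (by linarith [hx.2])]
  push_cast
  rfl

theorem intervalIntegrable_betaIntegrand {p q : ℝ} (hp : 0 < p) (hq : 0 < q) :
    IntervalIntegrable (betaIntegrand p q) volume 0 1 := by
  have h := Complex.betaIntegral_convergent (u := p) (v := q) (by simpa) (by simpa)
  rw [intervalIntegrable_iff_integrableOn_Icc_of_le zero_le_one] at h ⊢
  have h2 := h.re
  refine h2.congr ?_
  filter_upwards [ae_restrict_mem measurableSet_Icc] with x hx
  rw [← ofReal_betaIntegrand hx]
  simp

theorem integral_betaIntegrand {p q : ℝ} (hp : 0 < p) (hq : 0 < q) :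
    ∫ x in (0 : ℝ)..1, betaIntegrand p q x = beta p q := by
  rw [beta_eq_betaIntegralReal _ _ hp hq, Complex.betaIntegral]
  have : ∫ x : ℝ in (0 : ℝ)..1, (x : ℂ) ^ ((p : ℂ) - 1) * (1 - (x : ℂ)) ^ ((q : ℂ) - 1)
      = ∫ x : ℝ in (0 : ℝ)..1, ((betaIntegrand p q x : ℝ) : ℂ) := by
    refine intervalIntegral.integral_congr fun x hx => ?_
    rw [uIcc_of_le zero_le_one] at hx
    exact (ofReal_betaIntegrand hx).symm
  rw [this, intervalIntegral.integral_ofReal, Complex.ofReal_re]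

/-- u^(d-1) (1 - u)^(1+b-d) is the integrating factor of `unitHyp_ode`. The conditions 1 < d < 1 + b
make the beta integrand integrable at both ends. -/
theorem unitHyp_mul_eq_integral {b d u : ℝ} (hb : 0 < b) (hbd : b ≤ d) (hd : 1 < d)
    (hbd' : d < 1 + b) (hu0 : 0 < u) (hu1 : u < 1) :
    unitHyp b d u * (u ^ (d - 1) * (1 - u) ^ (1 + b - d)) =
      (d - 1) * ∫ t in (0 : ℝ)..u, betaIntegrand (d - 1) (1 + b - d) t := by
  have habs : ∀ t ∈ Icc 0 u, |t| < 1 := fun t ht => by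
    rw [abs_of_nonneg ht.1]; linarith [ht.2]
  have hint : IntervalIntegrable (fun t => (d - 1) * betaIntegrand (d - 1) (1 + b - d) t) volume
      0 u := by
    refine ((intervalIntegrable_betaIntegrand (by linarith) (by linarith)).mono_set ?_).const_mul _
    rw [uIcc_of_le hu0.le, uIcc_of_le zero_le_one]
    exact Icc_subset_Icc le_rfl hu1.le
  have h := intervalIntegral.integral_eq_sub_of_hasDerivAt_of_le hu0.le
    (f := fun t => unitHyp b d t * (t ^ (d - 1) * (1 - t) ^ (1 + b - d))) ?_ ?_ hint
  · rw [← intervalIntegral.integral_const_mul, h]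
    simp [Real.zero_rpow (by linarith : d - 1 ≠ 0)]
  · refine ContinuousOn.mul (fun t ht =>
      (hasDerivAt_unitHyp hb hbd (habs t ht)).continuousAt.continuousWithinAt) ?_
    refine ContinuousOn.mul (fun t ht => ?_) (fun t ht => ?_)
    · exact (Real.continuousAt_rpow_const _ _ (Or.inr (by linarith))).continuousWithinAt
    · exact (ContinuousAt.rpow_const (by fun_prop)
        (Or.inl (by linarith [ht.2]))).continuousWithinAt
  · intro t ht
    have ht1 : 0 < 1 - t := by linarith [ht.2]
    have ode := unitHyp_ode hb hbd (habs t ⟨ht.1.le, ht.2.le⟩)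
    have h1 := hasDerivAt_unitHyp hb hbd (habs t ⟨ht.1.le, ht.2.le⟩)
    have h2 := Real.hasDerivAt_rpow_const (x := t) (p := d - 1) (Or.inl ht.1.ne')
    have h3 := ((hasDerivAt_id t).const_sub 1).rpow_const (p := 1 + b - d) (Or.inl ht1.ne')
    convert! h1.mul (h2.mul h3) using 1
    simp only [betaIntegrand, id_eq, Pi.mul_apply]
    have e1 : t ^ (d - 1) = t ^ (d - 1 - 1) * t := by
      rw [← Real.rpow_add_one ht.1.ne']; ring_nf
    have e2 : (1 - t) ^ (1 + b - d) = (1 - t) ^ (1 + b - d - 1) * (1 - t) := by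
      rw [← Real.rpow_add_one ht1.ne']; ring_nf
    rw [e1, e2]
    linear_combination -(t ^ (d - 1 - 1) * (1 - t) ^ (1 + b - d - 1)) * ode

theorem betaIntegrand_symm (p q x : ℝ) : betaIntegrand p q (1 - x) = betaIntegrand q p x := by
  rw [betaIntegrand, betaIntegrand, sub_sub_cancel, mul_comm]

/-- Taking d = 2b at u and d = 2 - b at 1 - u gives beta integrands with swapped exponents, so the
two incomplete integrals together fill (0, 1). -/
theorem unitHyp_connection {b u : ℝ} (hb : 1 / 2 < b) (hb1 : b < 1) (hu0 : 0 < u) (hu1 : u < 1) :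
    unitHyp b (2 * b) u / (2 * b - 1) + unitHyp b (2 - b) (1 - u) / (1 - b) =
      beta (2 * b - 1) (1 - b) * (u ^ (1 - 2 * b) * (1 - u) ^ (b - 1)) := by
  have h1 := unitHyp_mul_eq_integral (b := b) (d := 2 * b) (by linarith) (by linarith) (by linarith)
    (by linarith) hu0 hu1
  have h2 := unitHyp_mul_eq_integral (b := b) (d := 2 - b) (u := 1 - u) (by linarith) (by linarith)
    (by linarith) (by linarith) (by linarith) (by linarith)
  rw [show (1 + b - 2 * b) = 1 - b by ring] at h1
  rw [show (1 + b - (2 - b)) = 2 * b - 1 by ring, show 2 - b - 1 = 1 - b by ring,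
    sub_sub_cancel] at h2
  have h3 : ∫ t in (0 : ℝ)..(1 - u), betaIntegrand (1 - b) (2 * b - 1) t
      = ∫ t in u..1, betaIntegrand (2 * b - 1) (1 - b) t := by
    have := intervalIntegral.integral_comp_sub_left
      (f := betaIntegrand (1 - b) (2 * b - 1)) (a := u) (b := 1) 1
    simp only [betaIntegrand_symm, sub_self] at this
    exact this.symm
  have hI := intervalIntegrable_betaIntegrand (p := 2 * b - 1) (q := 1 - b) (by linarith)
    (by linarith)
  have h4 : (∫ t in (0 : ℝ)..u, betaIntegrand (2 * b - 1) (1 - b) t) +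
      ∫ t in u..1, betaIntegrand (2 * b - 1) (1 - b) t = beta (2 * b - 1) (1 - b) := by
    rw [← integral_betaIntegrand (by linarith) (by linarith)]
    refine intervalIntegral.integral_add_adjacent_intervals (hI.mono_set ?_) (hI.mono_set ?_)
    · rw [uIcc_of_le hu0.le, uIcc_of_le zero_le_one]
      exact Icc_subset_Icc le_rfl hu1.le
    · rw [uIcc_of_le hu1.le, uIcc_of_le zero_le_one]
      exact Icc_subset_Icc hu0.le le_rfl
  have hu1' : 0 < 1 - u := by linarith
  have n1 : 2 * b - 1 ≠ 0 := by linarith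
  have n2 : 1 - b ≠ 0 := by linarith
  rw [h3] at h2
  rw [← h4, show 1 - 2 * b = -(2 * b - 1) by ring, show b - 1 = -(1 - b) by ring,
    Real.rpow_neg hu0.le, Real.rpow_neg hu1'.le]
  have p1 : 0 < u ^ (2 * b - 1) := Real.rpow_pos_of_pos hu0 _
  have p2 : 0 < (1 - u) ^ (1 - b) := Real.rpow_pos_of_pos hu1' _
  generalize u ^ (2 * b - 1) = x at *
  generalize (1 - u) ^ (1 - b) = y at *
  have h1' : unitHyp b (2 * b) u = (2 * b - 1) *
      (∫ t in (0 : ℝ)..u, betaIntegrand (2 * b - 1) (1 - b) t) / (x * y) := by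
    rw [← h1]; field_simp
  have h2' : unitHyp b (2 - b) (1 - u) = (1 - b) *
      (∫ t in u..1, betaIntegrand (2 * b - 1) (1 - b) t) / (x * y) := by
    rw [← h2]; field_simp
  rw [h1', h2']
  generalize 2 * b - 1 = m at *
  generalize 1 - b = n at *
  field_simp

theorem beta_add_nat {p q : ℝ} (hp : 0 < p) (hq : 0 < q) (k : ℕ) :
    beta (p + k) q = beta p q * pochRatio p (p + q) k := by
  induction k with
  | zero => simp
  | succ k ih =>
    have h := pochRatio_succ (b := p) (d := p + q) (by linarith) k
    have hk : 0 < p + k := by positivity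
    have hk' : 0 < p + q + k := by positivity
    have e : beta (p + (k + 1 : ℕ)) q * (p + q + k) = beta (p + k) q * (p + k) := by
      have g := Real.Gamma_pos_of_pos hk'
      rw [beta, beta]
      push_cast
      rw [← add_assoc, Real.Gamma_add_one hk.ne', show p + k + 1 + q = p + q + k + 1 by ring,
        show p + k + q = p + q + k by ring, Real.Gamma_add_one hk'.ne']
      field_simp
    rw [ih] at e
    refine mul_right_cancel₀ hk'.ne' (e.trans ?_)
    linear_combination -beta p q * h

theorem beta_comm (p q : ℝ) : beta p q = beta q p := by
  rw [beta, beta, mul_comm, add_comm]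

theorem integral_mul_betaIntegrand {b d p q : ℝ} (hb : 0 < b) (hd : 0 < d) (hp : 0 < p)
    (hq : 0 < q) (k : ℕ) {V : ℝ} (hV : beta p q = V) :
    IntegrableOn (fun x => pochRatio b d k * betaIntegrand p q x) (Ioo 0 1) ∧
    (∫ x in Ioo (0 : ℝ) 1, pochRatio b d k * betaIntegrand p q x = pochRatio b d k * V) ∧
    ∀ x ∈ Ioo (0 : ℝ) 1, 0 ≤ pochRatio b d k * betaIntegrand p q x := by
  refine ⟨((intervalIntegrable_iff_integrableOn_Ioo_of_le zero_le_one).1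
    (intervalIntegrable_betaIntegrand hp hq)).const_mul _, ?_, fun x hx => ?_⟩
  · rw [integral_const_mul, ← integral_Ioc_eq_integral_Ioo,
      ← intervalIntegral.integral_of_le zero_le_one, integral_betaIntegrand hp hq, hV]
  · exact mul_nonneg (pochRatio_nonneg hb hd k) (mul_nonneg (Real.rpow_nonneg hx.1.le _)
      (Real.rpow_nonneg (by linarith [hx.2]) _))

/-- A three-term relation between two `₃F₂(1)` series and a product of Gamma functions. -/
theorem three_term_relation {b : ℝ} (hb : 1 / 2 < b) (hb1 : b < 1)
    (hs1 : Summable fun k => pochRatio b (2 * b) k * pochRatio b (2 * b) k)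
    (hs2 : Summable fun k => pochRatio b (2 - b) k * pochRatio b (2 * b) k) :
    (∑' k, pochRatio b (2 * b) k * pochRatio b (2 * b) k) / (2 * b - 1) +
      (∑' k, pochRatio b (2 - b) k * pochRatio b (2 * b) k) / (1 - b) =
    beta (2 * b - 1) (1 - b) ^ 2 / beta b b := by
  have hb0 : 0 < b := by linarith
  have n1 : 0 < 2 * b - 1 := by linarith
  have n2 : 0 < 1 - b := by linarith
  have hB := beta_pos hb0 hb0
  -- Integrating x^k or (1 - x)^k against x^(b-1) (1 - x)^(b-1) inserts the second factor (b)_k /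
  -- (2b)_k. Integrating `unitHyp_connection` against this weight gives the relation.
  have hv : ∀ k : ℕ, beta (b + k) b = beta b b * pochRatio b (2 * b) k := fun k => by
    rw [beta_add_nat hb0 hb0, two_mul]
  have A1 := fun k : ℕ => integral_mul_betaIntegrand (d := 2 * b) hb0 (by linarith)
    (by positivity : 0 < b + k) hb0 k (hv k)
  have A2 := fun k : ℕ => integral_mul_betaIntegrand (d := 2 - b) hb0 (by linarith)
    hb0 (by positivity : 0 < b + k) k ((beta_comm _ _).trans (hv k))
  have hF := fun k : ℕ => ((A1 k).1.div_const (2 * b - 1)).add ((A2 k).1.div_const (1 - b))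
  have hnn : ∀ k : ℕ, ∀ x ∈ Ioo (0 : ℝ) 1,
      0 ≤ pochRatio b (2 * b) k * betaIntegrand (b + k) b x / (2 * b - 1) +
        pochRatio b (2 - b) k * betaIntegrand b (b + k) x / (1 - b) := fun k x hx =>
    add_nonneg (div_nonneg ((A1 k).2.2 x hx) n1.le) (div_nonneg ((A2 k).2.2 x hx) n2.le)
  have hval : ∀ k : ℕ, ∫ x in Ioo (0 : ℝ) 1,
      (pochRatio b (2 * b) k * betaIntegrand (b + k) b x / (2 * b - 1) +
        pochRatio b (2 - b) k * betaIntegrand b (b + k) x / (1 - b)) =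
      beta b b * (pochRatio b (2 * b) k * pochRatio b (2 * b) k / (2 * b - 1) +
        pochRatio b (2 - b) k * pochRatio b (2 * b) k / (1 - b)) := fun k => by
    rw [integral_add ((A1 k).1.div_const (2 * b - 1)) ((A2 k).1.div_const (1 - b)),
      integral_div, integral_div, (A1 k).2.1, (A2 k).2.1]
    ring
  -- All terms are nonnegative on (0, 1), so the L¹ norms are the integrals themselves and `hs1`,
  -- `hs2` justify termwise integration.
  have hnorm : ∀ k : ℕ, ∫ x in Ioo (0 : ℝ) 1,
      ‖pochRatio b (2 * b) k * betaIntegrand (b + k) b x / (2 * b - 1) +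
        pochRatio b (2 - b) k * betaIntegrand b (b + k) x / (1 - b)‖ =
      beta b b * (pochRatio b (2 * b) k * pochRatio b (2 * b) k / (2 * b - 1) +
        pochRatio b (2 - b) k * pochRatio b (2 * b) k / (1 - b)) := fun k => by
    rw [← hval]
    exact setIntegral_congr_fun measurableSet_Ioo fun x hx => Real.norm_of_nonneg (hnn k x hx)
  have hs := (hs1.div_const (2 * b - 1)).add (hs2.div_const (1 - b))
  have hsum := hasSum_integral_of_summable_integral_norm
    (μ := volume.restrict (Ioo (0 : ℝ) 1))
    (F := fun (k : ℕ) x => pochRatio b (2 * b) k * betaIntegrand (b + k) b x / (2 * b - 1) +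
        pochRatio b (2 - b) k * betaIntegrand b (b + k) x / (1 - b))
    hF (by simpa only [hnorm] using hs.mul_left _)
  have heq : ∀ x ∈ Ioo (0 : ℝ) 1,
      ∑' k : ℕ, (pochRatio b (2 * b) k * betaIntegrand (b + k) b x / (2 * b - 1) +
        pochRatio b (2 - b) k * betaIntegrand b (b + k) x / (1 - b))
      = beta (2 * b - 1) (1 - b) * betaIntegrand (1 - b) (2 * b - 1) x := fun x hx => by
    have hx' : 0 < 1 - x := by linarith [hx.2]
    have s1 := summable_nat_mul_pochRatio (b := b) (d := 2 * b) (u := x) hb0 (by linarith)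
      (by rw [abs_of_pos hx.1]; exact hx.2) 0
    have s2 := summable_nat_mul_pochRatio (b := b) (d := 2 - b) (u := 1 - x) hb0 (by linarith)
      (by rw [abs_of_pos hx']; linarith [hx.1]) 0
    simp only [pow_zero, one_mul] at s1 s2
    have e : ∀ k : ℕ, pochRatio b (2 * b) k * betaIntegrand (b + k) b x / (2 * b - 1) +
        pochRatio b (2 - b) k * betaIntegrand b (b + k) x / (1 - b) =
        betaIntegrand b b x / (2 * b - 1) * (pochRatio b (2 * b) k * x ^ k) +
        betaIntegrand b b x / (1 - b) * (pochRatio b (2 - b) k * (1 - x) ^ k) := fun k => by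
      simp only [betaIntegrand]
      rw [add_sub_right_comm, Real.rpow_add_natCast hx.1.ne', Real.rpow_add_natCast hx'.ne']
      ring
    have hc := unitHyp_connection hb hb1 hx.1 hx.2
    rw [tsum_congr e, (s1.mul_left _).tsum_add (s2.mul_left _), tsum_mul_left, tsum_mul_left,
      ← unitHyp, ← unitHyp]
    have e1 : x ^ (1 - b - 1) = x ^ (b - 1) * x ^ (1 - 2 * b) := by
      rw [← Real.rpow_add hx.1]; ring_nf
    have e2 : (1 - x) ^ (2 * b - 1 - 1) = (1 - x) ^ (b - 1) * (1 - x) ^ (b - 1) := by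
      rw [← Real.rpow_add hx']; ring_nf
    simp only [betaIntegrand]
    rw [e1, e2]
    linear_combination x ^ (b - 1) * (1 - x) ^ (b - 1) * hc
  rw [setIntegral_congr_fun measurableSet_Ioo heq, integral_const_mul,
    ← integral_Ioc_eq_integral_Ioo, ← intervalIntegral.integral_of_le zero_le_one,
    integral_betaIntegrand n2 n1, beta_comm (1 - b)] at hsum
  simp only [hval] at hsum
  have h := hsum.unique (hs.hasSum.mul_left (beta b b))
  rw [(hs1.div_const _).tsum_add (hs2.div_const _), tsum_div_const, tsum_div_const] at h
  rw [eq_div_iff hB.ne', sq, h, mul_comm]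

end

/-! ### Locally uniform bounds for quotients of rising factorials -/

theorem norm_rising_ofReal {x : ℝ} (hx : 0 < x) (n : ℕ) :
    ‖rising x n‖ = ∏ j ∈ Finset.range n, (x + j) := by
  rw [rising_eq_prod, norm_prod]
  refine Finset.prod_congr rfl fun j _ => ?_
  rw [← Complex.ofReal_natCast, ← Complex.ofReal_add, Complex.norm_real,
    Real.norm_of_nonneg (by positivity)]

theorem norm_rising_ofReal_le {x : ℝ} {z : ℂ} (hx : 0 < x) (hz : x ≤ z.re) (n : ℕ) :
    ‖rising x n‖ ≤ ‖rising z n‖ := by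
  rw [norm_rising_ofReal hx, rising_eq_prod, norm_prod]
  refine Finset.prod_le_prod (fun j _ => by positivity) fun j _ => ?_
  refine le_trans ?_ (Complex.re_le_norm _)
  simpa using hz

/-- |z + j| ≤ (1 + t_j)(Re z + j) with t_j = Y²/(x₀ + j)². The product of the 1 + t_j is at most
exp(∑ t_j), uniformly in n and z. -/
theorem exists_norm_rising_le (x₀ x₁ Y : ℝ) (hx₀ : 0 < x₀) :
    ∃ C : ℝ, 0 ≤ C ∧ ∀ z : ℂ, x₀ ≤ z.re → z.re ≤ x₁ → |z.im| ≤ Y → ∀ n,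
      ‖rising z n‖ ≤ C * ‖rising x₁ n‖ := by
  have hs : Summable fun j : ℕ => Y ^ 2 / (x₀ + j) ^ 2 := by
    have h := (Real.summable_one_div_nat_add_rpow x₀ 2).2 (by norm_num)
    refine (h.mul_left (Y ^ 2)).congr fun j => ?_
    have : (0 : ℝ) < j + x₀ := by positivity
    rw [abs_of_pos this, add_comm]
    norm_num
    rfl
  refine ⟨Real.exp (∑' j : ℕ, Y ^ 2 / (x₀ + j) ^ 2), (Real.exp_pos _).le,
    fun z h0 h1 hY n => ?_⟩
  rw [norm_rising_ofReal (by linarith), rising_eq_prod, norm_prod]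
  have step : ∀ j ∈ Finset.range n, ‖z + j‖ ≤ Real.exp (Y ^ 2 / (x₀ + j) ^ 2) * (x₁ + j) := by
    intro j _
    have hp : 0 < x₀ + j := by positivity
    have hp1 : 0 < z.re + j := by linarith
    set t := Y ^ 2 / (x₀ + j) ^ 2 with ht
    have ht0 : 0 ≤ t := by positivity
    have hY2 : Y ^ 2 = t * (x₀ + j) ^ 2 := by rw [ht]; field_simp
    have him : z.im ^ 2 ≤ Y ^ 2 := by
      rw [← sq_abs]; gcongr
    have h2 : ‖z + j‖ ≤ (1 + t) * (z.re + j) := by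
      rw [Complex.norm_def]
      refine Real.sqrt_le_iff.2 ⟨by positivity, ?_⟩
      rw [Complex.normSq_apply]
      simp only [Complex.add_re, Complex.natCast_re, Complex.add_im, Complex.natCast_im, add_zero]
      have h3 : (x₀ + j) ^ 2 ≤ (z.re + j) ^ 2 := by gcongr
      have h4 : t * (x₀ + j) ^ 2 ≤ t * (z.re + j) ^ 2 := by gcongr
      have h5 : 0 ≤ (t + t ^ 2) * (z.re + j) ^ 2 := by positivity
      nlinarith
    refine h2.trans ?_
    gcongr
    linarith [Real.add_one_le_exp t]
  refine (Finset.prod_le_prod (fun _ _ => norm_nonneg _) step).trans ?_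
  rw [Finset.prod_mul_distrib, ← Real.exp_sum]
  have : 0 ≤ ∏ j ∈ Finset.range n, (x₁ + (j : ℝ)) :=
    Finset.prod_nonneg fun j _ => by
      have : (0 : ℝ) ≤ j := by positivity
      linarith
  gcongr
  exact hs.sum_le_tsum _ fun j _ => by positivity

/-- A common form of the series with rising factorials of `a + x`, `2 a + y` and `z - a`. -/
noncomputable def quotTerm (q : ℕ) (x y z : ℝ) (a : ℂ) (n : ℕ) : ℂ :=
  rising (a + x) n ^ (q + 1) / (rising (2 * a + y) n ^ q * rising (z - a) n)

theorem summable_quot_ofReal (q : ℕ) {x y z : ℝ} (hx : 0 < x) (hy : 0 < y) (hz : 0 < z)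
    (h : 1 < q * (y - x) + (z - x)) :
    Summable fun n => rising (x : ℂ) n ^ (q + 1) / (rising (y : ℂ) n ^ q * rising (z : ℂ) n) := by
  have hx' := ne_neg_nat_of_re_pos (x := (x : ℂ)) (by simpa)
  have h1 := tendsto_rising_div_rising hx' (ne_neg_nat_of_re_pos (x := (y : ℂ)) (by simpa))
  have h2 := tendsto_rising_div_rising hx' (ne_neg_nat_of_re_pos (x := (z : ℂ)) (by simpa))
  refine summable_of_tendsto_mul_cpow (s := q * ((y : ℂ) - x) + (z - x)) (by simpa using h)
    (((h1.pow q).mul h2).congr' ?_)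
  filter_upwards [eventually_ne_atTop 0] with n hn
  have hn' : (n : ℂ) ≠ 0 := by exact_mod_cast hn
  rw [Complex.cpow_add _ _ hn', Complex.cpow_nat_mul]
  generalize (n : ℂ) ^ ((y : ℂ) - x) = u
  generalize (n : ℂ) ^ ((z : ℂ) - x) = v
  rw [mul_pow, div_pow]
  generalize rising (y : ℂ) n ^ q = D
  generalize rising (z : ℂ) n = E
  ring

theorem differentiableAt_tsum_quotTerm (q : ℕ) {x y z : ℝ} {a : ℂ} (hx : 0 < a.re + x)
    (hy : 0 < 2 * a.re + y) (hz : 0 < z - a.re)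
    (h : 1 < q * (2 * a.re + y - (a.re + x)) + (z - a.re - (a.re + x))) :
    DifferentiableAt ℂ (fun a => ∑' n, quotTerm q x y z a n) a := by
  -- ε is small enough that the real majorant, with the worst parameters in the ball, still has
  -- positive arguments and decay exponent above 1.
  obtain ⟨ε, hε, h1, h2, h3, h4⟩ : ∃ ε : ℝ, 0 < ε ∧ 0 < a.re + x - ε ∧ 0 < 2 * a.re + y - 2 * ε ∧
      0 < z - a.re - ε ∧ 1 < q * (2 * a.re + y - 2 * ε - (a.re + x + ε)) +
        (z - a.re - ε - (a.re + x + ε)) := by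
    have c : ∀ F : ℝ → ℝ, Continuous F → ∀ t, t < F 0 → ∀ᶠ ε in 𝓝[>] 0, t < F ε :=
      fun F hF t ht => (hF.continuousAt.eventually (lt_mem_nhds ht)).filter_mono nhdsWithin_le_nhds
    have e0 : ∀ᶠ ε : ℝ in 𝓝[>] 0, 0 < ε := eventually_mem_nhdsWithin
    exact (e0.and ((c (fun ε => a.re + x - ε) (by fun_prop) 0 (by simpa)).and
      ((c (fun ε => 2 * a.re + y - 2 * ε) (by fun_prop) 0 (by simpa)).and
      ((c (fun ε => z - a.re - ε) (by fun_prop) 0 (by linarith)).and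
      (c (fun ε => q * (2 * a.re + y - 2 * ε - (a.re + x + ε)) + (z - a.re - ε - (a.re + x + ε)))
        (by fun_prop) 1 (by simpa)))))).exists
  obtain ⟨C, hC0, hC⟩ := exists_norm_rising_le (a.re + x - ε) (a.re + x + ε) (|a.im| + ε) h1
  have hs := ((summable_quot_ofReal q (x := a.re + x + ε) (by linarith) h2 h3 h4).norm).mul_left
    (C ^ (q + 1))
  have hre : ∀ b ∈ Metric.ball a ε, |b.re - a.re| < ε ∧ |b.im - a.im| < ε := fun b hb => by
    have hb' := mem_ball_iff_norm.1 hb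
    exact ⟨(Complex.abs_re_le_norm (b - a)).trans_lt hb',
      (Complex.abs_im_le_norm (b - a)).trans_lt hb'⟩
  refine (Complex.differentiableOn_tsum_of_summable_norm hs (U := Metric.ball a ε)
    (fun n b hb => ?_) Metric.isOpen_ball (fun n b hb => ?_)).differentiableAt
    (Metric.ball_mem_nhds a hε)
  · obtain ⟨hb1, hb2⟩ := hre b hb
    rw [abs_lt] at hb1
    have n1 := rising_ne_zero (ne_neg_nat_of_re_pos (x := 2 * b + y) (by simp; linarith)) n
    have n2 := rising_ne_zero (ne_neg_nat_of_re_pos (x := (z : ℂ) - b) (by simp; linarith)) n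
    have d1 : DifferentiableAt ℂ (fun a : ℂ => rising (a + x) n) b :=
      (differentiable_rising n).differentiableAt.comp b (by fun_prop)
    have d2 : DifferentiableAt ℂ (fun a : ℂ => rising (2 * a + y) n) b :=
      (differentiable_rising n).differentiableAt.comp b (by fun_prop)
    have d3 : DifferentiableAt ℂ (fun a : ℂ => rising (z - a) n) b :=
      (differentiable_rising n).differentiableAt.comp b (by fun_prop)
    exact ((d1.pow (q + 1)).div ((d2.pow q).mul d3)
      (mul_ne_zero (pow_ne_zero _ n1) n2)).differentiableWithinAt
  · obtain ⟨hb1, hb2⟩ := hre b hb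
    have him : |b.im| ≤ |a.im| + ε := by
      have := abs_sub_abs_le_abs_sub b.im a.im
      linarith
    rw [abs_lt] at hb1
    have b1 := hC (b + x) (by simp; linarith) (by simp; linarith) (by simpa using him) n
    have b2 := norm_rising_ofReal_le (z := 2 * b + y) h2 (by simp; linarith) n
    have b3 := norm_rising_ofReal_le (z := (z : ℂ) - b) h3 (by simp; linarith) n
    have p2 : 0 < ‖rising ((2 * a.re + y - 2 * ε : ℝ) : ℂ) n‖ :=
      norm_pos_iff.2 (rising_ne_zero (ne_neg_nat_of_re_pos (by simpa using h2)) n)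
    have p3 : 0 < ‖rising ((z - a.re - ε : ℝ) : ℂ) n‖ :=
      norm_pos_iff.2 (rising_ne_zero (ne_neg_nat_of_re_pos (by simpa using h3)) n)
    rw [quotTerm, norm_div, norm_mul, norm_pow, norm_pow, norm_div, norm_mul, norm_pow, norm_pow,
      mul_div_assoc', ← mul_pow]
    gcongr

/-! ### The series `g` by analytic continuation -/

/-- The analytic continuation of `∑ squareTerm a` to the removable singularity `-1 / 2`. -/
noncomputable def squareSum (a : ℂ) : ℂ :=
  1 + (a + 1 / 2) / (2 * (3 / 2 - a)) * ∑' n, quotTerm 1 (3 / 2) 2 (5 / 2) a n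

/-- Beyond n = 0 every term contains (a + 1/2)²/(2a + 1) = (a + 1/2)/2. Cancelling 2a + 1 gives a
formula regular at a = -1/2. -/
theorem tsum_squareTerm_eq {a : ℂ} (h : ∀ m : ℕ, 2 * a + 1 ≠ -m) (h' : ∀ m : ℕ, 1 / 2 - a ≠ -m)
    (ha : a.re < 1 / 2) : ∑' n, squareTerm a n = squareSum a := by
  rw [(summable_squareTerm h h' ha).tsum_eq_zero_add, squareSum, ← tsum_mul_left]
  congr 1
  · simp [squareTerm]
  refine tsum_congr fun n => ?_
  have h1 := two_mul_add_one_ne_zero h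
  have h2 : 3 / 2 - a ≠ 0 := by simpa using three_half_sub_ne h' 0
  rw [squareTerm, quotTerm, rising_succ_left, rising_succ_left, rising_succ_left]
  push_cast
  rw [show a + 1 / 2 + 1 = a + 3 / 2 by ring, show 2 * a + 1 + 1 = 2 * a + 2 by ring,
    show 3 / 2 - a + 1 = 5 / 2 - a by ring, show a + 1 / 2 = (2 * a + 1) / 2 by ring]
  generalize rising (a + 3 / 2) n = R
  generalize rising (2 * a + 2) n = D
  generalize rising (5 / 2 - a) n = E
  generalize 2 * a + 1 = W at *
  generalize 3 / 2 - a = V at *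
  rcases eq_or_ne D 0 with rfl | hD
  · simp
  rcases eq_or_ne E 0 with rfl | hE
  · simp
  field_simp

theorem differentiableAt_squareSum {a : ℂ} (h1 : -1 < a.re) (h2 : a.re < 1 / 2) :
    DifferentiableAt ℂ squareSum a := by
  have h : DifferentiableAt ℂ (fun a => ∑' n, quotTerm 1 (3 / 2) 2 (5 / 2) a n) a :=
    differentiableAt_tsum_quotTerm 1 (by linarith) (by linarith) (by linarith)
      (by push_cast; linarith)
  have h3 : 2 * (3 / 2 - a) ≠ 0 := by
    have := ne_neg_nat_of_re_pos (x := 3 / 2 - a) (by simp; linarith) 0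
    simpa using this
  unfold squareSum
  fun_prop (disch := assumption)

/-- The Gamma product in the formula for `g`. -/
noncomputable def gammaPart (a : ℂ) : ℂ :=
  16 * ((2 : ℂ) ^ a) ^ 6 * Complex.Gamma (a + 1) ^ 3 * Complex.Gamma (1 / 2 - a) ^ 2 *
    (Complex.Gamma (a + 1 / 2))⁻¹ / ((Real.pi : ℂ) ^ (1 / 2 : ℂ)) ^ 3

theorem differentiableAt_gammaPart {a : ℂ} (h1 : -1 < a.re) (h2 : a.re < 1 / 2) :
    DifferentiableAt ℂ gammaPart a := by
  have d1 : DifferentiableAt ℂ (fun a : ℂ => Complex.Gamma (a + 1)) a :=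
    DifferentiableAt.comp (g := Complex.Gamma) a (Complex.differentiableAt_Gamma _
      (ne_neg_nat_of_re_pos (by simp; linarith))) (by fun_prop)
  have d2 : DifferentiableAt ℂ (fun a : ℂ => Complex.Gamma (1 / 2 - a)) a :=
    DifferentiableAt.comp (g := Complex.Gamma) a (Complex.differentiableAt_Gamma _
      (ne_neg_nat_of_re_pos (by simp; linarith))) (by fun_prop)
  have d3 : DifferentiableAt ℂ (fun a : ℂ => (Complex.Gamma (a + 1 / 2))⁻¹) a :=
    DifferentiableAt.comp (g := fun s => (Complex.Gamma s)⁻¹) a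
      Complex.differentiable_one_div_Gamma.differentiableAt (by fun_prop)
  have d4 : DifferentiableAt ℂ (fun a : ℂ => (2 : ℂ) ^ a) a :=
    differentiableAt_id.const_cpow (Or.inl two_ne_zero)
  unfold gammaPart
  fun_prop

theorem rising_div_rising_ofReal (x y : ℝ) (k : ℕ) :
    rising (x : ℂ) k / rising (y : ℂ) k = (pochRatio x y k : ℝ) := by
  rw [rising_eq_prod, rising_eq_prod, pochRatio, ← Finset.prod_div_distrib]
  push_cast
  rfl

/-- `three_term_relation` at b = a + 1/2, multiplied by 64a²: the first sum becomes 32a ∑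
`ratioTerm`, which is g. -/
theorem g_ofReal {a : ℝ} (h0 : 0 < a) (h1 : a < 1 / 2) :
    g a = gammaPart a + 128 * (a : ℂ) ^ 2 / (2 * a - 1) * squareSum a := by
  have hX := two_mul_add_one_ne_of_re_pos (a := (a : ℂ)) (by simpa)
  have hC : ∀ m : ℕ, 1 / 2 - (a : ℂ) ≠ -m := ne_neg_nat_of_re_pos (by simp; linarith)
  have e1 : ∀ k, ratioTerm a k =
      ((pochRatio (a + 1 / 2) (2 * (a + 1 / 2)) k * pochRatio (a + 1 / 2) (2 * (a + 1 / 2)) k : ℝ)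
        : ℂ) := fun k => by
    rw [Complex.ofReal_mul, ← rising_div_rising_ofReal, ratioTerm]
    push_cast
    rw [show 2 * ((a : ℂ) + 1 / 2) = 2 * a + 1 by ring]
    ring
  have e2 : ∀ k, squareTerm a k =
      ((pochRatio (a + 1 / 2) (2 - (a + 1 / 2)) k * pochRatio (a + 1 / 2) (2 * (a + 1 / 2)) k : ℝ)
        : ℂ) := fun k => by
    rw [Complex.ofReal_mul, ← rising_div_rising_ofReal, ← rising_div_rising_ofReal, squareTerm]
    push_cast
    rw [show 2 * ((a : ℂ) + 1 / 2) = 2 * a + 1 by ring,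
      show 2 - ((a : ℂ) + 1 / 2) = 3 / 2 - a by ring, mul_comm (rising (2 * (a : ℂ) + 1) k), sq,
      mul_div_mul_comm]
  have s1 := summable_ratioTerm (a := (a : ℂ)) (by simpa)
  have s2 := summable_squareTerm hX hC (by rw [Complex.ofReal_re]; exact h1)
  have s1' := Complex.summable_ofReal.1 (s1.congr e1)
  have s2' := Complex.summable_ofReal.1 (s2.congr e2)
  have h := three_term_relation (b := a + 1 / 2) (by linarith) (by linarith) s1' s2'
  have h' := congrArg (fun x : ℝ => (x : ℂ)) h
  simp only [Complex.ofReal_add, Complex.ofReal_div, Complex.ofReal_tsum] at h'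
  rw [← tsum_congr e1, ← tsum_congr e2] at h'
  rw [g_eq_tsum_ratioTerm (by simpa), ← tsum_squareTerm_eq hX hC (by rw [Complex.ofReal_re]; exact h1)]
  have ha : (a : ℂ) ≠ 0 := by exact_mod_cast h0.ne'
  have hm : 2 * (a : ℂ) - 1 ≠ 0 := two_mul_sub_one_ne_zero hC
  have hG := Complex.Gamma_ne_zero (add_half_ne hX)
  have hE : gammaPart a = 64 * (a : ℂ) ^ 2 *
      (((ProbabilityTheory.beta (2 * (a + 1 / 2) - 1) (1 - (a + 1 / 2)) ^ 2 /
        ProbabilityTheory.beta (a + 1 / 2) (a + 1 / 2) : ℝ)) : ℂ) := by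
    have hq : (Real.pi : ℂ) ^ (1 / 2 : ℂ) ≠ 0 := by simp [Complex.cpow_eq_zero_iff]
    have hw : (2 : ℂ) ^ (a : ℂ) ≠ 0 := by simp [Complex.cpow_eq_zero_iff]
    have hG1 := Complex.Gamma_ne_zero (s := (a : ℂ) + 1)
      (ne_neg_nat_of_re_pos (by simp; linarith))
    have hd := Gamma_two_mul_add_one (a : ℂ)
    have h2 := Complex.Gamma_add_one (2 * (a : ℂ)) (mul_ne_zero two_ne_zero ha)
    have h2' : Complex.Gamma (2 * (a : ℂ)) = Complex.Gamma (2 * a + 1) / (2 * a) := by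
      rw [h2]; field_simp
    simp only [ProbabilityTheory.beta]
    push_cast
    simp only [← Complex.Gamma_ofReal]
    push_cast
    rw [show 2 * ((a : ℂ) + 1 / 2) - 1 = 2 * a by ring,
      show 1 - ((a : ℂ) + 1 / 2) = 1 / 2 - a by ring,
      show 2 * (a : ℂ) + (1 / 2 - a) = a + 1 / 2 by ring,
      show (a : ℂ) + 1 / 2 + (a + 1 / 2) = 2 * a + 1 by ring, h2', hd, gammaPart]
    generalize Complex.Gamma ((a : ℂ) + 1 / 2) = G at *
    generalize Complex.Gamma ((a : ℂ) + 1) = G1 at *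
    generalize Complex.Gamma (1 / 2 - (a : ℂ)) = G2 at *
    generalize (Real.pi : ℂ) ^ (1 / 2 : ℂ) = q at *
    generalize (2 : ℂ) ^ (a : ℂ) = w at *
    field_simp
    ring
  rw [hE, Complex.ofReal_div, ← h']
  push_cast
  rw [show 2 * ((a : ℂ) + 1 / 2) - 1 = 2 * a by ring,
    show 1 - ((a : ℂ) + 1 / 2) = -(2 * a - 1) / 2 by ring]
  generalize 2 * (a : ℂ) - 1 = M at *
  field_simp
  ring

/-- Identity theorem from the real interval (0, 1/2), with 1/4 as accumulation point. `squareSum`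
keeps the strip free of the singularity at -1/2. -/
theorem g_eq_of_mem_strip {a : ℂ} (h1 : -1 < a.re) (h2 : a.re < 1 / 2) :
    g a = gammaPart a + 128 * a ^ 2 / (2 * a - 1) * squareSum a := by
  set U : Set ℂ := {a | -1 < a.re ∧ a.re < 1 / 2} with hU
  have hUo : IsOpen U := (isOpen_lt continuous_const Complex.continuous_re).inter
    (isOpen_lt Complex.continuous_re continuous_const)
  have hUc : Convex ℝ U := (convex_halfSpace_re_gt (-1)).inter (convex_halfSpace_re_lt (1 / 2))
  have hd : DifferentiableOn ℂ
      (fun a => g a - (gammaPart a + 128 * a ^ 2 / (2 * a - 1) * squareSum a)) U := by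
    intro b hb
    have d1 := differentiableAt_g (mem_domain_of_re hb.1)
    have d2 := differentiableAt_gammaPart hb.1 hb.2
    have d3 := differentiableAt_squareSum hb.1 hb.2
    have h3 : 2 * b - 1 ≠ 0 := two_mul_sub_one_ne_zero
      (ne_neg_nat_of_re_pos (x := 1 / 2 - b) (by simpa using hb.2))
    exact (d1.sub (d2.add (DifferentiableAt.mul (by fun_prop (disch := assumption))
      d3))).differentiableWithinAt
  have ha := hd.analyticOnNhd hUo
  have hz : ((1 / 4 : ℝ) : ℂ) ∈ U := by constructor <;> simp <;> norm_num
  have hf : ∃ᶠ z in 𝓝[≠] ((1 / 4 : ℝ) : ℂ),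
      g z - (gammaPart z + 128 * z ^ 2 / (2 * z - 1) * squareSum z) = 0 := by
    have ht : Tendsto (fun x : ℝ => (x : ℂ)) (𝓝[≠] (1 / 4)) (𝓝[≠] ((1 / 4 : ℝ) : ℂ)) := by
      refine tendsto_nhdsWithin_iff.2 ⟨Complex.continuous_ofReal.continuousAt.mono_left
        nhdsWithin_le_nhds, ?_⟩
      filter_upwards [self_mem_nhdsWithin] with x hx
      exact fun h => hx (Complex.ofReal_injective h)
    refine ht.frequently (Eventually.frequently ?_)
    have : ∀ᶠ x : ℝ in 𝓝 (1 / 4), x ∈ Set.Ioo (0 : ℝ) (1 / 2) :=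
      Ioo_mem_nhds (by norm_num) (by norm_num)
    filter_upwards [this.filter_mono nhdsWithin_le_nhds] with x hx
    rw [g_ofReal hx.1 hx.2, sub_self]
  have := ha.eqOn_zero_of_preconnected_of_frequently_eq_zero hUc.isPreconnected hz hf
    (show a ∈ U from ⟨h1, h2⟩)
  exact sub_eq_zero.1 this

theorem gammaPart_eq {a : ℂ} (h : Complex.Gamma (a + 1 / 2) ≠ 0) : gammaPart a =
    16 * (Real.pi : ℂ) ^ (1 / 2 : ℂ) * ((2 : ℂ) ^ a) ^ 6 / Complex.cos (Real.pi * a) ^ 2 *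
      (Complex.Gamma (a + 1) ^ 3 / Complex.Gamma (a + 1 / 2) ^ 3) := by
  have hq : (Real.pi : ℂ) ^ (1 / 2 : ℂ) ≠ 0 := by simp [Complex.cpow_eq_zero_iff]
  have h7 := pi_cpow_half_sq
  rw [gammaPart, Gamma_half_sub h]
  generalize (Real.pi : ℂ) ^ (1 / 2 : ℂ) = q at *
  generalize Complex.cos (Real.pi * a) = c
  rw [← h7]
  generalize Complex.Gamma (a + 1 / 2) = G at *
  rcases eq_or_ne c 0 with rfl | hc
  · simp
  field_simp

/-- `gammaPart` solves the homogeneous recurrence of g, so the formula for g passes from a + 1 to a.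
-/
theorem gammaPart_recurrence {a : ℂ} (ha : a ∈ domain) (hc : Complex.cos (Real.pi * a) ≠ 0) :
    gammaPart a = sFactor a * gammaPart (a + 1) := by
  have h := two_mul_add_one_ne ha hc
  have hc1 : Complex.cos (Real.pi * (a + 1)) ≠ 0 := by simpa using cos_pi_mul_add_nat_ne_zero hc 1
  have h1 := add_one_ne_zero_of_mem_domain ha
  have h2 : a + 1 / 2 ≠ 0 := by simpa using add_half_ne h 0
  have h3 := Complex.Gamma_ne_zero (add_half_ne h)
  rw [gammaPart_eq h3, gammaPart_eq (Complex.Gamma_ne_zero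
    (add_half_ne (two_mul_add_one_ne (add_one_mem_domain ha) hc1))), cos_pi_mul_add_one,
    Complex.Gamma_add_one _ h1, add_right_comm a 1,
    Complex.Gamma_add_one _ h2, Complex.cpow_add _ _ two_ne_zero, Complex.cpow_one, sFactor]
  generalize Complex.Gamma (a + 1 / 2) = G at *
  generalize Complex.cos (Real.pi * a) = c at *
  generalize a + 1 = x at *
  generalize a + 1 / 2 = y at *
  field_simp
  ring

theorem g_eq_gammaPart_add {a : ℂ} (ha : a ∈ domain) (hc : Complex.cos (Real.pi * a) ≠ 0)
    (hre : a.re < 1 / 2) :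
    g a = gammaPart a + 128 * a ^ 2 / (2 * a - 1) * ∑' n, squareTerm a n := by
  revert ha hc hre
  refine induction_of_re (p := fun a => a ∈ domain → Complex.cos (Real.pi * a) ≠ 0 →
    a.re < 1 / 2 → g a = gammaPart a + 128 * a ^ 2 / (2 * a - 1) * ∑' n, squareTerm a n)
    (x := -1) ?_ ?_ a
  · intro a h1 ha hc h2
    rw [tsum_squareTerm_eq (two_mul_add_one_ne ha hc) (half_sub_ne hc) h2, g_eq_of_mem_strip h1 h2]
  · intro a ih ha hc h2
    -- The hypothesis at a + 1 needs Re (a + 1) < 1/2, so it is used only for Re a ≤ -1. Elsewhere a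
    -- lies in the strip.
    rcases lt_or_ge (-1) a.re with h1 | h1
    · rw [tsum_squareTerm_eq (two_mul_add_one_ne ha hc) (half_sub_ne hc) h2,
        g_eq_of_mem_strip h1 h2]
    · have hc1 : Complex.cos (Real.pi * (a + 1)) ≠ 0 := by
        simpa using cos_pi_mul_add_nat_ne_zero hc 1
      rw [g_eq_add, ih (add_one_mem_domain ha) hc1 (by simp; linarith),
        gammaPart_recurrence ha hc, tsum_squareTerm_recurrence ha hc (by linarith)]
      ring

theorem scale_mul_gammaPart {a : ℂ} (ha : a ∈ domain) (hc : Complex.cos (Real.pi * a) ≠ 0) :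
    scale a * gammaPart a =
      128 / (Real.pi : ℂ) ^ 2 * ((1024 : ℂ) ^ a / Complex.cos (Real.pi * a) ^ 3) *
        (risingC 1 a ^ 5 / risingC (1 / 2) a ^ 5) := by
  have h3 := Complex.Gamma_ne_zero (add_half_ne (two_mul_add_one_ne ha hc))
  have hq : (Real.pi : ℂ) ^ (1 / 2 : ℂ) ≠ 0 := by simp [Complex.cpow_eq_zero_iff]
  have h7 := pi_cpow_half_sq
  rw [scale_eq, gammaPart_eq h3, risingC_one, risingC_half,
    show (1024 : ℂ) ^ a = ((2 : ℂ) ^ a) ^ 10 by rw [← two_pow_cpow]; norm_num]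
  generalize (Real.pi : ℂ) ^ (1 / 2 : ℂ) = q at *
  generalize Complex.cos (Real.pi * a) = c at *
  rw [← h7]
  generalize Complex.Gamma (a + 1 / 2) = G at *
  field_simp
  ring

theorem f_eq_third {a : ℂ} (ha : a ∈ domain) (hc : Complex.cos (Real.pi * a) ≠ 0)
    (hre : a.re < 1 / 2) :
    f a = 128 / (Real.pi : ℂ) ^ 2 * ((1024 : ℂ) ^ a / Complex.cos (Real.pi * a) ^ 3) *
        (risingC 1 a ^ 5 / risingC (1 / 2) a ^ 5) +
      scale a * (128 * a ^ 2 / (2 * a - 1) * ∑' n, squareTerm a n) +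
      2048 * a ^ 3 / (2 * a - 1) * ∑' n, cubeTerm a n := by
  rw [f_eq_scale_mul_g_add ha hc, g_eq_gammaPart_add ha hc hre, mul_add, scale_mul_gammaPart ha hc]

/-! ### Arcsine series, Catalan's constant and ζ(3) -/

section

open MeasureTheory Set

theorem rising_half_div_rising_one (n : ℕ) :
    rising (1 / 2) n / rising 1 n = ((pochRatio (1 / 2) 1 n : ℝ) : ℂ) := by
  rw [← rising_div_rising_ofReal]; push_cast; rfl

theorem rising_half_div_rising_three_half (n : ℕ) :
    rising (1 / 2) n / rising (3 / 2) n = (1 / (2 * (n : ℝ) + 1) : ℝ) := by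
  have h1 := rising_succ_left (1 / 2) n
  rw [rising_succ, show (1 / 2 : ℂ) + 1 = 3 / 2 by norm_num] at h1
  have h2 : rising (3 / 2) n ≠ 0 := rising_ne_zero
    (ne_neg_nat_of_re_pos (by norm_num)) n
  have h3 : (2 * (n : ℂ) + 1) ≠ 0 := by exact_mod_cast (by omega : 2 * n + 1 ≠ 0)
  push_cast
  rw [div_eq_div_iff h2 h3]
  linear_combination 2 * h1

theorem pochRatio_half_one (n : ℕ) : pochRatio (1 / 2) 1 n = (2 * n).choose n / 4 ^ n := by
  induction n with
  | zero => simp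
  | succ n ih =>
    have h1 := pochRatio_succ (b := 1 / 2) (d := 1) one_pos n
    have h2 : ((n : ℝ) + 1) * (2 * (n + 1)).choose (n + 1) = 2 * (2 * n + 1) * (2 * n).choose n := by
      exact_mod_cast Nat.succ_mul_centralBinom_succ n
    rw [ih] at h1
    have h3 : (n : ℝ) + 1 ≠ 0 := by positivity
    refine mul_left_cancel₀ h3 ?_
    rw [add_comm 1 (n : ℝ)] at h1
    rw [h1, eq_comm, ← mul_div_assoc, h2, pow_succ]
    field_simp
    ring

theorem squareTerm_zero (n : ℕ) :
    squareTerm 0 n = ((pochRatio (1 / 2) 1 n / (2 * n + 1) : ℝ) : ℂ) := by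
  have h1 := rising_half_div_rising_one n
  have h2 := rising_half_div_rising_three_half n
  rw [squareTerm]
  simp only [zero_add, mul_zero, sub_zero]
  rw [sq, mul_div_mul_comm, h1, h2]
  push_cast; ring

theorem cubeTerm_zero (n : ℕ) : cubeTerm 0 n = (binomTerm n : ℂ) := by
  have h1 := rising_half_div_rising_one n
  have h2 := rising_half_div_rising_three_half n
  rw [cubeTerm]
  simp only [add_zero, zero_add, mul_zero, sub_zero]
  rw [pow_succ, mul_div_mul_comm, ← div_pow, h1, h2, pochRatio_half_one, binomTerm,
    show (16 : ℝ) = 4 ^ 2 by norm_num, ← pow_mul, mul_comm 2 n, pow_mul]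
  push_cast; field_simp

theorem binomTerm_eq (n : ℕ) : binomTerm n = pochRatio (1 / 2) 1 n ^ 2 / (2 * n + 1) := by
  rw [pochRatio_half_one, binomTerm, show (16 : ℝ) = 4 ^ 2 by norm_num, ← pow_mul, mul_comm 2 n,
    mul_comm n 2, mul_comm 2 n, pow_mul]
  field_simp

theorem summable_pochRatio_half_one_div :
    Summable fun n : ℕ => pochRatio (1 / 2) 1 n / (2 * n + 1) := by
  have h := summable_squareTerm (a := 0) (ne_neg_nat_of_re_pos (by norm_num))
    (ne_neg_nat_of_re_pos (by norm_num)) (by norm_num)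
  exact Complex.summable_ofReal.1 (h.congr squareTerm_zero)

/-- The binomial series of (1 - u)^(-1/2) at u = sin² θ. Here d = 1, outside
`unitHyp_mul_eq_integral`; the ODE shows instead that the product has derivative 0. -/
theorem unitHyp_half_one_sin_sq_mul_cos {θ : ℝ} (h0 : 0 ≤ θ) (h1 : θ < Real.pi / 2) :
    unitHyp (1 / 2) 1 (Real.sin θ ^ 2) * Real.cos θ = 1 := by
  have hlt : ∀ x ∈ Icc 0 θ, |Real.sin x ^ 2| < 1 := fun x hx => by
    have : 0 < Real.cos x := Real.cos_pos_of_mem_Ioo ⟨by linarith [hx.1, Real.pi_pos],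
      by linarith [hx.2]⟩
    rw [abs_of_nonneg (sq_nonneg _)]
    nlinarith [Real.sin_sq_add_cos_sq x]
  have hd : ∀ x ∈ Icc 0 θ, HasDerivAt
      (fun x => unitHyp (1 / 2) 1 (Real.sin x ^ 2) * Real.cos x) 0 x := fun x hx => by
    have := ((hasDerivAt_unitHyp (b := 1 / 2) (d := 1) (by norm_num) (by norm_num)
      (hlt x hx)).comp x ((Real.hasDerivAt_sin x).pow 2)).mul (Real.hasDerivAt_cos x)
    refine this.congr_deriv ?_
    have ho := unitHyp_ode (b := 1 / 2) (d := 1) (by norm_num) (by norm_num) (hlt x hx)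
    have hsc := Real.sin_sq_add_cos_sq x
    simp only [Function.comp_def, Nat.cast_ofNat, Nat.add_one_sub_one, pow_one]
    generalize (∑' k : ℕ, pochRatio (1 / 2) 1 k * (k * (Real.sin x ^ 2) ^ (k - 1))) = D at *
    rcases eq_or_ne (Real.sin x) 0 with h | h
    · rw [h]; ring
    · refine mul_left_cancel₀ h ?_
      rw [show 1 - Real.sin x ^ 2 = Real.cos x ^ 2 by linarith] at ho
      linear_combination 2 * ho
  rw [constant_of_has_deriv_right_zero (fun x hx => (hd x hx).continuousAt.continuousWithinAt)
    (fun x hx => (hd x (Ico_subset_Icc_self hx)).hasDerivWithinAt) θ (right_mem_Icc.2 h0)]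
  rw [unitHyp, tsum_eq_single 0 fun n hn => by simp [hn]]
  simp

theorem hasSum_intervalIntegral {F : ℕ → ℝ → ℝ} {G : ℝ → ℝ} {a b : ℝ} (hab : a ≤ b)
    (hF : ∀ n, Continuous (F n)) (hs : Summable fun n => ∫ x in a..b, |F n x|)
    (hG : ∀ x ∈ Ioo a b, HasSum (fun n => F n x) (G x)) :
    HasSum (fun n => ∫ x in a..b, F n x) (∫ x in a..b, G x) := by
  simp only [intervalIntegral.integral_of_le hab, integral_Ioc_eq_integral_Ioo] at hs ⊢
  have h := hasSum_integral_of_summable_integral_norm (μ := volume.restrict (Ioo a b)) (F := F)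
    (fun n => ((hF n).integrableOn_Icc).mono_set Ioo_subset_Icc_self) hs
  rwa [setIntegral_congr_fun measurableSet_Ioo fun x hx => (hG x hx).tsum_eq] at h

/-- Termwise integration of 1 = ∑ c_n sin^(2n) x cos x from 0 to θ. Summability at sin θ = 1 comes
from `squareTerm` at a = 0, so θ = π/2 is included. -/
theorem hasSum_pochRatio_mul_sin_pow {θ : ℝ} (h0 : 0 ≤ θ) (h1 : θ ≤ Real.pi / 2) :
    HasSum (fun n : ℕ => pochRatio (1 / 2) 1 n / (2 * n + 1) * Real.sin θ ^ (2 * n + 1)) θ := by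
  have hI : ∀ n : ℕ, ∫ x in (0 : ℝ)..θ, pochRatio (1 / 2) 1 n * (Real.sin x ^ (2 * n) * Real.cos x)
      = pochRatio (1 / 2) 1 n / (2 * n + 1) * Real.sin θ ^ (2 * n + 1) := fun n => by
    have h := intervalIntegral.integral_eq_sub_of_hasDerivAt (a := 0) (b := θ)
      (f := fun x => pochRatio (1 / 2) 1 n / (2 * n + 1) * Real.sin x ^ (2 * n + 1))
      (f' := fun x => pochRatio (1 / 2) 1 n * (Real.sin x ^ (2 * n) * Real.cos x))
      (fun x _ => by
        refine (((Real.hasDerivAt_sin x).pow (2 * n + 1)).const_mul _).congr_deriv ?_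
        push_cast
        field_simp)
      (Continuous.intervalIntegrable (by fun_prop) _ _)
    rw [h]
    simp
  have hc : ∀ x ∈ uIcc 0 θ, 0 ≤ Real.cos x := fun x hx => by
    rw [uIcc_of_le h0] at hx
    exact Real.cos_nonneg_of_mem_Icc ⟨by linarith [hx.1, Real.pi_pos], by linarith [hx.2]⟩
  have h := hasSum_intervalIntegral (G := fun _ => 1) h0
    (F := fun n x => pochRatio (1 / 2) 1 n * (Real.sin x ^ (2 * n) * Real.cos x))
    (fun n => by fun_prop) ?_ fun x hx => ?_
  · simpa only [hI, intervalIntegral.integral_const, sub_zero, smul_eq_mul, mul_one] using h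
  · refine Summable.of_nonneg_of_le (fun n => intervalIntegral.integral_nonneg h0
      fun _ _ => abs_nonneg _) (fun n => ?_) summable_pochRatio_half_one_div
    have hp := pochRatio_nonneg (b := 1 / 2) (d := 1) (by norm_num) one_pos n
    rw [intervalIntegral.integral_congr fun x hx => abs_of_nonneg (mul_nonneg hp
      (mul_nonneg (by rw [pow_mul]; positivity) (hc x hx))), hI]
    refine mul_le_of_le_one_right (by positivity) (pow_le_one₀ ?_ (Real.sin_le_one θ))
    exact Real.sin_nonneg_of_nonneg_of_le_pi h0 (by linarith [Real.pi_pos])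
  · have hx1 : x < Real.pi / 2 := hx.2.trans_le h1
    have hu := unitHyp_half_one_sin_sq_mul_cos hx.1.le hx1
    have hcos : 0 < Real.cos x := Real.cos_pos_of_mem_Ioo ⟨by linarith [hx.1, Real.pi_pos], hx1⟩
    have hs := summable_nat_mul_pochRatio (b := 1 / 2) (d := 1) (u := Real.sin x ^ 2)
      (by norm_num) (by norm_num) (by
        rw [abs_of_nonneg (sq_nonneg _)]
        nlinarith [Real.sin_sq_add_cos_sq x]) 0
    simp only [pow_zero, one_mul] at hs
    have h := hs.hasSum.mul_right (Real.cos x)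
    rw [← unitHyp, hu] at h
    refine h.congr_fun ?_
    intro n
    simp only [← pow_mul]
    ring

theorem hasSum_pochRatio_half_one_div :
    HasSum (fun n : ℕ => pochRatio (1 / 2) 1 n / (2 * n + 1)) (Real.pi / 2) := by
  simpa using hasSum_pochRatio_mul_sin_pow (θ := Real.pi / 2) (by positivity) le_rfl

theorem integral_sin_pow_even_half (n : ℕ) :
    ∫ x in (0 : ℝ)..Real.pi / 2, Real.sin x ^ (2 * n) = Real.pi / 2 * pochRatio (1 / 2) 1 n := by
  have h : ∫ x in (0 : ℝ)..Real.pi, Real.sin x ^ (2 * n) = Real.pi * pochRatio (1 / 2) 1 n := by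
    rw [integral_sin_pow_even, pochRatio]
    congr 1
    refine Finset.prod_congr rfl fun i _ => ?_
    field_simp
    ring
  have h2 := intervalIntegral.integral_add_adjacent_intervals (μ := volume)
    (f := fun x => Real.sin x ^ (2 * n)) (a := 0) (b := Real.pi / 2) (c := Real.pi)
    (Continuous.intervalIntegrable (by fun_prop) _ _)
    (Continuous.intervalIntegrable (by fun_prop) _ _)
  have h3 := intervalIntegral.integral_comp_sub_left (fun x => Real.sin x ^ (2 * n)) Real.pi
    (a := 0) (b := Real.pi / 2)
  simp only [Real.sin_pi_sub, sub_zero, sub_half] at h3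
  rw [← h3, h] at h2
  linarith

/-- The arcsine series divided by sin θ and integrated over (0, π/2). Wallis' formula supplies the
second central binomial coefficient. -/
theorem hasSum_binomTerm_integral :
    HasSum binomTerm (2 / Real.pi * ∫ θ in (0 : ℝ)..Real.pi / 2, (Real.sinc θ)⁻¹) := by
  have hp := fun n => pochRatio_nonneg (b := 1 / 2) (d := 1) (by norm_num) one_pos n
  have hI : ∀ n : ℕ, ∫ x in (0 : ℝ)..Real.pi / 2,
      pochRatio (1 / 2) 1 n / (2 * n + 1) * Real.sin x ^ (2 * n) =
      Real.pi / 2 * binomTerm n := fun n => by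
    rw [intervalIntegral.integral_const_mul, integral_sin_pow_even_half, binomTerm_eq]
    ring
  have hb : Summable binomTerm := by
    have h := summable_cubeTerm (a := 0) (ne_neg_nat_of_re_pos (by norm_num))
      (ne_neg_nat_of_re_pos (by norm_num))
    exact Complex.summable_ofReal.1 (h.congr cubeTerm_zero)
  have h := hasSum_intervalIntegral (G := fun θ => (Real.sinc θ)⁻¹) (a := 0) (b := Real.pi / 2)
    (by positivity) (F := fun n x => pochRatio (1 / 2) 1 n / (2 * n + 1) * Real.sin x ^ (2 * n))
    (fun n => by fun_prop) ?_ fun x hx => ?_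
  · simp only [hI] at h
    have := h.mul_left (2 / Real.pi)
    refine this.congr_fun fun n => ?_
    field_simp
  · refine (hb.mul_left (Real.pi / 2)).congr fun n => ?_
    rw [← hI]
    refine intervalIntegral.integral_congr fun x _ => (abs_of_nonneg ?_).symm
    have := hp n
    rw [pow_mul]
    positivity
  · have hs : 0 < Real.sin x := Real.sin_pos_of_pos_of_lt_pi hx.1 (by linarith [hx.2, Real.pi_pos])
    rw [Real.sinc_of_ne_zero hx.1.ne', inv_div, div_eq_mul_inv]
    refine ((hasSum_pochRatio_mul_sin_pow hx.1.le hx.2.le).mul_right _).congr_fun fun n => ?_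
    rw [pow_succ]
    field_simp

/-- The substitution θ = 2 arctan t. Using 1/sinc for θ/sin θ keeps the integrand continuous at 0.
-/
theorem integral_inv_sinc :
    ∫ θ in (0 : ℝ)..Real.pi / 2, (Real.sinc θ)⁻¹ =
      ∫ t in (0 : ℝ)..1, (Real.sinc (2 * Real.arctan t))⁻¹ * (2 * (1 / (1 + t ^ 2))) := by
  have h := intervalIntegral.integral_comp_mul_deriv' (a := 0) (b := 1)
    (f := fun t => 2 * Real.arctan t) (f' := fun t => 2 * (1 / (1 + t ^ 2)))
    (g := fun θ => (Real.sinc θ)⁻¹) (fun t _ => (Real.hasDerivAt_arctan t).const_mul 2) ?_ ?_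
  · rw [show 2 * Real.arctan 1 = Real.pi / 2 by rw [Real.arctan_one]; ring, Real.arctan_zero,
      mul_zero] at h
    exact h.symm
  · refine Continuous.continuousOn ?_
    refine continuous_const.mul (continuous_const.div (by fun_prop) fun t => by positivity)
  · refine Real.continuous_sinc.continuousOn.inv₀ ?_
    rintro _ ⟨t, ht, rfl⟩
    rw [uIcc_of_le zero_le_one] at ht
    rcases ht.1.eq_or_lt with rfl | h0
    · simp
    · have h1 := Real.arctan_lt_pi_div_two t
      have h2 : 0 < Real.arctan t := Real.arctan_pos.2 h0
      rw [Real.sinc_of_ne_zero (by positivity)]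
      have := Real.sin_pos_of_pos_of_lt_pi (x := 2 * Real.arctan t) (by positivity) (by linarith)
      positivity

theorem inv_sinc_two_mul_arctan {t : ℝ} (h0 : 0 < t) :
    (Real.sinc (2 * Real.arctan t))⁻¹ * (2 * (1 / (1 + t ^ 2))) = 2 * (Real.arctan t / t) := by
  have h2 : 0 < Real.arctan t := Real.arctan_pos.2 h0
  rw [Real.sinc_of_ne_zero (by positivity), Real.sin_two_mul, Real.sin_arctan, Real.cos_arctan]
  have h3 : 0 < √(1 + t ^ 2) := by positivity
  have h4 : √(1 + t ^ 2) ^ 2 = 1 + t ^ 2 := Real.sq_sqrt (by positivity)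
  generalize √(1 + t ^ 2) = s at *
  rw [← h4]
  field_simp

theorem summable_one_div_odd_sq : Summable fun n : ℕ => 1 / (2 * (n : ℝ) + 1) ^ 2 := by
  have h := (Real.summable_one_div_nat_pow (p := 2)).2 one_lt_two
  have := h.comp_injective (i := fun n : ℕ => 2 * n + 1) fun a b h => by simpa using h
  simpa [Function.comp_def] using this

/-- After the substitution the integrand is 2 arctan(t)/t on (0, 1), and its power series integrates
termwise to 2G. -/
theorem integral_inv_sinc_eq_catalanG :
    ∫ θ in (0 : ℝ)..Real.pi / 2, (Real.sinc θ)⁻¹ = 2 * catalanG := by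
  have hA : ∀ n : ℕ, ∫ t in (0 : ℝ)..1, 2 * (1 / (2 * (n : ℝ) + 1)) * t ^ (2 * n) =
      2 * (1 / (2 * (n : ℝ) + 1) ^ 2) := fun n => by
    rw [intervalIntegral.integral_const_mul, integral_pow]
    simp
    field_simp
  have hI : ∀ n : ℕ, ∫ t in (0 : ℝ)..1, 2 * ((-1) ^ n / (2 * (n : ℝ) + 1)) * t ^ (2 * n) =
      2 * ((-1) ^ n / (2 * (n : ℝ) + 1) ^ 2) := fun n => by
    rw [intervalIntegral.integral_const_mul, integral_pow]
    simp
    field_simp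
  have h := hasSum_intervalIntegral (a := 0) (b := 1)
    (G := fun t => (Real.sinc (2 * Real.arctan t))⁻¹ * (2 * (1 / (1 + t ^ 2))))
    zero_le_one (F := fun n t => 2 * ((-1) ^ n / (2 * (n : ℝ) + 1)) * t ^ (2 * n))
    (fun n => by fun_prop) ?_ fun t ht => ?_
  · simp only [hI] at h
    rw [integral_inv_sinc, ← h.tsum_eq, tsum_mul_left, catalanG]
  · refine (summable_one_div_odd_sq.mul_left 2).congr fun n => ?_
    rw [← hA]
    refine intervalIntegral.integral_congr fun t _ => ?_
    have h1 : 0 < 2 * (n : ℝ) + 1 := by positivity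
    simp only [pow_mul, abs_mul, abs_div, abs_pow, abs_neg, abs_one, one_pow, abs_of_pos h1, sq_abs]
    norm_num
  · rw [inv_sinc_two_mul_arctan ht.1]
    have := (((Real.hasSum_arctan (x := t) (by
      rw [Real.norm_of_nonneg ht.1.le]; exact ht.2)).div_const t).mul_left 2)
    refine this.congr_fun fun n => ?_
    have := ht.1.ne'
    push_cast
    rw [pow_succ]
    field_simp

theorem hasSum_binomTerm : HasSum binomTerm (4 * catalanG / Real.pi) := by
  have h := hasSum_binomTerm_integral
  rw [integral_inv_sinc_eq_catalanG] at h
  convert h using 1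
  ring

theorem tsum_squareTerm_zero : ∑' n, squareTerm 0 n = Real.pi / 2 := by
  rw [tsum_congr squareTerm_zero, ← Complex.ofReal_tsum, hasSum_pochRatio_half_one_div.tsum_eq]
  push_cast
  rfl

theorem f_one_half : f (1 / 2) = 256 * riemannZeta 3 := by
  have h1 : ∀ n, rising 1 n ≠ 0 := rising_ne_zero (ne_neg_nat_of_re_pos (by norm_num))
  have h2 : ∀ n, rising 2 n ≠ 0 := rising_ne_zero (ne_neg_nat_of_re_pos (by norm_num))
  -- At a = 1/2 the rising factorials are (1)_n and (2)_n, with quotient 1/(n + 1).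
  have ht : ∀ n, firstTerm (1 / 2) n = 4 * (1 / ((n : ℂ) + 1) ^ 3) := fun n => by
    have h3 : rising 2 n = rising 1 n * (n + 1) := by
      have := rising_succ_left 1 n
      rw [rising_succ] at this
      norm_num at this
      linear_combination -this
    have h4 : (n : ℂ) + 1 ≠ 0 := by exact_mod_cast n.succ_ne_zero
    rw [firstTerm]
    norm_num
    rw [h3]
    have := h1 n
    field_simp
    ring
  rw [f_eq_tsum_firstTerm (by norm_num), tsum_congr ht, tsum_mul_left,
    show (3 : ℂ) = ((3 : ℕ) : ℂ) by norm_num, zeta_nat_eq_tsum_of_gt_one (by norm_num)]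
  have hs : Summable fun n : ℕ => (1 : ℂ) / (n : ℂ) ^ 3 := by
    have h := (Real.summable_one_div_nat_pow (p := 3)).2 (by norm_num)
    exact (Complex.summable_ofReal.2 h).congr fun n => by push_cast; rfl
  rw [hs.tsum_eq_zero_add]
  push_cast
  simp
  ring

end

/-! ### Second-order Taylor data at 0 -/

section

/-- `h` is analytic at `0` with value `c₀`, derivative `c₁` and second derivative `c₂` there. -/
structure HasJet (h : ℂ → ℂ) (c₀ c₁ c₂ : ℂ) : Prop where
  analyticAt : AnalyticAt ℂ h 0
  apply_zero : h 0 = c₀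
  deriv_zero : deriv h 0 = c₁
  deriv_deriv_zero : deriv (deriv h) 0 = c₂

theorem eventually_hasDerivAt {h : ℂ → ℂ} {z : ℂ} (hh : AnalyticAt ℂ h z) :
    ∀ᶠ a in 𝓝 z, HasDerivAt h (deriv h a) a :=
  hh.eventually_analyticAt.mono fun _ ha => ha.differentiableAt.hasDerivAt

theorem hasJet_of_hasDerivAt {h h' : ℂ → ℂ} {c₂ : ℂ} (h1 : ∀ a, HasDerivAt h (h' a) a)
    (h2 : HasDerivAt h' c₂ 0) : HasJet h (h 0) (h' 0) c₂ where
  analyticAt := (Differentiable.analyticAt (fun a => (h1 a).differentiableAt) 0)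
  apply_zero := rfl
  deriv_zero := (h1 0).deriv
  deriv_deriv_zero := by
    rw [funext fun a => (h1 a).deriv]
    exact h2.deriv

namespace HasJet

variable {u v : ℂ → ℂ} {a₀ a₁ a₂ b₀ b₁ b₂ : ℂ}

theorem add (hu : HasJet u a₀ a₁ a₂) (hv : HasJet v b₀ b₁ b₂) :
    HasJet (fun a => u a + v a) (a₀ + b₀) (a₁ + b₁) (a₂ + b₂) where
  analyticAt := hu.analyticAt.add hv.analyticAt
  apply_zero := by rw [hu.apply_zero, hv.apply_zero]
  deriv_zero := by
    rw [← hu.deriv_zero, ← hv.deriv_zero]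
    exact (hu.analyticAt.differentiableAt.hasDerivAt.add
      hv.analyticAt.differentiableAt.hasDerivAt).deriv
  deriv_deriv_zero := by
    have h : deriv (fun a => u a + v a) =ᶠ[𝓝 0] fun a => deriv u a + deriv v a := by
      filter_upwards [eventually_hasDerivAt hu.analyticAt, eventually_hasDerivAt hv.analyticAt]
        with a h1 h2 using (h1.add h2).deriv
    rw [h.deriv_eq, ← hu.deriv_deriv_zero, ← hv.deriv_deriv_zero]
    exact (hu.analyticAt.deriv.differentiableAt.hasDerivAt.add
      hv.analyticAt.deriv.differentiableAt.hasDerivAt).deriv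

theorem mul (hu : HasJet u a₀ a₁ a₂) (hv : HasJet v b₀ b₁ b₂) :
    HasJet (fun a => u a * v a) (a₀ * b₀) (a₁ * b₀ + a₀ * b₁)
      (a₂ * b₀ + 2 * (a₁ * b₁) + a₀ * b₂) where
  analyticAt := hu.analyticAt.mul hv.analyticAt
  apply_zero := by rw [hu.apply_zero, hv.apply_zero]
  deriv_zero := by
    rw [← hu.deriv_zero, ← hv.deriv_zero, ← hu.apply_zero, ← hv.apply_zero]
    exact (hu.analyticAt.differentiableAt.hasDerivAt.mul
      hv.analyticAt.differentiableAt.hasDerivAt).deriv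
  deriv_deriv_zero := by
    have h : deriv (fun a => u a * v a) =ᶠ[𝓝 0] fun a => deriv u a * v a + u a * deriv v a := by
      filter_upwards [eventually_hasDerivAt hu.analyticAt, eventually_hasDerivAt hv.analyticAt]
        with a h1 h2 using (h1.mul h2).deriv
    rw [h.deriv_eq, ← hu.deriv_deriv_zero, ← hv.deriv_deriv_zero, ← hu.deriv_zero, ← hv.deriv_zero,
      ← hu.apply_zero, ← hv.apply_zero]
    have hu1 := hu.analyticAt.differentiableAt.hasDerivAt
    have hv1 := hv.analyticAt.differentiableAt.hasDerivAt
    have hu2 := hu.analyticAt.deriv.differentiableAt.hasDerivAt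
    have hv2 := hv.analyticAt.deriv.differentiableAt.hasDerivAt
    refine ((hu2.mul hv1).add (hu1.mul hv2)).deriv.trans ?_
    ring

theorem comp_neg (hu : HasJet u a₀ a₁ a₂) : HasJet (fun a => u (-a)) a₀ (-a₁) a₂ where
  analyticAt := AnalyticAt.fun_comp (by simpa using hu.analyticAt) (by fun_prop)
  apply_zero := by simpa using hu.apply_zero
  deriv_zero := by rw [deriv_comp_neg, neg_zero, hu.deriv_zero]
  deriv_deriv_zero := by
    rw [show deriv (fun a => u (-a)) = fun a => -deriv u (-a) from funext fun a => deriv_comp_neg ..,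
      deriv.fun_neg, deriv_comp_neg, neg_zero, neg_neg, hu.deriv_deriv_zero]

theorem congr (hu : HasJet u a₀ a₁ a₂) (h : v =ᶠ[𝓝 0] u) : HasJet v a₀ a₁ a₂ where
  analyticAt := hu.analyticAt.congr h.symm
  apply_zero := h.eq_of_nhds.trans hu.apply_zero
  deriv_zero := h.deriv_eq.trans hu.deriv_zero
  deriv_deriv_zero := h.deriv.deriv_eq.trans hu.deriv_deriv_zero

theorem of_analyticAt (hu : AnalyticAt ℂ u 0) :
    HasJet u (u 0) (deriv u 0) (deriv (deriv u) 0) := ⟨hu, rfl, rfl, rfl⟩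

theorem unique (hu : HasJet u a₀ a₁ a₂) (hv : HasJet u b₀ b₁ b₂) : a₀ = b₀ ∧ a₁ = b₁ ∧ a₂ = b₂ :=
  ⟨hu.apply_zero.symm.trans hv.apply_zero, hu.deriv_zero.symm.trans hv.deriv_zero,
    hu.deriv_deriv_zero.symm.trans hv.deriv_deriv_zero⟩

theorem pow_five (hu : HasJet u 1 a₁ a₂) :
    HasJet (fun a => u a ^ 5) 1 (5 * a₁) (5 * a₂ + 20 * a₁ ^ 2) := by
  have h := (((hu.mul hu).mul (hu.mul hu)).mul hu)
  convert! h.congr (Eventually.of_forall fun a => ?_) using 1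
  · ring
  · ring
  · ring
  · ring

theorem pow_three (hu : HasJet u 1 a₁ a₂) :
    HasJet (fun a => u a ^ 3) 1 (3 * a₁) (3 * a₂ + 6 * a₁ ^ 2) := by
  have h := (hu.mul hu).mul hu
  convert! h.congr (Eventually.of_forall fun a => ?_) using 1
  · ring
  · ring
  · ring
  · ring

theorem const_mul (c : ℂ) (hu : HasJet u a₀ a₁ a₂) :
    HasJet (fun a => c * u a) (c * a₀) (c * a₁) (c * a₂) := by
  simpa using (hasJet_of_hasDerivAt (h' := 0) (fun a => hasDerivAt_const a c)
    (hasDerivAt_const 0 0)).mul hu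

/-- Only the value of u at 0 enters, so no derivative of `remainder` is ever computed. -/
theorem sq_mul (hu : HasJet u a₀ a₁ a₂) : HasJet (fun a => a ^ 2 * u a) 0 0 (2 * a₀) := by
  have h := (hasJet_of_hasDerivAt (h' := 1) (fun a => hasDerivAt_id a) (hasDerivAt_const 0 1))
  simpa [sq] using (h.mul h).mul hu

end HasJet

theorem hasJet_cos : HasJet (fun a => Complex.cos (Real.pi * a)) 1 0 (-Real.pi ^ 2) := by
  have h1 : ∀ a : ℂ, HasDerivAt (fun a : ℂ => Real.pi * a) (Real.pi : ℂ) a := fun a => by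
    simpa using (hasDerivAt_id a).const_mul (Real.pi : ℂ)
  have h := hasJet_of_hasDerivAt (fun a => (h1 a).ccos) (((h1 0).csin.neg).mul_const (Real.pi : ℂ))
  simp only [mul_zero, Complex.cos_zero, Complex.sin_zero] at h
  convert h using 1 <;> ring

/-- The second derivative at `0` of `π a cot(π a)`. -/
theorem deriv_deriv_of_mul_sin_eq {P : ℂ → ℂ} (hP : AnalyticAt ℂ P 0) (h0 : P 0 = 1)
    (h : ∀ᶠ a in 𝓝 0, P a * Complex.sin (Real.pi * a) = Real.pi * a * Complex.cos (Real.pi * a)) :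
    deriv (deriv P) 0 = -(2 * (Real.pi : ℂ) ^ 2 / 3) := by
  have hpi : (Real.pi : ℂ) ≠ 0 := by exact_mod_cast Real.pi_ne_zero
  generalize (Real.pi : ℂ) = p at *
  have hl : ∀ a : ℂ, HasDerivAt (fun a : ℂ => p * a) p a := fun a => by
    simpa using (hasDerivAt_id a).const_mul p
  have hs : ∀ a, HasDerivAt (fun a => Complex.sin (p * a)) (Complex.cos (p * a) * p) a :=
    fun a => (hl a).csin
  have hc : ∀ a, HasDerivAt (fun a => Complex.cos (p * a)) (-Complex.sin (p * a) * p) a :=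
    fun a => (hl a).ccos
  have e1 := eventually_hasDerivAt hP
  have e2 := eventually_hasDerivAt hP.deriv
  have e3 := (eventually_hasDerivAt hP.deriv.deriv).self_of_nhds
  have h1 : ∀ᶠ a in 𝓝 0, deriv P a * Complex.sin (p * a) + P a * (Complex.cos (p * a) * p) =
      p * Complex.cos (p * a) + p * a * (-Complex.sin (p * a) * p) := by
    filter_upwards [h.eventually_nhds, e1] with a ha h1
    exact (h1.mul (hs a)).unique (((hl a).mul (hc a)).congr_of_eventuallyEq ha)
  have h2 : ∀ᶠ a in 𝓝 0, deriv (deriv P) a * Complex.sin (p * a) +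
      deriv P a * (Complex.cos (p * a) * p) + (deriv P a * (Complex.cos (p * a) * p) +
        P a * (-Complex.sin (p * a) * p * p)) =
      p * (-Complex.sin (p * a) * p) + (p * (-Complex.sin (p * a) * p) +
        p * a * (-(Complex.cos (p * a) * p) * p)) := by
    filter_upwards [h1.eventually_nhds, e1, e2] with a ha h1 h2
    exact ((h2.mul (hs a)).add (h1.mul ((hc a).mul_const p))).unique
      ((((hc a).const_mul p).add ((hl a).mul ((hs a).neg.mul_const p))).congr_of_eventuallyEq ha)
  have d1 := e1.self_of_nhds
  have d2 := e2.self_of_nhds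
  -- Since sin(pa) vanishes at 0, the identity must be differentiated three times before it
  -- determines the second derivative of P.
  have h3 := ((((e3.mul (hs 0)).add (d2.mul ((hc 0).mul_const p))).add
    ((d2.mul ((hc 0).mul_const p)).add (d1.mul (((hs 0).neg.mul_const p).mul_const p)))).unique
      (((((hs 0).neg.mul_const p).const_mul p).add ((((hs 0).neg.mul_const p).const_mul p).add
        ((hl 0).mul (((hc 0).mul_const p).neg.mul_const p)))).congr_of_eventuallyEq h2))
  simp only [mul_zero, Complex.cos_zero, Complex.sin_zero, neg_zero, h0, Pi.neg_apply] at h3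
  have : 3 * p * (deriv (deriv P) 0 + 2 * p ^ 2 / 3) = 0 := by
    linear_combination h3
  simpa [hpi, add_eq_zero_iff_eq_neg] using this

/-- The normalized quotient `4 ^ a (1)_a / (1/2)_a`. -/
noncomputable def gammaQuot (a : ℂ) : ℂ := 4 ^ a * (risingC 1 a / risingC (1 / 2) a)

/-- The logarithmic derivative at 0 is log 4 + ψ(1) - ψ(1/2) = 2 log 2 + 2 log 2, with Euler's
constant cancelling. -/
theorem hasDerivAt_gammaQuot_zero : HasDerivAt gammaQuot (4 * Real.log 2) 0 := by
  have hsq : (√Real.pi : ℂ) ≠ 0 := by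
    exact_mod_cast (Real.sqrt_pos.2 Real.pi_pos).ne'
  have h1 : HasDerivAt (fun a : ℂ => Complex.Gamma (1 + a)) (-Real.eulerMascheroniConstant) 0 :=
    HasDerivAt.comp_const_add 1 0 (by simpa using Complex.hasDerivAt_Gamma_one)
  have h2 : HasDerivAt (fun a : ℂ => Complex.Gamma (1 / 2 + a))
      (-√Real.pi * (Real.eulerMascheroniConstant + 2 * Complex.log 2)) 0 :=
    HasDerivAt.comp_const_add (1 / 2) 0
      (by simpa only [add_zero] using Complex.hasDerivAt_Gamma_one_half)
  have hG : Complex.Gamma (1 / 2) = √Real.pi := by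
    rw [show (1 / 2 : ℂ) = ((1 / 2 : ℝ) : ℂ) by push_cast; rfl, Complex.Gamma_ofReal,
      Real.Gamma_one_half_eq]
  have h4 : HasDerivAt (fun a : ℂ => (4 : ℂ) ^ a) (2 * Complex.log 2) 0 := by
    have := (hasDerivAt_id (0 : ℂ)).const_cpow (c := 4) (Or.inl (by norm_num))
    simp only [id, Complex.cpow_zero, one_mul, mul_one] at this
    convert! this using 1
    rw [← Complex.ofNat_log, ← Complex.ofNat_log, show (4 : ℝ) = 2 ^ 2 by norm_num, Real.log_pow]
    push_cast
    rfl
  have := h4.mul ((h1.div_const (Complex.Gamma 1)).div (h2.div_const (Complex.Gamma (1 / 2))) (by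
    rw [add_zero, hG, div_self hsq]; exact one_ne_zero))
  refine this.congr_deriv ?_
  rw [Pi.div_apply, add_zero, add_zero, hG, Complex.Gamma_one, Complex.cpow_zero,
    Complex.ofReal_log zero_le_two]
  push_cast
  field_simp
  ring

theorem differentiableAt_gammaQuot {a : ℂ} (h : -1 / 2 < a.re) : DifferentiableAt ℂ gammaQuot a := by
  have h1 : DifferentiableAt ℂ (fun a => risingC 1 a) a := by
    unfold risingC
    refine DifferentiableAt.div_const (DifferentiableAt.comp a
      (Complex.differentiableAt_Gamma _ (ne_neg_nat_of_re_pos ?_)) (by fun_prop)) _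
    simp; linarith
  have h2 : DifferentiableAt ℂ (fun a => risingC (1 / 2) a) a := by
    unfold risingC
    refine DifferentiableAt.div_const (DifferentiableAt.comp a
      (Complex.differentiableAt_Gamma _ (ne_neg_nat_of_re_pos ?_)) (by fun_prop)) _
    norm_num; linarith
  have h3 : risingC (1 / 2) a ≠ 0 := div_ne_zero
    (Complex.Gamma_ne_zero_of_re_pos (by norm_num; linarith))
    (Complex.Gamma_ne_zero_of_re_pos (by norm_num))
  have h4 : DifferentiableAt ℂ (fun a : ℂ => (4 : ℂ) ^ a) a :=
    differentiableAt_id.const_cpow (Or.inl (by norm_num))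
  exact h4.mul (h1.div h2 h3)

/-- The reflection formula for Γ(1 ± a) and for Γ(1/2 ± a). Multiplying by the sine keeps the
identity true at a = 0. -/
theorem gammaQuot_mul_gammaQuot_neg {a : ℂ} (h : |a.re| < 1 / 2) :
    gammaQuot a * gammaQuot (-a) * Complex.sin (Real.pi * a) =
      Real.pi * a * Complex.cos (Real.pi * a) := by
  obtain ⟨hl, hr⟩ := abs_lt.1 h
  rcases eq_or_ne a 0 with rfl | ha
  · simp
  have hpi : (Real.pi : ℂ) ≠ 0 := by exact_mod_cast Real.pi_ne_zero
  have g1 := Complex.Gamma_ne_zero_of_re_pos (s := 1 + a) (by simp; linarith)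
  have g2 := Complex.Gamma_ne_zero_of_re_pos (s := 1 - a) (by simp; linarith)
  have g3 := Complex.Gamma_ne_zero_of_re_pos (s := 1 / 2 + a) (by norm_num; linarith)
  have g4 := Complex.Gamma_ne_zero_of_re_pos (s := 1 / 2 - a) (by norm_num; linarith)
  have r1 : Complex.Gamma (1 + a) * Complex.Gamma (1 - a) =
      a * (Real.pi / Complex.sin (Real.pi * a)) := by
    rw [← Complex.Gamma_mul_Gamma_one_sub, add_comm 1 a, Complex.Gamma_add_one a ha, mul_assoc]
  have r2 : Complex.Gamma (1 / 2 + a) * Complex.Gamma (1 / 2 - a) =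
      Real.pi / Complex.cos (Real.pi * a) := by
    have := Complex.Gamma_mul_Gamma_one_sub (1 / 2 + a)
    rwa [show 1 - (1 / 2 + a) = 1 / 2 - a by ring,
      show Real.pi * (1 / 2 + a) = Real.pi * a + Real.pi / 2 by ring, Complex.sin_add_pi_div_two]
      at this
  have r3 : Complex.Gamma (1 / 2) * Complex.Gamma (1 / 2) = Real.pi := by
    have := Complex.Gamma_mul_Gamma_one_sub (1 / 2)
    rw [show (1 : ℂ) - 1 / 2 = 1 / 2 by norm_num, mul_one_div, Complex.sin_pi_div_two, div_one]
      at this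
    exact this
  have hs : Complex.sin (Real.pi * a) ≠ 0 := fun h0 => mul_ne_zero g1 g2 (by rw [r1, h0]; simp)
  have hc : Complex.cos (Real.pi * a) ≠ 0 := fun h0 => mul_ne_zero g3 g4 (by rw [r2, h0]; simp)
  have h4 : (4 : ℂ) ^ a * 4 ^ (-a) = 1 := by
    rw [← Complex.cpow_add _ _ (by norm_num), add_neg_cancel, Complex.cpow_zero]
  have key : gammaQuot a * gammaQuot (-a) =
      ((4 : ℂ) ^ a * 4 ^ (-a)) * (Complex.Gamma (1 + a) * Complex.Gamma (1 - a)) *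
        (Complex.Gamma (1 / 2) * Complex.Gamma (1 / 2)) /
        (Complex.Gamma (1 / 2 + a) * Complex.Gamma (1 / 2 - a)) := by
    simp only [gammaQuot, risingC, Complex.Gamma_one, ← sub_eq_add_neg]
    field_simp
  rw [key, h4, r1, r2, r3]
  generalize Complex.sin (Real.pi * a) = s at *
  generalize Complex.cos (Real.pi * a) = c at *
  field_simp

theorem eventually_abs_re_lt : ∀ᶠ a : ℂ in 𝓝 0, |a.re| < 1 / 2 := by
  have : Continuous fun a : ℂ => |a.re| := by fun_prop
  exact this.continuousAt.eventually_lt continuousAt_const (by simp)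

theorem hasJet_gammaQuot : HasJet gammaQuot 1 (4 * Real.log 2)
    ((4 * Real.log 2) ^ 2 - (Real.pi : ℂ) ^ 2 / 3) := by
  have hA : AnalyticAt ℂ gammaQuot 0 := by
    rw [Complex.analyticAt_iff_eventually_differentiableAt]
    filter_upwards [eventually_abs_re_lt] with a ha
    exact differentiableAt_gammaQuot (by linarith [(abs_lt.1 ha).1])
  have h0 : gammaQuot 0 = 1 := by
    have : Complex.Gamma (1 / 2) ≠ 0 := Complex.Gamma_ne_zero_of_re_pos (by norm_num)
    rw [gammaQuot, risingC, risingC, add_zero, add_zero, Complex.cpow_zero, div_self this,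
      Complex.Gamma_one]
    norm_num
  have hJ := HasJet.of_analyticAt hA
  rw [h0, hasDerivAt_gammaQuot_zero.deriv] at hJ
  -- The second derivative of Q(a)Q(-a) at 0 is 2Q''(0) - 2Q'(0)², so πa cot(πa) yields Q''(0)
  -- without polygamma values.
  have hP := hJ.mul hJ.comp_neg
  have h2 := deriv_deriv_of_mul_sin_eq hP.analyticAt (by rw [hP.apply_zero, one_mul])
    (eventually_abs_re_lt.mono fun a ha => gammaQuot_mul_gammaQuot_neg ha)
  rw [hP.deriv_deriv_zero] at h2
  convert! hJ using 1
  linear_combination -h2 / 2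

theorem differentiableAt_tsum_cubeTerm {a : ℂ} (h : |a.re| < 1 / 2) :
    DifferentiableAt ℂ (fun a => ∑' n, cubeTerm a n) a := by
  obtain ⟨hl, hr⟩ := abs_lt.1 h
  have := differentiableAt_tsum_quotTerm (a := a) 2 (x := 1 / 2) (y := 1) (z := 3 / 2)
    (by linarith) (by linarith) (by linarith) (by push_cast; linarith)
  have e : (fun a => ∑' n, cubeTerm a n) = fun a => ∑' n, quotTerm 2 (1 / 2) 1 (3 / 2) a n := by
    funext a
    refine tsum_congr fun n => ?_
    rw [cubeTerm, quotTerm]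
    push_cast
    rw [add_comm (1 / 2 : ℂ)]
  rwa [e]

theorem cos_ne_zero_of_abs_re_lt {a : ℂ} (h : |a.re| < 1 / 2) :
    Complex.cos (Real.pi * a) ≠ 0 := by
  obtain ⟨hl, hr⟩ := abs_lt.1 h
  have h1 := Complex.Gamma_mul_Gamma_one_sub (1 / 2 + a)
  rw [show Real.pi * (1 / 2 + a) = Real.pi * a + Real.pi / 2 by ring,
    Complex.sin_add_pi_div_two] at h1
  intro h0
  rw [h0, div_zero] at h1
  exact mul_ne_zero (Complex.Gamma_ne_zero_of_re_pos (by norm_num; linarith))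
    (Complex.Gamma_ne_zero_of_re_pos (by norm_num; linarith)) h1

theorem four_pow_cpow (n : ℕ) (a : ℂ) : ((4 : ℂ) ^ n) ^ a = ((4 : ℂ) ^ a) ^ n := by
  rw [show (4 : ℂ) = 2 ^ 2 by norm_num, ← pow_mul, two_pow_cpow, two_pow_cpow, pow_mul]

theorem scale_eq_gammaQuot (a : ℂ) :
    scale a = 8 / Real.pi * (gammaQuot a ^ 2 / Complex.cos (Real.pi * a)) := by
  have h := four_pow_cpow 2 a
  norm_num at h
  rw [scale, gammaQuot, h]
  ring

/-- The coefficient of `a ^ 2` in the third form of `f`. -/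
noncomputable def remainder (a : ℂ) : ℂ :=
  (scale a * (128 / (2 * a - 1) * squareSum a) +
    2048 * a / (2 * a - 1) * ∑' n, cubeTerm a n) * Complex.cos (Real.pi * a) ^ 3

/-- Multiplying the third form by cos³(πa) clears the cosines, so sums and products of jets suffice.
-/
theorem f_mul_cos_pow {a : ℂ} (h : |a.re| < 1 / 2) :
    f a * Complex.cos (Real.pi * a) ^ 3 =
      128 / (Real.pi : ℂ) ^ 2 * gammaQuot a ^ 5 + a ^ 2 * remainder a := by
  obtain ⟨hl, hr⟩ := abs_lt.1 h
  have hc := cos_ne_zero_of_abs_re_lt h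
  have ha := mem_domain_of_re (a := a) (by linarith)
  have h4 := four_pow_cpow 5 a
  norm_num at h4
  rw [f_eq_third ha hc hr, remainder, gammaQuot, h4,
    tsum_squareTerm_eq (two_mul_add_one_ne ha hc) (half_sub_ne hc) hr]
  generalize (2 * a - 1) = d
  generalize Complex.cos (Real.pi * a) = c at *
  field_simp
  ring

theorem analyticAt_remainder : AnalyticAt ℂ remainder 0 := by
  rw [Complex.analyticAt_iff_eventually_differentiableAt]
  filter_upwards [eventually_abs_re_lt] with a h
  obtain ⟨hl, hr⟩ := abs_lt.1 h
  have h1 : 2 * a - 1 ≠ 0 := fun h0 => by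
    have := congrArg Complex.re h0
    simp at this
    linarith
  have h2 := differentiableAt_squareSum (a := a) (by linarith) hr
  have h3 := differentiableAt_tsum_cubeTerm h
  have h4 := differentiableAt_gammaQuot (a := a) (by linarith)
  have h5 := cos_ne_zero_of_abs_re_lt h
  unfold remainder
  simp only [scale_eq_gammaQuot]
  fun_prop (disch := assumption)

/-- The `squareTerm` series at 0 is the arcsine series at 1, that is π/2, and (8/π)(-128)(π/2) =
-512. -/
theorem remainder_zero : remainder 0 = -512 := by
  have h := tsum_squareTerm_eq (a := 0) (ne_neg_nat_of_re_pos (by norm_num))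
    (ne_neg_nat_of_re_pos (by norm_num)) (by norm_num)
  have hpi : (Real.pi : ℂ) ≠ 0 := by exact_mod_cast Real.pi_ne_zero
  rw [remainder, ← h, tsum_squareTerm_zero, scale_eq_gammaQuot, hasJet_gammaQuot.apply_zero]
  simp
  field_simp
  norm_num

theorem hasJet_f : HasJet f (128 / (Real.pi : ℂ) ^ 2) (2560 / (Real.pi : ℂ) ^ 2 * Real.log 2)
    (2560 / (3 * (Real.pi : ℂ) ^ 2) * (60 * Real.log 2 ^ 2 - (Real.pi : ℂ) ^ 2)) := by
  have hpi : (Real.pi : ℂ) ≠ 0 := by exact_mod_cast Real.pi_ne_zero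
  have hA : AnalyticAt ℂ f 0 := by
    rw [Complex.analyticAt_iff_eventually_differentiableAt]
    filter_upwards [eventually_abs_re_lt] with a ha
    exact differentiableAt_f (mem_domain_of_re (by linarith [(abs_lt.1 ha).1]))
  have hJ := HasJet.of_analyticAt hA
  have h1 := hJ.mul hasJet_cos.pow_three
  have h2 := (hasJet_gammaQuot.pow_five.const_mul (128 / (Real.pi : ℂ) ^ 2)).add
    (HasJet.of_analyticAt analyticAt_remainder).sq_mul
  obtain ⟨e0, e1, e2⟩ := h1.unique
    (h2.congr (eventually_abs_re_lt.mono fun a ha => f_mul_cos_pow ha))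
  rw [remainder_zero] at e2
  refine ⟨hA, ?_, ?_, ?_⟩
  · linear_combination e0
  · linear_combination e1
  · have e0' : f 0 = 128 / (Real.pi : ℂ) ^ 2 := by linear_combination e0
    rw [e0'] at e2
    field_simp at e2 ⊢
    linear_combination e2

/-- By the second form the bracket is 2048/(2a - 1) times the `cubeTerm` series, which is continuous
at 0. -/
theorem tendsto_second_form : Tendsto
    (fun a : ℂ => f a / a ^ 3 - 8 / (Real.pi : ℂ) * ((16 : ℂ) ^ a / Complex.cos (Real.pi * a)) *
      (risingC 1 a ^ 2 / risingC (1 / 2) a ^ 2) * (g a / a ^ 3))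
    (𝓝[≠] 0) (𝓝 ((-2048 * ∑' n : ℕ, binomTerm n : ℝ) : ℂ)) := by
  have hc : ContinuousAt (fun a => 2048 / (2 * a - 1) * ∑' n, cubeTerm a n) 0 := by
    refine ContinuousAt.mul (ContinuousAt.div (by fun_prop) (by fun_prop) (by norm_num))
      (differentiableAt_tsum_cubeTerm (by simp)).continuousAt
  have h := hc.tendsto
  rw [tsum_congr cubeTerm_zero, ← Complex.ofReal_tsum] at h
  rw [show ((-2048 * ∑' n : ℕ, binomTerm n : ℝ) : ℂ) =
    2048 / (2 * 0 - 1) * ((∑' n : ℕ, binomTerm n : ℝ) : ℂ) by push_cast; ring]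
  refine (h.mono_left nhdsWithin_le_nhds).congr' ?_
  filter_upwards [self_mem_nhdsWithin, nhdsWithin_le_nhds eventually_abs_re_lt] with a h0 ha
  have h0 : a ≠ 0 := h0
  have hcos := cos_ne_zero_of_abs_re_lt ha
  rw [f_eq_scale_mul_g_add (mem_domain_of_re (by linarith [(abs_lt.1 ha).1])) hcos, ← scale]
  generalize scale a = s
  generalize 2 * a - 1 = d
  field_simp
  ring

end

end RamanujanExt

theorem mainTheorem9 :
    -- the series `f` and `g` converge, and `f` is holomorphic, off the negative integers
    (∀ a ∈ RamanujanExt.domain,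
      Summable (RamanujanExt.fTerm a) ∧ Summable (RamanujanExt.gTerm a)) ∧
    DifferentiableOn ℂ RamanujanExt.f RamanujanExt.domain ∧
    -- first form
    (∀ a : ℂ, 0 < a.re →
      Summable (RamanujanExt.firstTerm a) ∧
      RamanujanExt.f a = 128 * a * ∑' n : ℕ, RamanujanExt.firstTerm a n) ∧
    -- second form
    (∀ a ∈ RamanujanExt.domain, Complex.cos (Real.pi * a) ≠ 0 →
      Summable (RamanujanExt.cubeTerm a) ∧
      RamanujanExt.f a =
        8 / (Real.pi : ℂ) * ((16 : ℂ) ^ a / Complex.cos (Real.pi * a)) *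
            (RamanujanExt.risingC 1 a ^ 2 / RamanujanExt.risingC (1 / 2) a ^ 2) *
            RamanujanExt.g a +
          2048 * a ^ 3 / (2 * a - 1) * ∑' n : ℕ, RamanujanExt.cubeTerm a n) ∧
    -- third form
    (∀ a ∈ RamanujanExt.domain, Complex.cos (Real.pi * a) ≠ 0 → a.re < 1 / 2 →
      Summable (RamanujanExt.squareTerm a) ∧ Summable (RamanujanExt.cubeTerm a) ∧
      RamanujanExt.f a =
        128 / (Real.pi : ℂ) ^ 2 * ((1024 : ℂ) ^ a / Complex.cos (Real.pi * a) ^ 3) *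
            (RamanujanExt.risingC 1 a ^ 5 / RamanujanExt.risingC (1 / 2) a ^ 5) +
          1024 / (Real.pi : ℂ) * ((16 : ℂ) ^ a / Complex.cos (Real.pi * a)) *
            (RamanujanExt.risingC 1 a ^ 2 / RamanujanExt.risingC (1 / 2) a ^ 2) *
            (a ^ 2 / (2 * a - 1)) * ∑' n : ℕ, RamanujanExt.squareTerm a n +
          2048 * a ^ 3 / (2 * a - 1) * ∑' n : ℕ, RamanujanExt.cubeTerm a n) ∧
    -- consequence of the first form
    RamanujanExt.f (1 / 2) = 256 * riemannZeta 3 ∧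
    -- consequences of the second form
    HasSum RamanujanExt.binomTerm (4 * RamanujanExt.catalanG / Real.pi) ∧
    Tendsto
      (fun a : ℂ => RamanujanExt.f a / a ^ 3 -
        8 / (Real.pi : ℂ) * ((16 : ℂ) ^ a / Complex.cos (Real.pi * a)) *
          (RamanujanExt.risingC 1 a ^ 2 / RamanujanExt.risingC (1 / 2) a ^ 2) *
          (RamanujanExt.g a / a ^ 3))
      (𝓝[≠] 0) (𝓝 ((-2048 * ∑' n : ℕ, RamanujanExt.binomTerm n : ℝ) : ℂ)) ∧
    -2048 * ∑' n : ℕ, RamanujanExt.binomTerm n = -8192 * (RamanujanExt.catalanG / Real.pi) ∧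
    -- consequences of the third form
    RamanujanExt.f 0 = 128 / (Real.pi : ℂ) ^ 2 ∧
    deriv RamanujanExt.f 0 = ((2560 / Real.pi ^ 2 * Real.log 2 : ℝ) : ℂ) ∧
    deriv (deriv RamanujanExt.f) 0 =
      ((2560 / (3 * Real.pi ^ 2) * (60 * Real.log 2 ^ 2 - Real.pi ^ 2) : ℝ) : ℂ) := by
  refine ⟨fun a _ => ⟨RamanujanExt.summable_fTerm a, RamanujanExt.summable_gTerm a⟩,
    fun a ha => (RamanujanExt.differentiableAt_f ha).differentiableWithinAt,
    fun a ha => ⟨RamanujanExt.summable_firstTerm ha, RamanujanExt.f_eq_tsum_firstTerm ha⟩,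
    fun a ha hc => ⟨?_, RamanujanExt.f_eq_scale_mul_g_add ha hc⟩,
    fun a ha hc hre => ⟨?_, ?_, ?_⟩, RamanujanExt.f_one_half, RamanujanExt.hasSum_binomTerm,
    RamanujanExt.tendsto_second_form, ?_, RamanujanExt.hasJet_f.apply_zero, ?_, ?_⟩
  · exact RamanujanExt.summable_cubeTerm (RamanujanExt.two_mul_add_one_ne ha hc)
      (RamanujanExt.half_sub_ne hc)
  · exact RamanujanExt.summable_squareTerm (RamanujanExt.two_mul_add_one_ne ha hc)
      (RamanujanExt.half_sub_ne hc) hre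
  · exact RamanujanExt.summable_cubeTerm (RamanujanExt.two_mul_add_one_ne ha hc)
      (RamanujanExt.half_sub_ne hc)
  · rw [RamanujanExt.f_eq_third ha hc hre, RamanujanExt.scale]
    ring
  · rw [RamanujanExt.hasSum_binomTerm.tsum_eq]
    ring
  · rw [RamanujanExt.hasJet_f.deriv_zero]
    push_cast
    ring
  · rw [RamanujanExt.hasJet_f.deriv_deriv_zero]
    push_cast
    ring
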